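/- Let $N\ge 1$, $n=2N$, $\lambda\in\mathbb R\setminus\{0\}$, and put $s=\sin$, $c=\cos$ if $\lambda>0$ and $s=\sinh$, $c=\cosh$ if $\lambda<0$. Let $W$ be an open set of points $(u,x_1,\dots,x_{N-1},y_1,\dots,y_{N-1})$ on which $s(x_\alpha)\neq0$ for all $\alpha$, let $H\in C^\infty(W)$, and consider on $U=\{(u,v,x,y): (u,x,y)\in W\}$ the metric $$ds^2 = 2\,du\,dv+(\lambda v^2+H(u,x,y))\,du^2+\frac1{|\lambda|}\sum_{\alpha=1}^{N-1}\left(dx_\alpha^2+s(x_\alpha)^2\,dy_\alpha^2\right)$$ (the generalized Khlebnikov–Ghanam–Thompson metric built from $N$ blocks of dimension 2). Tensors constructed from given ones are linear combinations, with constant real coefficients, of contractions of tensor products of the given ones. A metric is $k$-universal if every symmetric rank-2 tensor $T_{ab}$ that is constructed from the metric, the Riemann tensor and its covariant derivatives up to order $k$, and is conserved ($\nabla^aT_{ab}=0$), is a constant multiple of the metric. Then: (0) The metric is a smooth Lorentzian metric, and it is Einstein ($R_{ab}=\mathrm{const}\cdot g_{ab}$) if and only if $$\Box H=\sum_{\alpha=1}^{N-1}|\lambda|\left(H_{,x_\alpha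 x_\alpha}+\frac{1}{s(x_\alpha)^2}H_{,y_\alpha y_\alpha}+\frac{c(x_\alpha)}{s(x_\alpha)}H_{,x_\alpha}\right)=0 .$$ Assume from now on that $\Box H=0$. (1) The metric is $0$-universal. (2) Let $L$ be a polynomial curvature invariant (a scalar constructed from the metric, the Riemann tensor and its covariant derivatives of any order), and suppose that its field equations contain no derivatives of the Riemann tensor except derivatives of the Ricci tensor: for all Lorentzian metrics in dimension $n$ the first variation is $\delta\int L\sqrt{|g|}=\int E^{ab}\,\delta g_{ab}\sqrt{|g|}$ for compactly supported $\delta g$, where the symmetric tensor $E_{ab}$ is constructed from the metric, the Riemann tensor, the Ricci tensor and covariant derivatives of the Ricci tensor of any order. Then the metric solves the vacuum field equations of this theory with a suitable cosmological constant: $E_{ab}+\Lambda g_{ab}=0$ for some $\Lambda\in\mathbb R$. (3) In particular, the metric solves the vacuum equations of Lovelock gravity: for all $m$ and all real $c_0,\dots,c_m$ there is $\Lambda\in\mathbb R$ with $\sum_{k=0}^m c_k\,G^{(k)}_{ab}+\Lambda g_{ab}=0$, where $G^{(k)a}{}_b=-2^{-(k+1)}\,\delta^{a c_1\dots c_{2k}}_{b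 d_1\dots d_{2k}}R^{d_1d_2}{}_{c_1c_2}\cdots R^{d_{2k-1}d_{2k}}{}_{c_{2k-1}c_{2k}}$. (4) It also solves the vacuum equations of quadratic gravity: for all real $\kappa\neq0,\alpha,\beta,\gamma$ there is $\Lambda_0\in\mathbb R$ such that $$\begin{aligned}&\tfrac1\kappa\left(R_{ab}-\tfrac12Rg_{ab}+\Lambda_0g_{ab}\right)+2\alpha R\left(R_{ab}-\tfrac14Rg_{ab}\right)+(2\alpha+\beta)\left(g_{ab}\Box-\nabla_a\nabla_b\right)R\\&+2\gamma\left[RR_{ab}-2R_{acbd}R^{cd}+R_{acde}R_b{}^{cde}-2R_{ac}R_b{}^c-\tfrac14g_{ab}\left(R_{cdef}R^{cdef}-4R_{cd}R^{cd}+R^2\right)\right]\\&+\beta\,\Box\left(R_{ab}-\tfrac12Rg_{ab}\right)+2\beta\left(R_{acbd}-\tfrac14g_{ab}R_{cd}\right)R^{cd}=0 .\end{aligned}$$ -/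

import Mathlib

open scoped ContDiff

noncomputable section

namespace KGT

/-! ### Pseudo-Riemannian geometry in one coordinate chart

`ι` is the finite index set of the coordinates, a point is `p : ι → ℝ`, and a metric is given by
its matrix of components `g p a b`. All tensors are covariant; indices are raised with the inverse
matrix. -/

section Geometry

variable {ι : Type} [Fintype ι] [DecidableEq ι]

/-- The partial derivative `∂ᵢ f` at `p`. -/
def pd (i : ι) (f : (ι → ℝ) → ℝ) (p : ι → ℝ) : ℝ := fderiv ℝ f p (Pi.single i 1)

/-- Components of a covariant tensor field of rank `r`. -/
abbrev TensorField (ι : Type) (r : ℕ) : Type := (ι → ℝ) → (Fin r → ι) → ℝ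

/-- `g` is a smooth metric of Lorentzian signature `(-,+,…,+)` on the set `U`. -/
def IsLorentzianOn (g : (ι → ℝ) → Matrix ι ι ℝ) (U : Set (ι → ℝ)) : Prop :=
  (∀ a b, ContDiffOn ℝ ∞ (fun p => g p a b) U) ∧
  ∀ p ∈ U, ∃ (i₀ : ι) (P : Matrix ι ι ℝ), IsUnit P.det ∧
    P.transpose * g p * P = Matrix.diagonal (fun i => if i = i₀ then -1 else 1)

/-- The Christoffel symbol `Γᵈ_{ab}`. -/
def christoffel (g : (ι → ℝ) → Matrix ι ι ℝ) (d a b : ι) (p : ι → ℝ) : ℝ :=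
  (1 / 2) * ∑ e, (g p)⁻¹ d e *
    (pd a (fun q => g q e b) p + pd b (fun q => g q e a) p - pd e (fun q => g q a b) p)

/-- `Rᵃ_{bcd} = ∂_c Γᵃ_{db} - ∂_d Γᵃ_{cb} + Γᵃ_{ce} Γᵉ_{db} - Γᵃ_{de} Γᵉ_{cb}`. -/
def riemannUp (g : (ι → ℝ) → Matrix ι ι ℝ) (a b c d : ι) (p : ι → ℝ) : ℝ :=
  pd c (christoffel g a d b) p - pd d (christoffel g a c b) p
    + ∑ e, (christoffel g a c e p * christoffel g e d b p
      - christoffel g a d e p * christoffel g e c b p)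

/-- The Riemann tensor `R_{abcd}`. -/
def riemann (g : (ι → ℝ) → Matrix ι ι ℝ) : TensorField ι 4 :=
  fun p i => ∑ e, g p (i 0) e * riemannUp g e (i 1) (i 2) (i 3) p

/-- The Ricci tensor `R_{bd} = Rᵃ_{bad}`. -/
def ricci (g : (ι → ℝ) → Matrix ι ι ℝ) : TensorField ι 2 :=
  fun p i => ∑ a, riemannUp g a (i 0) a (i 1) p

/-- The metric as a tensor field of rank two. -/
def metricTensor (g : (ι → ℝ) → Matrix ι ι ℝ) : TensorField ι 2 := fun p i => g p (i 0) (i 1)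

/-- Contraction of the first two indices with the inverse metric. -/
def contract (g : (ι → ℝ) → Matrix ι ι ℝ) {r : ℕ} (T : TensorField ι (r + 2)) :
    TensorField ι r :=
  fun p i => ∑ a, ∑ b, (g p)⁻¹ a b *
    T p (Fin.cons (α := fun _ => ι) a (Fin.cons (α := fun _ => ι) b i))

/-- The covariant derivative `∇_c T_{i₁…i_r}`; the index `c` of the derivative comes first. -/
def covD (g : (ι → ℝ) → Matrix ι ι ℝ) {r : ℕ} (T : TensorField ι r) : TensorField ι (r + 1) :=
  fun p i => pd (i 0) (fun q => T q (Fin.tail i)) p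
    - ∑ j : Fin r, ∑ d, christoffel g d (i 0) (i j.succ) p * T p (Function.update (Fin.tail i) j d)

/-- The iterated covariant derivative `∇ʲ T`. -/
def covDIter (g : (ι → ℝ) → Matrix ι ι ℝ) {r : ℕ} (T : TensorField ι r) :
    (j : ℕ) → TensorField ι (r + j)
  | 0 => T
  | j + 1 => covD g (covDIter g T j)

/-- The tensor product. -/
def tprod {r s : ℕ} (T : TensorField ι r) (S : TensorField ι s) : TensorField ι (r + s) :=
  fun p i => T p (fun k => i (Fin.castAdd s k)) * S p (fun k => i (Fin.natAdd r k))

end Geometry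

/-! ### Tensors constructed from the metric and the curvature -/

/-- Formal expressions for tensors of rank `r` constructed polynomially (linear combinations with
real coefficients of contractions of tensor products) from the metric, the covariant derivatives
`∇ʲ Riem` of the Riemann tensor and the covariant derivatives `∇ʲ Ric` of the Ricci tensor. -/
inductive CurvExpr : ℕ → Type
  | const (c : ℝ) : CurvExpr 0
  | metric : CurvExpr 2
  | riem (j : ℕ) : CurvExpr (4 + j)
  | ric (j : ℕ) : CurvExpr (2 + j)
  | add {r : ℕ} (T S : CurvExpr r) : CurvExpr r
  | smul {r : ℕ} (c : ℝ) (T : CurvExpr r) : CurvExpr r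
  | prod {r s : ℕ} (T : CurvExpr r) (S : CurvExpr s) : CurvExpr (r + s)
  | perm {r : ℕ} (σ : Equiv.Perm (Fin r)) (T : CurvExpr r) : CurvExpr r
  | contr {r : ℕ} (T : CurvExpr (r + 2)) : CurvExpr r

namespace CurvExpr

/-- The highest order of a covariant derivative of the curvature in the expression. -/
def order : {r : ℕ} → CurvExpr r → ℕ
  | _, const _ => 0
  | _, metric => 0
  | _, riem j => j
  | _, ric j => j
  | _, add T S => max T.order S.order
  | _, smul _ T => T.order
  | _, prod T S => max T.order S.order
  | _, perm _ T => T.order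
  | _, contr T => T.order

/-- The expression contains no covariant derivative of the Riemann tensor
(covariant derivatives of the Ricci tensor may occur). -/
def NoRiemannDerivatives : {r : ℕ} → CurvExpr r → Prop
  | _, const _ => True
  | _, metric => True
  | _, riem j => j = 0
  | _, ric _ => True
  | _, add T S => T.NoRiemannDerivatives ∧ S.NoRiemannDerivatives
  | _, smul _ T => T.NoRiemannDerivatives
  | _, prod T S => T.NoRiemannDerivatives ∧ S.NoRiemannDerivatives
  | _, perm _ T => T.NoRiemannDerivatives
  | _, contr T => T.NoRiemannDerivatives

/-- The tensor field that the expression denotes for the metric `g`. -/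
def eval {ι : Type} [Fintype ι] [DecidableEq ι] (g : (ι → ℝ) → Matrix ι ι ℝ) :
    {r : ℕ} → CurvExpr r → TensorField ι r
  | _, const c => fun _ _ => c
  | _, metric => metricTensor g
  | _, riem j => covDIter g (riemann g) j
  | _, ric j => covDIter g (ricci g) j
  | _, add T S => fun p i => T.eval g p i + S.eval g p i
  | _, smul c T => fun p i => c * T.eval g p i
  | _, prod T S => tprod (T.eval g) (S.eval g)
  | _, perm σ T => fun p i => T.eval g p (fun k => i (σ k))
  | _, contr T => contract g (T.eval g)

end CurvExpr

section Theories

variable {ι : Type} [Fintype ι] [DecidableEq ι]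

/-- `T_{ab} = T_{ba}` on `U`. -/
def IsSymmetricOn (T : TensorField ι 2) (U : Set (ι → ℝ)) : Prop :=
  ∀ p ∈ U, ∀ a b, T p ![a, b] = T p ![b, a]

/-- `∇ᵃ T_{ab} = 0` on `U`. -/
def IsConservedOn (g : (ι → ℝ) → Matrix ι ι ℝ) (T : TensorField ι 2) (U : Set (ι → ℝ)) : Prop :=
  ∀ p ∈ U, ∀ b, contract g (covD g T) p ![b] = 0

/-- The metric `g` on `U` is `k`-universal: every conserved symmetric rank-2 tensor constructed from
the metric, the Riemann tensor and its covariant derivatives up to order `k` is a constant multiple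
of the metric. -/
def IsKUniversal (k : ℕ) (g : (ι → ℝ) → Matrix ι ι ℝ) (U : Set (ι → ℝ)) : Prop :=
  ∀ T : CurvExpr 2, T.order ≤ k → IsSymmetricOn (T.eval g) U → IsConservedOn g (T.eval g) U →
    ∃ c : ℝ, ∀ p ∈ U, ∀ a b, T.eval g p ![a, b] = c * g p a b

/-- The metric `g` on `U` is Einstein: `R_{ab} = c g_{ab}` with a constant `c`. -/
def IsEinsteinOn (g : (ι → ℝ) → Matrix ι ι ℝ) (U : Set (ι → ℝ)) : Prop :=
  ∃ c : ℝ, ∀ p ∈ U, ∀ a b, ricci g p ![a, b] = c * g p a b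

/-- The Lagrangian density `L √|det g|`. -/
def density (L : CurvExpr 0) (g : (ι → ℝ) → Matrix ι ι ℝ) (p : ι → ℝ) : ℝ :=
  L.eval g p ![] * Real.sqrt |(g p).det|

/-- `E_{ab}` is the tensor of the field equations derived from the Lagrangian `L`, in a spacetime
with coordinates indexed by `ι`: it is symmetric, and the first variation of the action is
`δ ∫ L √|det g| = ∫ Eᵃᵇ δg_{ab} √|det g|` for every Lorentzian metric `g` on an open set `U` and
every smooth symmetric variation `δg = h` that vanishes outside a compact subset `K` of `U`. -/
def IsFieldTensor (ι : Type) [Fintype ι] [DecidableEq ι] (L : CurvExpr 0) (E : CurvExpr 2) :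
    Prop :=
  ∀ (U : Set (ι → ℝ)) (g : (ι → ℝ) → Matrix ι ι ℝ), IsOpen U → IsLorentzianOn g U →
    IsSymmetricOn (E.eval g) U ∧
    ∀ (h : (ι → ℝ) → Matrix ι ι ℝ) (K : Set (ι → ℝ)),
      (∀ a b, ContDiff ℝ ∞ (fun p => h p a b)) → (∀ p, (h p).IsSymm) →
      IsCompact K → K ⊆ U → (∀ p, p ∉ K → h p = 0) →
      HasDerivAt (fun ε : ℝ => ∫ p in K, density L (fun q => g q + ε • h q) p)
        (∫ p in K, (∑ a, ∑ b, ∑ c, ∑ d, (g p)⁻¹ a c * (g p)⁻¹ b d * E.eval g p ![a, b] * h p c d)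
          * Real.sqrt |(g p).det|) 0

/-- `g` solves on `U` the vacuum field equations `E_{ab} + Λ g_{ab} = 0` for some value of the
cosmological constant `Λ`. -/
def SolvesVacuum (E : TensorField ι 2) (g : (ι → ℝ) → Matrix ι ι ℝ) (U : Set (ι → ℝ)) : Prop :=
  ∃ Λ : ℝ, ∀ p ∈ U, ∀ a b, E p ![a, b] + Λ * g p a b = 0

/-! ### Lovelock gravity -/

/-- `Rᵃᵇ_{cd}`. -/
def riemannMixed (g : (ι → ℝ) → Matrix ι ι ℝ) (a b c d : ι) (p : ι → ℝ) : ℝ :=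
  ∑ e, ∑ f, (g p)⁻¹ a e * (g p)⁻¹ b f * riemann g p ![e, f, c, d]

/-- The generalized Kronecker delta with upper indices `A` and lower indices `B`. -/
def genDelta {κ : Type} [Fintype κ] [DecidableEq κ] (A B : κ → ι) : ℝ :=
  Matrix.det (Matrix.of fun s t => if A s = B t then (1 : ℝ) else 0)

/-- The Lovelock tensor of degree `k`, with the first index lowered:
`Gᵃ_b = -2^{-(k+1)} δ^{a c₁ c₂ … c_{2k}}_{b d₁ d₂ … d_{2k}} R^{d₁d₂}_{c₁c₂} ⋯`. -/
def lovelock (k : ℕ) (g : (ι → ℝ) → Matrix ι ι ℝ) : TensorField ι 2 :=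
  fun p i => ∑ a, g p (i 0) a *
    (-(1 / 2 ^ (k + 1)) * ∑ c : Fin k × Fin 2 → ι, ∑ d : Fin k × Fin 2 → ι,
      genDelta (fun s : Option (Fin k × Fin 2) => s.elim a c)
          (fun s : Option (Fin k × Fin 2) => s.elim (i 1) d) *
        ∏ l : Fin k, riemannMixed g (d (l, 0)) (d (l, 1)) (c (l, 0)) (c (l, 1)) p)

/-- The field equations of Lovelock gravity: a linear combination of Lovelock tensors
of degree at most `m`. -/
def lovelockTensor (m : ℕ) (coef : ℕ → ℝ) (g : (ι → ℝ) → Matrix ι ι ℝ) : TensorField ι 2 :=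
  fun p i => ∑ k ∈ Finset.range (m + 1), coef k * lovelock k g p i

/-! ### Quadratic gravity -/

/-- The scalar curvature. -/
def scalarCurv (g : (ι → ℝ) → Matrix ι ι ℝ) : TensorField ι 0 := contract g (ricci g)

/-- `R^{cd}`. -/
def ricciUp (g : (ι → ℝ) → Matrix ι ι ℝ) (c d : ι) (p : ι → ℝ) : ℝ :=
  ∑ e, ∑ f, (g p)⁻¹ c e * (g p)⁻¹ d f * ricci g p ![e, f]

/-- `R_{acbd} R^{cd}`. -/
def riemRic (g : (ι → ℝ) → Matrix ι ι ℝ) : TensorField ι 2 :=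
  fun p i => ∑ c, ∑ d, riemann g p ![i 0, c, i 1, d] * ricciUp g c d p

/-- `R_{ac} R_b{}^c`. -/
def ricRic (g : (ι → ℝ) → Matrix ι ι ℝ) : TensorField ι 2 :=
  fun p i => ∑ c, ∑ d, (g p)⁻¹ c d * ricci g p ![i 0, c] * ricci g p ![i 1, d]

/-- `R_{acde} R_b{}^{cde}`. -/
def riemRiem (g : (ι → ℝ) → Matrix ι ι ℝ) : TensorField ι 2 :=
  fun p i => ∑ c, ∑ d, ∑ e, ∑ c', ∑ d', ∑ e', (g p)⁻¹ c c' * (g p)⁻¹ d d' * (g p)⁻¹ e e' *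
    riemann g p ![i 0, c, d, e] * riemann g p ![i 1, c', d', e']

/-- The Einstein tensor `R_{ab} - R g_{ab} / 2`. -/
def einstein (g : (ι → ℝ) → Matrix ι ι ℝ) : TensorField ι 2 :=
  fun p i => ricci g p i - (1 / 2) * scalarCurv g p ![] * metricTensor g p i

/-- The field equations of quadratic gravity with the Lagrangian
`(R - 2 Λ₀)/κ + α R² + β R_{ab}R^{ab} + γ (R_{abcd}R^{abcd} - 4 R_{ab}R^{ab} + R²)`. -/
def quadraticGravityTensor (κ Λ₀ α β γ : ℝ) (g : (ι → ℝ) → Matrix ι ι ℝ) : TensorField ι 2 :=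
  fun p i =>
    let R := scalarCurv g p ![]
    let Ric2 := contract g (ricRic g) p ![]
    let Riem2 := contract g (riemRiem g) p ![]
    (1 / κ) * (einstein g p i + Λ₀ * metricTensor g p i)
      + 2 * α * R * (ricci g p i - (1 / 4) * R * metricTensor g p i)
      + (2 * α + β) * (metricTensor g p i * contract g (covD g (covD g (scalarCurv g))) p ![]
          - covD g (covD g (scalarCurv g)) p i)
      + 2 * γ * (R * ricci g p i - 2 * riemRic g p i + riemRiem g p i - 2 * ricRic g p i
          - (1 / 4) * metricTensor g p i * (Riem2 - 4 * Ric2 + R ^ 2))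
      + β * contract g (covD g (covD g (einstein g))) p i
      + 2 * β * (riemRic g p i - (1 / 4) * metricTensor g p i * Ric2)

end Theories

/-! ### The generalized Khlebnikov–Ghanam–Thompson metric with `N` blocks of dimension two -/

/-- The coordinates `u, v` and `x_α, y_α` for `α = 1, …, N - 1`. -/
abbrev Coord (N : ℕ) : Type := Fin 2 ⊕ (Fin (N - 1) × Fin 2)

/-- The index of the coordinate `u`. -/
abbrev cu {N : ℕ} : Coord N := Sum.inl 0

/-- The index of the coordinate `v`. -/
abbrev cv {N : ℕ} : Coord N := Sum.inl 1

/-- The index of the coordinate `x_α`. -/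
abbrev cx {N : ℕ} (α : Fin (N - 1)) : Coord N := Sum.inr (α, 0)

/-- The index of the coordinate `y_α`. -/
abbrev cy {N : ℕ} (α : Fin (N - 1)) : Coord N := Sum.inr (α, 1)

/-- The space of the variables `(u, x, y)` of the function `H`. -/
abbrev HSpace (N : ℕ) : Type := ℝ × (Fin (N - 1) → ℝ) × (Fin (N - 1) → ℝ)

/-- The variables `(u, x, y)` at a point of the spacetime. -/
def toHSpace {N : ℕ} (p : Coord N → ℝ) : HSpace N := (p cu, fun α => p (cx α), fun α => p (cy α))

/-- `sin` for positive and `sinh` for negative `lam`. -/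
def sFun (lam x : ℝ) : ℝ := if 0 < lam then Real.sin x else Real.sinh x

/-- `cos` for positive and `cosh` for negative `lam`. -/
def cFun (lam x : ℝ) : ℝ := if 0 < lam then Real.cos x else Real.cosh x

/-- The metric
`2 du dv + (lam v² + H(u, x, y)) du² + |lam|⁻¹ ∑_α (dx_α² + s(x_α)² dy_α²)`. -/
def kgtMetric {N : ℕ} (lam : ℝ) (H : HSpace N → ℝ) (p : Coord N → ℝ) :
    Matrix (Coord N) (Coord N) ℝ :=
  Matrix.fromBlocks !![lam * p cv ^ 2 + H (toHSpace p), 1; 1, 0] 0 0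
    (Matrix.diagonal fun i : Fin (N - 1) × Fin 2 =>
      (1 / |lam|) * if i.2 = 0 then 1 else sFun lam (p (cx i.1)) ^ 2)

/-- `□H = ∑_α |lam| (H_{,x_α x_α} + s(x_α)⁻² H_{,y_α y_α} + (c(x_α)/s(x_α)) H_{,x_α})`. -/
def boxH {N : ℕ} (lam : ℝ) (H : HSpace N → ℝ) (p : Coord N → ℝ) : ℝ :=
  ∑ α : Fin (N - 1), |lam| *
    (pd (cx α) (pd (cx α) fun q : Coord N → ℝ => H (toHSpace q)) p
      + (1 / sFun lam (p (cx α)) ^ 2) *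
        pd (cy α) (pd (cy α) fun q : Coord N → ℝ => H (toHSpace q)) p
      + (cFun lam (p (cx α)) / sFun lam (p (cx α))) *
        pd (cx α) (fun q : Coord N → ℝ => H (toHSpace q)) p)

end KGT

end

/-! Everything reduces to linear algebra at a point. With `∧` for the Kulkarni–Nomizu product, the
curvature tensor is `(lam / 2) ∑ B_b ∧ B_b + ℓ² ∧ h`. Here the `B_b` are the metrics of the `N`
two-dimensional blocks, `ℓ = du`, and `h` is a transverse tensor made from the covariant Hessian of
`H`, with trace `-□H / 2` (`riemann_kgtMetric`, `riemannC_eq`, `sum_kgtInv_mul_waveTensor`). The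
term `lam v²` gives the `(u, v)` block the same constant curvature `lam` that the surfaces `(x_α,
y_α)` have. Hence the Ricci tensor is `lam g - (□H / 2) du²`, which settles the Einstein condition.

Over `ℂ` every block has a basis of two null vectors, so the Lorentzian block and the Riemannian
ones look alike. Let `F` be a rank-two operation on metric and curvature that is frame independent
and complex differentiable in the curvature (`IsNatural`). Rescaling the null directions of the
first block by `s` and `s⁻¹` replaces `h` by `s² h`, so each component of `F` has a definite weight
under `h ↦ s² h`. The weight decides its fate: the component along `ℓ²` is homogeneous of degree one
in `h`, hence linear by differentiability at `0`; invariance under rescalings inside the transverse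
blocks and under permutations of them makes it a multiple of the trace of `h`, which vanishes when
`□H = 0` (`nullValue_uu`); every other component is the same as for `h = 0`, by `s → 0` or `s = -1`
(`nullValue_eq_zero_apply`); for `h = 0` all blocks are interchangeable and only a multiple of the
metric is left (`nullValue_zero`). The factor does not involve `h`, so it is the same at all points
(`exists_natural_eq_smul_metricC`).

It remains to recognize natural operations. A curvature expression without derivatives of the
Riemann tensor is one, because the Ricci tensor is `lam g` and its covariant derivatives vanish
(`ofReal_eval`). The Lovelock tensors are natural because the generalized Kronecker delta is an
invariant tensor (`sum_genDelta_option`). In quadratic gravity each term is a constant multiple of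
the metric, and `Λ₀` solves one scalar linear equation. -/

noncomputable section

set_option linter.unusedSectionVars false

namespace KGT

/-! ### Complex tensors in a frame -/

section Frame

variable {ι κ : Type} [Fintype ι] [DecidableEq ι] [Fintype κ] [DecidableEq κ]

/-- The components of the tensor `T` in the frame formed by the columns of `P`. -/
def frameChange {r : ℕ} (P : Matrix ι κ ℂ) (T : (Fin r → ι) → ℂ) : (Fin r → κ) → ℂ :=
  fun i => ∑ j : Fin r → ι, (∏ k, P (j k) (i k)) * T j

/-- Contraction of the first two indices with `Q`. -/
def contrAt {r : ℕ} (Q : Matrix ι ι ℂ) (T : (Fin (r + 2) → ι) → ℂ) : (Fin r → ι) → ℂ :=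
  fun i => ∑ a, ∑ b, Q a b * T (Fin.cons (α := fun _ => ι) a (Fin.cons (α := fun _ => ι) b i))

lemma sum_fin_succ_arrow {r : ℕ} (f : (Fin (r + 1) → ι) → ℂ) :
    ∑ j, f j = ∑ x, ∑ j : Fin r → ι, f (Fin.cons (α := fun _ => ι) x j) := by
  rw [← Fintype.sum_prod_type']
  exact (Fintype.sum_equiv (Fin.consEquiv fun _ => ι) _ _ fun _ => rfl).symm

lemma frameChange_add {r : ℕ} (P : Matrix ι κ ℂ) (T S : (Fin r → ι) → ℂ) :
    frameChange P (fun i => T i + S i) = fun i => frameChange P T i + frameChange P S i := by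
  funext i
  simp only [frameChange, mul_add, Finset.sum_add_distrib]

lemma frameChange_smul {r : ℕ} (P : Matrix ι κ ℂ) (c : ℂ) (T : (Fin r → ι) → ℂ) :
    frameChange P (fun i => c * T i) = fun i => c * frameChange P T i := by
  funext i
  simp only [frameChange, Finset.mul_sum]
  exact Finset.sum_congr rfl fun _ _ => by ring

lemma frameChange_sub {r : ℕ} (P : Matrix ι κ ℂ) (T S : (Fin r → ι) → ℂ) :
    frameChange P (fun i => T i - S i) = fun i => frameChange P T i - frameChange P S i := by
  funext i
  simp only [frameChange, mul_sub, Finset.sum_sub_distrib]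

lemma frameChange_sum {r : ℕ} {β : Type} (s : Finset β) (P : Matrix ι κ ℂ)
    (T : β → (Fin r → ι) → ℂ) :
    frameChange P (fun i => ∑ b ∈ s, T b i) = fun i => ∑ b ∈ s, frameChange P (T b) i := by
  funext i
  simp only [frameChange, Finset.mul_sum]
  exact Finset.sum_comm

lemma frameChange_const (P : Matrix ι κ ℂ) (c : ℂ) :
    frameChange P (fun _ : Fin 0 → ι => c) = fun _ => c := by
  funext i
  simp [frameChange]

lemma frameChange_zero {r : ℕ} (P : Matrix ι κ ℂ) :
    frameChange P (fun _ : Fin r → ι => 0) = fun _ => 0 := by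
  funext i
  simp [frameChange]

lemma frameChange_two (P : Matrix ι κ ℂ) (M : Matrix ι ι ℂ) :
    frameChange P (fun i : Fin 2 → ι => M (i 0) (i 1)) =
      fun i => (P.transpose * M * P) (i 0) (i 1) := by
  funext i
  simp only [frameChange, sum_fin_succ_arrow, Matrix.mul_apply, Matrix.transpose_apply,
    Finset.sum_mul]
  rw [Finset.sum_comm]
  refine Finset.sum_congr rfl fun x _ => Finset.sum_congr rfl fun y _ => ?_
  simp [Fin.prod_univ_two]
  ring

lemma frameChange_prod {r s : ℕ} (P : Matrix ι κ ℂ) (T : (Fin r → ι) → ℂ)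
    (S : (Fin s → ι) → ℂ) :
    frameChange P (fun i : Fin (r + s) → ι =>
        T (fun k => i (Fin.castAdd s k)) * S (fun k => i (Fin.natAdd r k))) =
      fun i => frameChange P T (fun k => i (Fin.castAdd s k)) *
        frameChange P S (fun k => i (Fin.natAdd r k)) := by
  funext i
  simp only [frameChange]
  rw [Finset.sum_mul_sum, ← Fintype.sum_prod_type']
  refine (Fintype.sum_equiv (Fin.appendEquiv r s) _ _ fun x => ?_).symm
  simp [Fin.appendEquiv, Fin.prod_univ_add]
  ring

lemma frameChange_perm {r : ℕ} (P : Matrix ι κ ℂ) (σ : Equiv.Perm (Fin r))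
    (T : (Fin r → ι) → ℂ) :
    frameChange P (fun i => T (fun k => i (σ k))) =
      fun i => frameChange P T (fun k => i (σ k)) := by
  funext i
  simp only [frameChange]
  refine Fintype.sum_equiv (Equiv.arrowCongr σ.symm (Equiv.refl ι)) _ _ fun x => ?_
  simp only [Equiv.arrowCongr_apply, Equiv.symm_symm, Equiv.coe_refl, Function.comp_apply, id_eq]
  rw [← Equiv.prod_comp σ]
  rfl

lemma sum_rotate {α : Type} [Fintype α] (f : ι → ι → α → κ → κ → ℂ) :
    ∑ x, ∑ y, ∑ j, ∑ a, ∑ b, f x y j a b = ∑ a, ∑ b, ∑ x, ∑ y, ∑ j, f x y j a b := by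
  have h : ∀ g : ι → ι → α → κ → ℂ,
      ∑ x, ∑ y, ∑ j, ∑ a, g x y j a = ∑ a, ∑ x, ∑ y, ∑ j, g x y j a := by
    intro g
    calc _ = ∑ x, ∑ y, ∑ a, ∑ j, g x y j a :=
          Finset.sum_congr rfl fun _ _ => Finset.sum_congr rfl fun _ _ => Finset.sum_comm
      _ = ∑ x, ∑ a, ∑ y, ∑ j, g x y j a :=
          Finset.sum_congr rfl fun _ _ => Finset.sum_comm
      _ = _ := Finset.sum_comm
  rw [h]
  exact Finset.sum_congr rfl fun a _ => h _

/-- Covariant slots transform with `P` and the contracting tensor with `P'`. Carrying `P' * Q *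
P'.transpose` back with `P` returns `Q` as soon as `P * P' = 1`; this is `key`. -/
lemma frameChange_contr {r : ℕ} {P : Matrix ι κ ℂ} {P' : Matrix κ ι ℂ} (h : P * P' = 1)
    (Q : Matrix ι ι ℂ) (T : (Fin (r + 2) → ι) → ℂ) :
    frameChange P (contrAt Q T) = contrAt (P' * Q * P'.transpose) (frameChange P T) := by
  have key : ∀ x y, ∑ a, ∑ b, (P' * Q * P'.transpose) a b * (P x a * P y b) = Q x y := by
    intro x y
    have h2 : P * (P' * Q * P'.transpose) * P.transpose = Q := by
      have : P'.transpose * P.transpose = 1 := by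
        rw [← Matrix.transpose_mul, h, Matrix.transpose_one]
      calc P * (P' * Q * P'.transpose) * P.transpose
          = (P * P') * Q * (P'.transpose * P.transpose) := by simp only [Matrix.mul_assoc]
        _ = Q := by rw [h, this, Matrix.one_mul, Matrix.mul_one]
    generalize P' * Q * P'.transpose = X at h2 ⊢
    rw [← h2, Matrix.mul_apply]
    simp only [Matrix.mul_apply, Matrix.transpose_apply, Finset.sum_mul]
    rw [Finset.sum_comm]
    exact Finset.sum_congr rfl fun _ _ => Finset.sum_congr rfl fun _ _ => by ring
  funext i
  simp only [frameChange, contrAt]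
  calc _ = ∑ x, ∑ y, ∑ j : Fin r → ι, (∏ k, P (j k) (i k)) * (Q x y *
            T (Fin.cons (α := fun _ => ι) x (Fin.cons (α := fun _ => ι) y j))) := by
        simp only [Finset.mul_sum]
        rw [Finset.sum_comm]
        exact Finset.sum_congr rfl fun _ _ => Finset.sum_comm
    _ = ∑ x, ∑ y, ∑ j : Fin r → ι, ∑ a, ∑ b, (P' * Q * P'.transpose) a b *
          (P x a * P y b * (∏ k, P (j k) (i k)) *
            T (Fin.cons (α := fun _ => ι) x (Fin.cons (α := fun _ => ι) y j))) := by
        refine Finset.sum_congr rfl fun x _ => Finset.sum_congr rfl fun y _ =>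
          Finset.sum_congr rfl fun j _ => ?_
        rw [← key x y]
        simp only [Finset.sum_mul, Finset.mul_sum]
        exact Finset.sum_congr rfl fun _ _ => Finset.sum_congr rfl fun _ _ => by ring
    _ = ∑ a, ∑ b, ∑ x, ∑ y, ∑ j : Fin r → ι, (P' * Q * P'.transpose) a b *
          (P x a * P y b * (∏ k, P (j k) (i k)) *
            T (Fin.cons (α := fun _ => ι) x (Fin.cons (α := fun _ => ι) y j))) := by
        exact sum_rotate _
    _ = _ := by
        refine Finset.sum_congr rfl fun a _ => Finset.sum_congr rfl fun b _ => ?_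
        rw [sum_fin_succ_arrow]
        simp only [sum_fin_succ_arrow (r := r), Finset.mul_sum]
        refine Finset.sum_congr rfl fun x _ => Finset.sum_congr rfl fun y _ =>
          Finset.sum_congr rfl fun j _ => ?_
        simp only [Fin.prod_univ_succ, Fin.cons_zero, Fin.cons_succ]
        ring

end Frame

/-! ### Natural operations of rank two -/

/-- A construction of a matrix from the metric `G`, its inverse `Q` and the curvature tensor `R`. -/
abbrev TwoTensorOp : Type 1 :=
  ∀ (ι : Type) [Fintype ι] [DecidableEq ι],
    Matrix ι ι ℂ → Matrix ι ι ℂ → ((Fin 4 → ι) → ℂ) → Matrix ι ι ℂ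

/-- The construction depends differentiably on the curvature and does not depend on the frame. -/
structure IsNatural (F : TwoTensorOp) : Prop where
  differentiable : ∀ {ι : Type} [Fintype ι] [DecidableEq ι] (G Q : Matrix ι ι ℂ) (a b : ι),
    Differentiable ℂ fun R : (Fin 4 → ι) → ℂ => F ι G Q R a b
  -- The index types may differ: coordinates are indexed by `Coord N`, the null frame by `Option
  -- (Fin (N - 1)) × Fin 2`.
  equivariant : ∀ {ι κ : Type} [Fintype ι] [DecidableEq ι] [Fintype κ] [DecidableEq κ]
    (P : Matrix ι κ ℂ) (P' : Matrix κ ι ℂ), P * P' = 1 → P' * P = 1 →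
    ∀ (G Q : Matrix ι ι ℂ) (R : (Fin 4 → ι) → ℂ),
      F κ (P.transpose * G * P) (P' * Q * P'.transpose) (frameChange P R) =
        P.transpose * F ι G Q R * P

/-! ### Curvature expressions as natural operations -/

section EvalAt

variable {ι κ : Type} [Fintype ι] [DecidableEq ι] [Fintype κ] [DecidableEq κ]

/-- The value of an expression for given components of the metric, its inverse and the curvature
tensor, when all covariant derivatives of the curvature vanish. -/
def evalAt (G Q : Matrix ι ι ℂ) (R : (Fin 4 → ι) → ℂ) : {r : ℕ} → CurvExpr r → (Fin r → ι) → ℂ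
  | _, .const c => fun _ => c
  | _, .metric => fun i => G (i 0) (i 1)
  | _, .riem j => fun i => if j = 0 then R (fun k => i (Fin.castAdd j k)) else 0
  -- The Ricci tensor is computed from `R`, which leaves the curvature as the only variable. The
  -- reordering puts the contracted pair into the first and third slots of `R`.
  | _, .ric j => fun i => if j = 0 then
      contrAt Q (fun i => R ![i 0, i 2, i 1, i 3]) (fun k => i (Fin.castAdd j k)) else 0
  | _, .add T S => fun i => evalAt G Q R T i + evalAt G Q R S i
  | _, .smul c T => fun i => c * evalAt G Q R T i
  | _, .prod (r := r) (s := s) T S => fun i =>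
      evalAt G Q R T (fun k => i (Fin.castAdd s k)) * evalAt G Q R S (fun k => i (Fin.natAdd r k))
  | _, .perm σ T => fun i => evalAt G Q R T (fun k => i (σ k))
  | _, .contr T => contrAt Q (evalAt G Q R T)

/-- Each way of building an expression commutes with a change of frame. Only contractions, including
the one hidden in `ric`, need the inverse frame. -/
lemma evalAt_frameChange (P : Matrix ι κ ℂ) (P' : Matrix κ ι ℂ) (h : P * P' = 1)
    (G Q : Matrix ι ι ℂ) (R : (Fin 4 → ι) → ℂ) {r : ℕ} (T : CurvExpr r) :
    evalAt (P.transpose * G * P) (P' * Q * P'.transpose) (frameChange P R) T =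
      frameChange P (evalAt G Q R T) := by
  induction T with
  | const c => simp only [evalAt, frameChange_const]
  | metric => simp only [evalAt, frameChange_two]
  | riem j =>
    rcases Nat.eq_zero_or_pos j with rfl | hj
    · rfl
    · simp only [evalAt, hj.ne', if_false, frameChange_zero]
  | ric j =>
    rcases Nat.eq_zero_or_pos j with rfl | hj
    · have e : ∀ {α : Type} (i : Fin 4 → α), ![i 0, i 2, i 1, i 3] =
          fun k => i (Equiv.swap (1 : Fin 4) 2 k) := by
        intro α i
        funext k
        fin_cases k <;> rfl
      have h1 := frameChange_contr (r := 2) h Q (fun i => R ![i 0, i 2, i 1, i 3])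
      simp only [e] at h1
      rw [frameChange_perm] at h1
      simp only [evalAt, if_true, e]
      exact h1.symm
    · simp only [evalAt, hj.ne', if_false, frameChange_zero]
  | add T S hT hS => simp only [evalAt, hT, hS, frameChange_add]
  | smul c T hT => simp only [evalAt, hT, frameChange_smul]
  | prod T S hT hS => simp only [evalAt, hT, hS, frameChange_prod]
  | perm σ T hT => simp only [evalAt, hT]; rw [frameChange_perm]
  | contr T hT => simp only [evalAt, hT, frameChange_contr h]

lemma differentiable_evalAt (G Q : Matrix ι ι ℂ) {r : ℕ} (T : CurvExpr r) (i : Fin r → ι) :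
    Differentiable ℂ fun R : (Fin 4 → ι) → ℂ => evalAt G Q R T i := by
  induction T with
  | const c => simp only [evalAt]; fun_prop
  | metric => simp only [evalAt]; fun_prop
  | riem j =>
    simp only [evalAt]
    split_ifs <;> fun_prop
  | ric j =>
    simp only [evalAt, contrAt]
    split_ifs <;> fun_prop
  | add T S hT hS => exact (hT i).fun_add (hS i)
  | smul c T hT => exact (hT i).const_mul _
  | prod T S hT hS => exact (hT _).fun_mul (hS _)
  | perm σ T hT => exact hT _
  | contr T hT =>
    exact Differentiable.fun_sum fun a _ => Differentiable.fun_sum fun b _ => (hT _).const_mul _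

lemma isNatural_evalAt (T : CurvExpr 2) :
    IsNatural fun _ _ _ G Q R => Matrix.of fun a b => evalAt G Q R T ![a, b] where
  differentiable G Q a b := differentiable_evalAt G Q T ![a, b]
  equivariant {ι κ} _ _ _ _ P P' h _ G Q R := by
    ext a b
    have h1 := evalAt_frameChange P P' h G Q R T
    have h2 := frameChange_two P (Matrix.of fun a b => evalAt G Q R T ![a, b])
    have h3 : (fun i : Fin 2 → ι => Matrix.of (fun a b => evalAt G Q R T ![a, b]) (i 0) (i 1)) =
        evalAt G Q R T := by
      funext i
      simp only [Matrix.of_apply]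
      congr 1
      funext k
      fin_cases k <;> rfl
    rw [h3] at h2
    simp only [Matrix.of_apply]
    rw [h1, h2]
    rfl

end EvalAt

/-! ### The algebraic form of the curvature tensor -/

section Model

variable {ι κ β : Type} [Fintype ι] [DecidableEq ι] [Fintype κ] [DecidableEq κ] [Fintype β]

/-- The Kulkarni–Nomizu product. -/
def kulkarniNomizu (A B : Matrix ι ι ℂ) : (Fin 4 → ι) → ℂ := fun i =>
  A (i 0) (i 2) * B (i 1) (i 3) + A (i 1) (i 3) * B (i 0) (i 2)
    - A (i 0) (i 3) * B (i 1) (i 2) - A (i 1) (i 2) * B (i 0) (i 3)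

lemma frameChange_mul_perm (P : Matrix ι κ ℂ) (A B : Matrix ι ι ℂ) (σ : Equiv.Perm (Fin 4)) :
    frameChange P (fun i : Fin 4 → ι => A (i (σ 0)) (i (σ 1)) * B (i (σ 2)) (i (σ 3))) =
      fun i : Fin 4 → κ => (P.transpose * A * P) (i (σ 0)) (i (σ 1)) *
        (P.transpose * B * P) (i (σ 2)) (i (σ 3)) := by
  have h := frameChange_prod P (fun i : Fin 2 → ι => A (i 0) (i 1))
    (fun i : Fin 2 → ι => B (i 0) (i 1))
  rw [frameChange_two, frameChange_two] at h
  have h2 := frameChange_perm P σ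
    (fun i : Fin 4 → ι => A (i 0) (i 1) * B (i 2) (i 3))
  refine h2.trans ?_
  funext i
  exact congrFun h (fun k => i (σ k))

/-- Each of the four terms is a tensor product with permuted slots, and both operations commute with
a change of frame. The four permutations list the slots of `A` and then those of `B`. -/
lemma frameChange_kulkarniNomizu (P : Matrix ι κ ℂ) (A B : Matrix ι ι ℂ) :
    frameChange P (kulkarniNomizu A B) =
      kulkarniNomizu (P.transpose * A * P) (P.transpose * B * P) := by
  have h1 := frameChange_mul_perm P A B (Equiv.swap 1 2)
  have h2 := frameChange_mul_perm P A B
    ⟨![1, 3, 0, 2], ![2, 0, 3, 1], by decide, by decide⟩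
  have h3 := frameChange_mul_perm P A B ⟨![0, 3, 1, 2], ![0, 2, 3, 1], by decide, by decide⟩
  have h4 := frameChange_mul_perm P A B ⟨![1, 2, 0, 3], ![2, 0, 1, 3], by decide, by decide⟩
  have e0 : Equiv.swap (1 : Fin 4) 2 0 = 0 := by decide
  have e1 : Equiv.swap (1 : Fin 4) 2 1 = 2 := by decide
  have e2 : Equiv.swap (1 : Fin 4) 2 2 = 1 := by decide
  have e3 : Equiv.swap (1 : Fin 4) 2 3 = 3 := by decide
  rw [e0, e1, e2, e3] at h1
  unfold kulkarniNomizu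
  rw [frameChange_sub, frameChange_sub, frameChange_add]
  funext i
  exact congrArg₂ (· - ·) (congrArg₂ (· - ·)
    (congrArg₂ (· + ·) (congrFun h1 i) (congrFun h2 i)) (congrFun h3 i)) (congrFun h4 i)

/-- A sum of tensors of constant curvature `lam` built from `B b`, and the product of `L`, `h`. -/
def curvModel (lam : ℂ) (B : β → Matrix ι ι ℂ) (L h : Matrix ι ι ℂ) : (Fin 4 → ι) → ℂ :=
  fun i => lam / 2 * (∑ b, kulkarniNomizu (B b) (B b) i) + kulkarniNomizu L h i

lemma frameChange_curvModel (P : Matrix ι κ ℂ) (lam : ℂ) (B : β → Matrix ι ι ℂ)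
    (L h : Matrix ι ι ℂ) :
    frameChange P (curvModel lam B L h) =
      curvModel lam (fun b => P.transpose * B b * P) (P.transpose * L * P)
        (P.transpose * h * P) := by
  unfold curvModel
  rw [frameChange_add, frameChange_smul, frameChange_sum]
  simp only [frameChange_kulkarniNomizu]

/-- Since all blocks carry the same curvature `lam`, relabelling them is harmless. This is what
makes block permutations available as symmetries. -/
lemma curvModel_comp_equiv (lam : ℂ) (B : β → Matrix ι ι ℂ) (L h : Matrix ι ι ℂ)
    (π : Equiv.Perm β) : curvModel lam (fun b => B (π b)) L h = curvModel lam B L h := by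
  funext i
  simp only [curvModel, Equiv.sum_comp π (fun b => kulkarniNomizu (B b) (B b) i)]

end Model

/-! ### The null frame -/

section NullFrame

variable {A : Type} [Fintype A] [DecidableEq A]

/-- The other null direction of the same block. -/
def opp (a : Option A × Fin 2) : Option A × Fin 2 := (a.1, Equiv.swap 0 1 a.2)

/-- The metric in the null frame. -/
def nullMetric : Matrix (Option A × Fin 2) (Option A × Fin 2) ℂ :=
  Matrix.of fun a b => if b = opp a then 1 else 0

/-- The metric of one block in the null frame. -/
def nullBlock (b : Option A) : Matrix (Option A × Fin 2) (Option A × Fin 2) ℂ :=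
  Matrix.of fun a c => if c = opp a ∧ a.1 = b then 1 else 0

/-- The square of the null covector. -/
def nullSq : Matrix (Option A × Fin 2) (Option A × Fin 2) ℂ :=
  Matrix.of fun a b => if a = (none, 0) ∧ b = (none, 0) then 1 else 0

/-- The curvature tensor in the null frame. -/
def nullCurv (lam : ℂ) (h : Option A × Fin 2 → Option A × Fin 2 → ℂ) :
    (Fin 4 → Option A × Fin 2) → ℂ :=
  curvModel lam nullBlock nullSq (Matrix.of h)

lemma opp_opp (a : Option A × Fin 2) : opp (opp a) = a := by
  simp [opp]

lemma nullMetric_mul_self : nullMetric * nullMetric = (1 : Matrix (Option A × Fin 2) _ ℂ) := by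
  ext a b
  simp only [nullMetric, Matrix.mul_apply, Matrix.of_apply, Matrix.one_apply, ite_mul, one_mul,
    zero_mul, Finset.sum_ite_eq', Finset.mem_univ, if_true, opp_opp]
  simp only [eq_comm]

lemma nullMetric_transpose :
    (nullMetric : Matrix (Option A × Fin 2) _ ℂ).transpose = nullMetric := by
  ext a b
  simp only [nullMetric, Matrix.transpose_apply, Matrix.of_apply]
  congr 1
  exact propext ⟨fun h => by rw [h, opp_opp], fun h => by rw [h, opp_opp]⟩

/-- The permutation of the null frame by `π` on the blocks and by `ρ b` on the block `b`. -/
def framePerm (π : Equiv.Perm (Option A)) (ρ : Option A → Equiv.Perm (Fin 2)) :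
    Equiv.Perm (Option A × Fin 2) := Equiv.prodShear π ρ

/-- The permutations of two elements commute, so permuting blocks, and the directions inside each
block, respects the pairing of null directions. -/
lemma framePerm_opp (π : Equiv.Perm (Option A)) (ρ : Option A → Equiv.Perm (Fin 2))
    (a : Option A × Fin 2) : framePerm π ρ (opp a) = opp (framePerm π ρ a) := by
  obtain ⟨b, k⟩ := a
  simp only [framePerm, opp, Equiv.prodShear_apply, Prod.mk.injEq, true_and]
  generalize ρ b = σ
  revert σ k
  decide

lemma framePerm_eq_opp (π : Equiv.Perm (Option A)) (ρ : Option A → Equiv.Perm (Fin 2))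
    (a b : Option A × Fin 2) : framePerm π ρ b = opp (framePerm π ρ a) ↔ b = opp a := by
  rw [← framePerm_opp, EmbeddingLike.apply_eq_iff_eq]

/-- The monomial matrix that maps the frame vector `a` to `w a` times the frame vector `σ a`. -/
def monomialMatrix {κ : Type} [DecidableEq κ] (σ : Equiv.Perm κ) (w : κ → ℂ) : Matrix κ κ ℂ :=
  Matrix.of fun a b => if a = σ b then w b else 0

lemma monomialMatrix_conj {κ : Type} [Fintype κ] [DecidableEq κ] (σ : Equiv.Perm κ) (w : κ → ℂ)
    (M : Matrix κ κ ℂ) (a b : κ) :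
    ((monomialMatrix σ w).transpose * M * monomialMatrix σ w) a b =
      w a * w b * M (σ a) (σ b) := by
  simp only [monomialMatrix, Matrix.mul_apply, Matrix.transpose_apply, Matrix.of_apply, ite_mul,
    zero_mul, mul_ite, mul_zero, Finset.sum_ite_eq', Finset.mem_univ, if_true]
  ring

/-! ### Symmetries of natural operations in the null frame -/

variable {F : TwoTensorOp} (hF : IsNatural F) (lam : ℂ)

/-- The value of a natural operation for the curvature tensor in the null frame. -/
def nullValue (F : TwoTensorOp) (lam : ℂ) (h : Option A × Fin 2 → Option A × Fin 2 → ℂ) :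
    Matrix (Option A × Fin 2) (Option A × Fin 2) ℂ :=
  F _ nullMetric nullMetric (nullCurv lam h)

/-- If `P` brings the metric to an involution `E`, then `E * P.transpose * G` is a left inverse of
`P`, and in this form the transformed inverse metric simplifies to `E` by cancellation. It serves
both the symmetries of the null frame and the passage from coordinates to that frame. -/
lemma conj_inv_of_conj_eq {ι κ : Type} [Fintype ι] [DecidableEq ι] [Fintype κ] [DecidableEq κ]
    {P : Matrix ι κ ℂ} {G Q : Matrix ι ι ℂ} {E : Matrix κ κ ℂ} (hP : P.transpose * G * P = E)
    (hE : E * E = 1) (hEt : E.transpose = E) (hG : G.transpose = G) (hGQ : G * Q = 1) :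
    (E * P.transpose * G) * Q * (E * P.transpose * G).transpose = E := by
  have h1 : (E * P.transpose * G) * Q = E * P.transpose := by
    rw [Matrix.mul_assoc _ G Q, hGQ, Matrix.mul_one]
  rw [h1, Matrix.transpose_mul, Matrix.transpose_mul, Matrix.transpose_transpose, hG, hEt,
    ← Matrix.mul_assoc, ← Matrix.mul_assoc, Matrix.mul_assoc E, Matrix.mul_assoc E, hP, hE,
    Matrix.one_mul]

lemma monomial_nullMetric {π : Equiv.Perm (Option A)} {ρ : Option A → Equiv.Perm (Fin 2)}
    {w : Option A × Fin 2 → ℂ} (hw : ∀ a, w a * w (opp a) = 1) (a b : Option A × Fin 2) :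
    w a * w b * nullMetric (framePerm π ρ a) (framePerm π ρ b) = nullMetric a b := by
  simp only [nullMetric, Matrix.of_apply, framePerm_eq_opp]
  split_ifs with h
  · rw [h, hw, mul_one]
  · rw [mul_zero]

lemma monomial_nullBlock {π : Equiv.Perm (Option A)} {ρ : Option A → Equiv.Perm (Fin 2)}
    {w : Option A × Fin 2 → ℂ} (hw : ∀ a, w a * w (opp a) = 1) (c : Option A)
    (a b : Option A × Fin 2) :
    w a * w b * nullBlock c (framePerm π ρ a) (framePerm π ρ b) = nullBlock (π.symm c) a b := by
  have h1 : (framePerm π ρ a).1 = c ↔ a.1 = π.symm c := by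
    rw [Equiv.eq_symm_apply]; rfl
  simp only [nullBlock, Matrix.of_apply, framePerm_eq_opp, h1]
  split_ifs with h
  · rw [h.1, hw, mul_one]
  · rw [mul_zero]

include hF in
-- The weight condition makes the monomial matrix an isometry that permutes the blocks, so only the
-- term built from `nullSq` and `h` can change. The hypothesis `hh` concerns the product of the two,
-- since a scalar may move from one factor to the other.
lemma nullValue_monomial (π : Equiv.Perm (Option A)) (ρ : Option A → Equiv.Perm (Fin 2))
    (w : Option A × Fin 2 → ℂ) (hw : ∀ a, w a * w (opp a) = 1)
    (h h' : Option A × Fin 2 → Option A × Fin 2 → ℂ)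
    (hh : kulkarniNomizu
        (Matrix.of fun a b => w a * w b * nullSq (framePerm π ρ a) (framePerm π ρ b))
        (Matrix.of fun a b => w a * w b * h (framePerm π ρ a) (framePerm π ρ b)) =
      kulkarniNomizu nullSq (Matrix.of h')) (a b : Option A × Fin 2) :
    nullValue F lam h' a b =
      w a * w b * nullValue F lam h (framePerm π ρ a) (framePerm π ρ b) := by
  set P := monomialMatrix (framePerm π ρ) w with hPdef
  have hM : P.transpose * nullMetric * P = nullMetric := by
    ext a b
    rw [monomialMatrix_conj, monomial_nullMetric hw]
  have hP' : (nullMetric * P.transpose * nullMetric) * P = 1 := by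
    rw [Matrix.mul_assoc nullMetric, Matrix.mul_assoc nullMetric, hM, nullMetric_mul_self]
  have hE := hF.equivariant P _ (mul_eq_one_comm.mp hP') hP' nullMetric nullMetric (nullCurv lam h)
  rw [hM, conj_inv_of_conj_eq hM nullMetric_mul_self nullMetric_transpose nullMetric_transpose
    nullMetric_mul_self] at hE
  have hR : frameChange P (nullCurv lam h) = nullCurv lam h' := by
    rw [nullCurv, frameChange_curvModel]
    have h1 : ∀ c, P.transpose * nullBlock c * P = nullBlock (π.symm c) := by
      intro c
      ext a b
      rw [monomialMatrix_conj, monomial_nullBlock hw]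
    simp only [h1]
    rw [curvModel_comp_equiv lam nullBlock _ _ π.symm]
    have h2 : ∀ M : Matrix (Option A × Fin 2) (Option A × Fin 2) ℂ, P.transpose * M * P =
        Matrix.of fun a b => w a * w b * M (framePerm π ρ a) (framePerm π ρ b) := by
      intro M
      ext a b
      rw [monomialMatrix_conj, Matrix.of_apply]
    rw [h2, h2]
    funext i
    simp only [curvModel, nullCurv]
    congr 1
    exact congrFun hh i
  rw [hR] at hE
  rw [nullValue, hE, monomialMatrix_conj]
  rfl

/-- The rescaling of the null directions of the block `c` by `s` and `s⁻¹`. -/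
def boostWeight (c : Option A) (s : ℂ) (a : Option A × Fin 2) : ℂ :=
  if a.1 = c then (if a.2 = 0 then s else s⁻¹) else 1

lemma boostWeight_opp (c : Option A) {s : ℂ} (hs : s ≠ 0) (a : Option A × Fin 2) :
    boostWeight c s a * boostWeight c s (opp a) = 1 := by
  obtain ⟨b, k⟩ := a
  simp only [boostWeight, opp]
  split_ifs <;> fin_cases k <;> simp_all

/-- The matrix has only components in the blocks other than the first one. -/
def IsTransverse (h : Option A × Fin 2 → Option A × Fin 2 → ℂ) : Prop :=
  ∀ a b, a.1 = none ∨ b.1 = none → h a b = 0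

lemma framePerm_one (a : Option A × Fin 2) : framePerm 1 1 a = a := rfl

include hF in
-- The boost multiplies the null covector by `s` and does not touch a transverse `h`; the factor `s
-- ^ 2` of `nullSq` is then attributed to `h`.
lemma nullValue_boost {h : Option A × Fin 2 → Option A × Fin 2 → ℂ} (hh : IsTransverse h)
    {s : ℂ} (hs : s ≠ 0) (a b : Option A × Fin 2) :
    nullValue F lam (fun a b => s ^ 2 * h a b) a b =
      boostWeight none s a * boostWeight none s b * nullValue F lam h a b := by
  refine nullValue_monomial hF lam 1 1 (boostWeight none s) (boostWeight_opp none hs) h _ ?_ a b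
  simp only [framePerm_one]
  have h1 : (Matrix.of fun a b => boostWeight none s a * boostWeight none s b * nullSq a b) =
      s ^ 2 • (nullSq : Matrix (Option A × Fin 2) _ ℂ) := by
    ext a b
    simp only [Matrix.of_apply, nullSq, Matrix.smul_apply, smul_eq_mul]
    split_ifs with h
    · rw [h.1, h.2]
      simp [boostWeight]
      ring
    · simp
  have h2 : (fun a b => boostWeight none s a * boostWeight none s b * h a b) = h := by
    funext a b
    by_cases h3 : a.1 = none ∨ b.1 = none
    · rw [hh a b h3, mul_zero]
    · simp only [not_or] at h3
      simp [boostWeight, h3.1, h3.2]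
  rw [h1, h2]
  funext i
  simp only [kulkarniNomizu, Matrix.smul_apply, Matrix.of_apply, smul_eq_mul]
  ring

include hF in
/-- The symmetries that fix the first block act on the transverse matrix only. -/
lemma nullValue_transverse {π : Equiv.Perm (Option A)} {ρ : Option A → Equiv.Perm (Fin 2)}
    {w : Option A × Fin 2 → ℂ} (hw : ∀ a, w a * w (opp a) = 1) (hπ : π none = none)
    (hρ : ρ none = 1) (hw0 : w (none, 0) = 1)
    (h : Option A × Fin 2 → Option A × Fin 2 → ℂ) :
    nullValue F lam (fun a b => w a * w b * h (framePerm π ρ a) (framePerm π ρ b))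
      (none, 0) (none, 0) = nullValue F lam h (none, 0) (none, 0) := by
  have h0 : framePerm π ρ (none, 0) = (none, 0) := by
    simp [framePerm, hπ, hρ]
  have h0' : ∀ a, framePerm π ρ a = (none, 0) ↔ a = (none, 0) := by
    intro a
    rw [← h0, EmbeddingLike.apply_eq_iff_eq, h0]
  have hL : (Matrix.of fun a b => w a * w b * nullSq (framePerm π ρ a) (framePerm π ρ b)) =
      (nullSq : Matrix (Option A × Fin 2) _ ℂ) := by
    ext a b
    simp only [Matrix.of_apply, nullSq, h0']
    split_ifs with h
    · simp [h.1, h.2, hw0]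
    · simp
  have := nullValue_monomial hF lam π ρ w hw h
    (fun a b => w a * w b * h (framePerm π ρ a) (framePerm π ρ b)) (by rw [hL]) (none, 0) (none, 0)
  rw [this, h0, hw0, one_mul, one_mul]

include hF in
lemma differentiable_nullValue (a b : Option A × Fin 2) :
    Differentiable ℂ fun h => nullValue F lam h a b := by
  refine (hF.differentiable nullMetric nullMetric a b).comp ?_
  rw [differentiable_pi]
  intro i
  simp only [nullCurv, curvModel, kulkarniNomizu, Matrix.of_apply]
  fun_prop

lemma isTransverse_single {a b : Option A × Fin 2} (ha : a.1 ≠ none) (hb : b.1 ≠ none) (c : ℂ) :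
    IsTransverse fun x y => if x = a ∧ y = b then c else 0 := by
  rintro x y h
  refine if_neg ?_
  rintro ⟨rfl, rfl⟩
  exact h.elim ha hb

include hF in
-- Without `h` the boost by `2` fixes the curvature, yet it multiplies this component by `4`.
lemma nullValue_zero_uu : 
    nullValue F lam (0 : Option A × Fin 2 → Option A × Fin 2 → ℂ) (none, 0) (none, 0) = 0 := by
  have h := nullValue_boost hF lam (A := A) (h := 0) (fun _ _ _ => rfl) (s := 2) two_ne_zero
    (none, 0) (none, 0)
  have h0 : (fun a b => (2 : ℂ) ^ 2 * (0 : Option A × Fin 2 → Option A × Fin 2 → ℂ) a b) = 0 := by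
    funext a b
    simp
  rw [h0] at h
  simp only [boostWeight, if_true] at h
  linear_combination (-1 / 3) * h

include hF in
/-- The component along the null covector depends linearly on the transverse matrix. -/
lemma nullValue_uu_eq_fderiv {h : Option A × Fin 2 → Option A × Fin 2 → ℂ}
    (hh : IsTransverse h) :
    nullValue F lam h (none, 0) (none, 0) =
      fderiv ℂ (fun h => nullValue F lam h (none, 0) (none, 0))
        (0 : Option A × Fin 2 → Option A × Fin 2 → ℂ) h := by
  set Φ := fun h : Option A × Fin 2 → Option A × Fin 2 → ℂ =>
    nullValue F lam h (none, 0) (none, 0) with hΦ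
  -- Boost by a square root of `t`, which exists for every complex `t`; over `ℝ` this would only
  -- reach `t ≥ 0`.
  have hom : ∀ t : ℂ, Φ (t • h) = t * Φ h := by
    intro t
    rcases eq_or_ne t 0 with rfl | ht
    · rw [zero_smul, zero_mul]
      exact nullValue_zero_uu hF lam
    · obtain ⟨s, rfl⟩ := IsAlgClosed.exists_pow_nat_eq t (n := 2) two_pos
      have hs : s ≠ 0 := fun h => ht (by rw [h]; simp)
      have := nullValue_boost hF lam hh hs (none, 0) (none, 0)
      simp only [boostWeight, if_true] at this
      rw [sq, ← this, ← sq]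
      rfl
  have h1 : HasFDerivAt Φ (fderiv ℂ Φ 0) 0 :=
    (differentiable_nullValue hF lam _ _).differentiableAt.hasFDerivAt
  -- The derivative along the line through `h` is found once by the chain rule and once from
  -- homogeneity; uniqueness makes `Φ` agree with its differential at `0`.
  have h2 : HasDerivAt (fun t : ℂ => Φ (t • h)) (fderiv ℂ Φ 0 h) 0 := by
    have h3 : HasDerivAt (fun t : ℂ => t • h) h 0 := by
      simpa using (hasDerivAt_id (0 : ℂ)).smul_const h
    exact HasFDerivAt.comp_hasDerivAt (0 : ℂ) (by rwa [zero_smul]) h3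
  have h4 : HasDerivAt (fun t : ℂ => Φ (t • h)) (Φ h) 0 := by
    simp only [hom]
    simpa using (hasDerivAt_id (0 : ℂ)).mul_const (Φ h)
  exact h4.unique h2

include hF in
-- Rescaling the null directions of the transverse block of `a` by `2` and `2⁻¹`, a complexified
-- rotation, fixes the null covector and multiplies the matrix unit by a factor other than `1`. By
-- linearity the value must vanish.
lemma nullValue_single_eq_zero {a b : Option A × Fin 2} (ha : a.1 ≠ none) (hb : b.1 ≠ none)
    (hab : b ≠ opp a) :
    nullValue F lam (fun x y => if x = a ∧ y = b then 1 else 0) (none, 0) (none, 0) = 0 := by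
  set w := boostWeight a.1 (2 : ℂ) with hw
  have h1 := nullValue_transverse hF lam (π := 1) (ρ := 1) (boostWeight_opp a.1 two_ne_zero) rfl rfl
    (by simp [boostWeight, ha.symm]) (fun x y => if x = a ∧ y = b then 1 else 0)
  have h2 : (fun x y => boostWeight a.1 2 x * boostWeight a.1 2 y *
      (if framePerm 1 1 x = a ∧ framePerm 1 1 y = b then (1 : ℂ) else 0)) =
      (w a * w b) • fun x y => if x = a ∧ y = b then 1 else 0 := by
    funext x y
    simp only [framePerm_one, Pi.smul_apply, smul_eq_mul, hw]
    by_cases h : x = a ∧ y = b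
    · simp [h.1, h.2]
    · simp [h]
  -- If `b` lies in the block of `a`, then `b = a` and the factor is `4` or `1 / 4`; otherwise it is
  -- `2` or `1 / 2`.
  have h3 : w a * w b ≠ 1 := by
    obtain ⟨a1, a2⟩ := a
    obtain ⟨b1, b2⟩ := b
    simp only [hw, boostWeight]
    by_cases h : b1 = a1
    · subst h
      fin_cases a2 <;> fin_cases b2 <;> simp [opp] at hab ⊢ <;> norm_num
    · fin_cases a2 <;> simp [h]
  rw [h2] at h1
  have ht := isTransverse_single ha hb 1
  have ht2 : IsTransverse ((w a * w b) • fun x y => if x = a ∧ y = b then (1 : ℂ) else 0) := by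
    intro x y h
    exact mul_eq_zero_of_right _ (ht x y h)
  rw [nullValue_uu_eq_fderiv hF lam ht2, map_smul, ← nullValue_uu_eq_fderiv hF lam ht,
    smul_eq_mul] at h1
  have h4 : (w a * w b - 1) *
      nullValue F lam (fun x y => if x = a ∧ y = b then 1 else 0) (none, 0) (none, 0) = 0 := by
    linear_combination h1
  exact (mul_eq_zero.mp h4).resolve_left (sub_ne_zero.mpr h3)

include hF in
lemma nullValue_single_opp {a b : Option A × Fin 2} (ha : a.1 ≠ none) (hb : b.1 ≠ none) :
    nullValue F lam (fun x y => if x = a ∧ y = opp a then 1 else 0) (none, 0) (none, 0) =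
      nullValue F lam (fun x y => if x = b ∧ y = opp b then 1 else 0) (none, 0) (none, 0) := by
  set π := Equiv.swap a.1 b.1
  -- The identity on the first block keeps the null covector; on the others the swap carries the
  -- direction of `b` to that of `a`.
  set ρ : Option A → Equiv.Perm (Fin 2) := fun c => if c = none then 1 else Equiv.swap a.2 b.2
  have hσ : framePerm π ρ b = a := by
    simp [framePerm, π, ρ, hb]
  have hσ2 : framePerm π ρ (opp b) = opp a := by rw [framePerm_opp, hσ]
  have h1 := nullValue_transverse hF lam (π := π) (ρ := ρ) (w := 1) (fun _ => by simp)
    (Equiv.swap_apply_of_ne_of_ne ha.symm hb.symm) (by simp [ρ]) rfl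
    (fun x y => if x = a ∧ y = opp a then 1 else 0)
  rw [← h1]
  congr 1
  have h2 : ∀ x, framePerm π ρ x = a ↔ x = b := fun x => by
    rw [← hσ, EmbeddingLike.apply_eq_iff_eq]
  have h3 : ∀ x, framePerm π ρ x = opp a ↔ x = opp b := fun x => by
    rw [← hσ2, EmbeddingLike.apply_eq_iff_eq]
  simp only [h2, h3, Pi.one_apply, one_mul]

include hF in
/-- The component along the null covector vanishes if the transverse matrix has trace zero. -/
lemma nullValue_uu {h : Option A × Fin 2 → Option A × Fin 2 → ℂ} (hh : IsTransverse h)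
    (htr : ∑ a, h a (opp a) = 0) : nullValue F lam h (none, 0) (none, 0) = 0 := by
  -- The common value on all pairs of opposite directions. If there is no transverse block, any
  -- constant will do.
  obtain ⟨c, hc⟩ : ∃ c, ∀ a : Option A × Fin 2, a.1 ≠ none →
      nullValue F lam (fun x y => if x = a ∧ y = opp a then 1 else 0) (none, 0) (none, 0) = c := by
    by_cases hA : ∃ a : Option A × Fin 2, a.1 ≠ none
    · obtain ⟨a, ha⟩ := hA
      exact ⟨_, fun b hb => nullValue_single_opp hF lam hb ha⟩
    · exact ⟨0, fun a ha => absurd ⟨a, ha⟩ hA⟩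
  have hsum : h = ∑ a, ∑ b, h a b • fun x y => if x = a ∧ y = b then (1 : ℂ) else 0 := by
    funext x y
    simp only [Finset.sum_apply, Pi.smul_apply, smul_eq_mul, mul_ite, mul_one, mul_zero, ite_and]
    simp
  rw [nullValue_uu_eq_fderiv hF lam hh]
  set ℓ := fderiv ℂ (fun h => nullValue F lam h (none, 0) (none, 0))
    (0 : Option A × Fin 2 → Option A × Fin 2 → ℂ) with hℓ
  rw [hsum]
  simp only [map_sum, map_smul, smul_eq_mul]
  -- Only opposite pairs contribute, each with the same factor, so that `ℓ h` is `c` times the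
  -- trace.
  have h1 : ∀ a b, h a b * ℓ (fun x y => if x = a ∧ y = b then (1 : ℂ) else 0) =
      if b = opp a then h a b * c else 0 := by
    intro a b
    by_cases h2 : a.1 = none ∨ b.1 = none
    · simp [hh a b h2]
    · rw [not_or] at h2
      rw [hℓ, ← nullValue_uu_eq_fderiv hF lam (isTransverse_single h2.1 h2.2 1)]
      split_ifs with h3
      · rw [h3, hc a h2.1]
      · rw [nullValue_single_eq_zero hF lam h2.1 h2.2 h3, mul_zero]
  simp only [h1, Finset.sum_ite_eq', Finset.mem_univ, if_true]
  rw [← Finset.sum_mul, htr, zero_mul]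

lemma eq_of_continuous_of_eq_off_zero {f : ℂ → ℂ} (hf : Continuous f) {c : ℂ}
    (h : ∀ s, s ≠ 0 → f s = c) : f 0 = c := by
  have h1 : Filter.Tendsto f (nhdsWithin 0 {0}ᶜ) (nhds (f 0)) :=
    (hf.tendsto 0).mono_left nhdsWithin_le_nhds
  have h2 : Filter.Tendsto f (nhdsWithin 0 {0}ᶜ) (nhds c) :=
    tendsto_const_nhds.congr' (by
      filter_upwards [self_mem_nhdsWithin] with s hs
      exact (h s hs).symm)
  exact tendsto_nhds_unique h1 h2

include hF in
lemma continuous_nullValue_scaled (h : Option A × Fin 2 → Option A × Fin 2 → ℂ)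
    (a b : Option A × Fin 2) :
    Continuous fun s : ℂ => nullValue F lam (fun a b => s ^ 2 * h a b) a b :=
  (differentiable_nullValue hF lam a b).continuous.comp (by fun_prop)

lemma scaled_zero (h : Option A × Fin 2 → Option A × Fin 2 → ℂ) :
    (fun a b => (0 : ℂ) ^ 2 * h a b) = 0 := by
  funext a b
  simp

include hF in
/-- All components except the one along the null covector are those for constant curvature. -/
lemma nullValue_eq_zero_apply {h : Option A × Fin 2 → Option A × Fin 2 → ℂ} (hh : IsTransverse h)
    {a b : Option A × Fin 2} (hab : ¬(a = (none, 0) ∧ b = (none, 0))) :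
    nullValue F lam h a b = nullValue F lam 0 a b := by
  have hz : IsTransverse (0 : Option A × Fin 2 → Option A × Fin 2 → ℂ) := fun _ _ _ => rfl
  have hc := continuous_nullValue_scaled hF lam h a b
  -- the value vanishes if the weight is not trivial
  have key : ∀ {g : Option A × Fin 2 → Option A × Fin 2 → ℂ}, IsTransverse g →
      (boostWeight none (-1) a * boostWeight none (-1) b = -1) → nullValue F lam g a b = 0 := by
    intro g hg h1
    have h2 := nullValue_boost hF lam hg (s := -1) (by norm_num) a b
    rw [h1] at h2
    simp only [even_two, Even.neg_pow, one_pow, one_mul] at h2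
    linear_combination (1 / 2) * h2
  -- At weight zero the value at `s ^ 2 * h` is constant for `s ≠ 0`, and continuity carries it to
  -- `s = 0`.
  have key2 : (∀ s : ℂ, s ≠ 0 → boostWeight none s a * boostWeight none s b = 1) →
      nullValue F lam h a b = nullValue F lam 0 a b := by
    intro h1
    have h2 := eq_of_continuous_of_eq_off_zero hc (c := nullValue F lam h a b) fun s hs => by
      rw [nullValue_boost hF lam hh hs, h1 s hs, one_mul]
    rw [← h2, scaled_zero]
  obtain ⟨a1, a2⟩ := a
  obtain ⟨b1, b2⟩ := b
  -- For two indices in the direction inverse to the null covector, `s ^ 2` times the value at `s ^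
  -- 2 * g` equals the value at `g`; the limit `s → 0` gives zero.
  have key3 : a1 = none → a2 = 1 → b1 = none → b2 = 1 →
      ∀ {g : Option A × Fin 2 → Option A × Fin 2 → ℂ}, IsTransverse g →
      nullValue F lam g (a1, a2) (b1, b2) = 0 := by
    rintro rfl rfl rfl rfl g hg
    have hc := continuous_nullValue_scaled hF lam g (none, 1) (none, 1)
    have h2 := eq_of_continuous_of_eq_off_zero
      (f := fun s => s ^ 2 * nullValue F lam (fun a b => s ^ 2 * g a b) (none, 1) (none, 1))
      (by fun_prop) (c := nullValue F lam g (none, 1) (none, 1)) fun s hs => by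
      rw [nullValue_boost hF lam hg hs]
      simp [boostWeight]
      field_simp
    rw [← h2]
    simp
  rcases a1 with _ | a1 <;> rcases b1 with _ | b1
  · fin_cases a2 <;> fin_cases b2
    · exact absurd ⟨rfl, rfl⟩ hab
    · exact key2 fun s hs => by simp [boostWeight, hs]
    · exact key2 fun s hs => by simp [boostWeight, hs]
    · rw [key3 rfl rfl rfl rfl hh, key3 rfl rfl rfl rfl hz]
  -- One index in the first block and one outside: the boost by `-1` leaves `h` alone and changes
  -- the sign.
  · rw [key hh, key hz] <;> fin_cases a2 <;> simp [boostWeight]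
  · rw [key hh, key hz] <;> fin_cases b2 <;> simp [boostWeight]
  · exact key2 fun s hs => by simp [boostWeight]

include hF in
/-- For constant curvature in each block the value is a multiple of the metric. -/
lemma nullValue_zero : ∃ c : ℂ,
    nullValue F lam (0 : Option A × Fin 2 → Option A × Fin 2 → ℂ) = c • nullMetric := by
  have sym : ∀ π ρ (w : Option A × Fin 2 → ℂ), (∀ a, w a * w (opp a) = 1) → ∀ a b : Option A × Fin 2,
      nullValue F lam 0 a b =
        w a * w b * nullValue F lam 0 (framePerm π ρ a) (framePerm π ρ b) := by
    intro π ρ w hw a b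
    refine nullValue_monomial hF lam π ρ w hw 0 0 ?_ a b
    funext i
    simp [kulkarniNomizu]
  refine ⟨nullValue (A := A) F lam 0 (none, 0) (none, 1), ?_⟩
  ext a b
  simp only [Matrix.smul_apply, nullMetric, Matrix.of_apply, smul_eq_mul, mul_ite, mul_one,
    mul_zero]
  split_ifs with hab
  -- With `h = 0` the first block may be exchanged with any other, so every opposite pair has the
  -- value of the pair in the first block.
  · have h1 := sym (Equiv.swap a.1 none) (fun _ => Equiv.swap a.2 0) 1 (fun _ => by simp) a b
    have h2 : framePerm (Equiv.swap a.1 none) (fun _ => Equiv.swap a.2 0) a = (none, 0) := by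
      simp [framePerm]
    rw [hab, framePerm_opp, h2] at h1
    rw [hab, h1]
    simp [opp]
  -- Any other pair has nontrivial weight under the rescaling of the block of `a`.
  · have h1 := sym 1 1 (boostWeight a.1 2) (boostWeight_opp a.1 two_ne_zero) a b
    simp only [framePerm_one] at h1
    have h3 : boostWeight a.1 2 a * boostWeight a.1 2 b ≠ 1 := by
      obtain ⟨a1, a2⟩ := a
      obtain ⟨b1, b2⟩ := b
      simp only [boostWeight]
      by_cases h : b1 = a1
      · subst h
        fin_cases a2 <;> fin_cases b2 <;> simp [opp] at hab ⊢ <;> norm_num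
      · fin_cases a2 <;> simp [h]
    have h4 : (boostWeight a.1 2 a * boostWeight a.1 2 b - 1) * nullValue F lam 0 a b = 0 := by
      linear_combination -h1
    exact (mul_eq_zero.mp h4).resolve_left (sub_ne_zero.mpr h3)

include hF in
/-- In the null frame a natural operation yields a multiple of the metric, and the factor does not
depend on the traceless transverse matrix. -/
theorem exists_nullValue_eq_smul : ∃ c : ℂ,
    ∀ h : Option A × Fin 2 → Option A × Fin 2 → ℂ, IsTransverse h →
      ∑ a : Option A × Fin 2, h a (opp a) = 0 →
      nullValue F lam h = c • nullMetric := by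
  obtain ⟨c, hc⟩ := nullValue_zero (A := A) hF lam
  refine ⟨c, fun h hh htr => ?_⟩
  rw [← hc]
  ext a b
  by_cases hab : a = (none, 0) ∧ b = (none, 0)
  · rw [hab.1, hab.2, nullValue_uu hF lam hh htr, nullValue_zero_uu hF lam]
  · exact nullValue_eq_zero_apply hF lam hh hab

end NullFrame

/-! ### The Lovelock tensors are natural -/

section Lovelock

variable {ι κ τ : Type} [Fintype ι] [DecidableEq ι] [Fintype κ] [DecidableEq κ]
  [Fintype τ] [DecidableEq τ]

/-- The rows of `U * V` are combinations of the rows of `V`; expand by multilinearity of the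
determinant in the rows, as in the first half of Cauchy–Binet. -/
lemma det_mul_eq_sum (U : Matrix τ ι ℂ) (V : Matrix ι τ ℂ) :
    (U * V).det = ∑ A : τ → ι, (∏ s, U s (A s)) * (Matrix.of fun s t => V (A s) t).det := by
  have h := (Matrix.detRowAlternating (n := τ) (R := ℂ)).toMultilinearMap.map_sum
    (fun s (x : ι) => U s x • V x)
  have h2 : (fun s => ∑ x : ι, U s x • V x) = U * V := by
    funext s t
    simp [Matrix.mul_apply, Finset.sum_apply]
  rw [h2] at h
  refine h.trans (Finset.sum_congr rfl fun A _ => ?_)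
  exact (Matrix.detRowAlternating (n := τ) (R := ℂ)).toMultilinearMap.map_smul_univ
    (fun s => U s (A s)) (fun s => V (A s))

lemma genDelta_eq_det (A B : τ → ι) :
    (genDelta A B : ℂ) = (Matrix.of fun s t => if A s = B t then (1 : ℂ) else 0).det := by
  have h := RingHom.map_det Complex.ofRealHom
    (Matrix.of fun s t => if A s = B t then (1 : ℝ) else 0)
  refine h.trans (congrArg Matrix.det ?_)
  ext s t
  by_cases hst : A s = B t <;> simp [hst]

/-- The delta is the determinant of a matrix of Kronecker symbols. Expanding `det (U * V)` along the
rows and then, transposed, along the columns of `V` produces it. -/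
lemma sum_genDelta (U : Matrix τ ι ℂ) (V : Matrix ι τ ℂ) :
    ∑ A : τ → ι, ∑ B : τ → ι, (∏ s, U s (A s)) * (∏ t, V (B t) t) * (genDelta A B : ℂ) =
      (U * V).det := by
  rw [det_mul_eq_sum]
  refine Finset.sum_congr rfl fun A _ => ?_
  have h := det_mul_eq_sum V.transpose
    (Matrix.of fun x s => if A s = x then (1 : ℂ) else 0)
  have h2 : V.transpose * (Matrix.of fun x s => if A s = x then (1 : ℂ) else 0) =
      (Matrix.of fun s t => V (A s) t).transpose := by
    ext t s
    simp [Matrix.mul_apply]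
  rw [h2, Matrix.det_transpose] at h
  rw [h, Finset.mul_sum]
  refine Finset.sum_congr rfl fun B _ => ?_
  rw [genDelta_eq_det, ← Matrix.det_transpose, mul_assoc]
  rfl

lemma sum_option_arrow (f : (Option τ → ι) → ℂ) :
    ∑ A, f A = ∑ a, ∑ c : τ → ι, f (fun s => s.elim a c) := by
  rw [← Fintype.sum_prod_type']
  refine Fintype.sum_equiv (Equiv.piOptionEquivProd (β := fun _ => ι)) _ _ fun A => ?_
  congr 1
  funext s
  cases s <;> rfl

lemma sum_prod_ite_eq (c : τ → ι) (f : (τ → ι) → ℂ) :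
    ∑ A : τ → ι, (∏ s, if A s = c s then (1 : ℂ) else 0) * f A = f c := by
  rw [Fintype.sum_eq_single c]
  · simp
  · intro A hA
    obtain ⟨s, hs⟩ := Function.ne_iff.mp hA
    rw [Finset.prod_eq_zero (Finset.mem_univ s) (by simp [hs]), zero_mul]

/-- The contraction of `M` with the generalized Kronecker delta. -/
def deltaContr (M : (τ → ι) → (τ → ι) → ℂ) : Matrix ι ι ℂ :=
  Matrix.of fun a b => ∑ c : τ → ι, ∑ d : τ → ι,
    (genDelta (fun s : Option τ => s.elim a c) (fun s : Option τ => s.elim b d) : ℂ) * M c d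

/-- Invariance of the generalized delta, with the transformation matrices moved to the free indices.
Both sides are determinants of products of bordered matrices as in `sum_genDelta`, and the two
products coincide. -/
lemma sum_genDelta_option {P : Matrix ι κ ℂ} {P' : Matrix κ ι ℂ} (h : P * P' = 1)
    (h' : P' * P = 1) (a b : κ) (c₁ d₁ : τ → ι) :
    ∑ c : τ → κ, ∑ d : τ → κ, (∏ s, P (c₁ s) (c s)) * (∏ s, P' (d s) (d₁ s)) *
      (genDelta (fun s : Option τ => s.elim a c) (fun s : Option τ => s.elim b d) : ℂ) =
    ∑ a₁, ∑ b₁, P' a a₁ * P b₁ b *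
      (genDelta (fun s : Option τ => s.elim a₁ c₁) (fun s : Option τ => s.elim b₁ d₁) : ℂ) := by
  have e1 := sum_genDelta (τ := Option τ) (ι := κ)
    (Matrix.of fun s x => s.elim (if x = a then 1 else 0) fun s => P (c₁ s) x)
    (Matrix.of fun x t => t.elim (if x = b then 1 else 0) fun t => P' x (d₁ t))
  have e2 := sum_genDelta (τ := Option τ) (ι := ι)
    (Matrix.of fun s x => s.elim (P' a x) fun s => if x = c₁ s then 1 else 0)
    (Matrix.of fun x t => t.elim (P x b) fun t => if x = d₁ t then 1 else 0)
  -- The corner entry is the Kronecker symbol of `a`, `b` because `P' * P = 1`, the remaining square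
  -- block that of `c₁`, `d₁` because `P * P' = 1`; the borders agree at once.
  have e3 : ((Matrix.of fun (s : Option τ) x => s.elim (if x = a then 1 else 0)
        fun s => P (c₁ s) x) *
      (Matrix.of fun x (t : Option τ) => t.elim (if x = b then 1 else 0)
        fun t => P' x (d₁ t)) : Matrix _ _ ℂ) =
      (Matrix.of fun (s : Option τ) x => s.elim (P' a x) fun s => if x = c₁ s then 1 else 0) *
      (Matrix.of fun x (t : Option τ) => t.elim (P x b) fun t => if x = d₁ t then 1 else 0) := by
    ext s t
    rcases s with _ | s <;> rcases t with _ | t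
    · simp only [Matrix.mul_apply, Matrix.of_apply, Option.elim]
      rw [← Matrix.mul_apply, h']
      simp [Matrix.one_apply, eq_comm]
    · simp [Matrix.mul_apply]
    · simp [Matrix.mul_apply]
    · simp only [Matrix.mul_apply, Matrix.of_apply, Option.elim]
      rw [← Matrix.mul_apply, h]
      simp [Matrix.one_apply, eq_comm]
  rw [← e3, ← e1] at e2
  -- The unit row and the unit column pin the border indices to `a` and `b`.
  have f1 : ∀ D : (Option τ → κ) → (Option τ → κ) → ℂ,
      (∑ A : Option τ → κ, ∑ B : Option τ → κ,
        (∏ s, (Matrix.of fun s x => s.elim (if x = a then (1 : ℂ) else 0)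
          fun s => P (c₁ s) x : Matrix (Option τ) κ ℂ) s (A s)) *
        (∏ t, (Matrix.of fun x t => t.elim (if x = b then (1 : ℂ) else 0)
          fun t => P' x (d₁ t) : Matrix κ (Option τ) ℂ) (B t) t) * D A B) =
      ∑ c : τ → κ, ∑ d : τ → κ, (∏ s, P (c₁ s) (c s)) * (∏ s, P' (d s) (d₁ s)) *
        D (fun s : Option τ => s.elim a c) (fun s : Option τ => s.elim b d) := by
    intro D
    simp only [sum_option_arrow, Fintype.prod_option, Matrix.of_apply, Option.elim_none,
      Option.elim_some]
    rw [Fintype.sum_eq_single a (fun x hx => by simp [hx])]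
    refine Finset.sum_congr rfl fun c _ => ?_
    rw [Fintype.sum_eq_single b (fun x hx => by simp [hx])]
    simp
  have f2 : ∀ D : (Option τ → ι) → (Option τ → ι) → ℂ,
      (∑ A : Option τ → ι, ∑ B : Option τ → ι,
        (∏ s, (Matrix.of fun s x => s.elim (P' a x)
          fun s => if x = c₁ s then (1 : ℂ) else 0 : Matrix (Option τ) ι ℂ) s (A s)) *
        (∏ t, (Matrix.of fun x t => t.elim (P x b)
          fun t => if x = d₁ t then (1 : ℂ) else 0 : Matrix ι (Option τ) ℂ) (B t) t) * D A B) =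
      ∑ a₁, ∑ b₁, P' a a₁ * P b₁ b *
        D (fun s : Option τ => s.elim a₁ c₁) (fun s : Option τ => s.elim b₁ d₁) := by
    intro D
    simp only [sum_option_arrow, Fintype.prod_option, Matrix.of_apply, Option.elim_none,
      Option.elim_some]
    refine Finset.sum_congr rfl fun x _ => ?_
    have g1 : ∀ c : τ → ι, (∑ y, ∑ d : τ → ι, P' a x * (∏ s, if c s = c₁ s then (1 : ℂ) else 0) *
        (P y b * ∏ s, if d s = d₁ s then (1 : ℂ) else 0) *
          D (fun s : Option τ => s.elim x c) (fun s : Option τ => s.elim y d)) =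
        (∏ s, if c s = c₁ s then (1 : ℂ) else 0) * ∑ y, P' a x * P y b *
          D (fun s : Option τ => s.elim x c) (fun s : Option τ => s.elim y d₁) := by
      intro c
      rw [Finset.mul_sum]
      refine Finset.sum_congr rfl fun y _ => ?_
      rw [← sum_prod_ite_eq d₁ fun d => P' a x * P y b *
        D (fun s : Option τ => s.elim x c) (fun s : Option τ => s.elim y d), Finset.mul_sum]
      exact Finset.sum_congr rfl fun d _ => by ring
    exact (Finset.sum_congr rfl fun c _ => g1 c).trans (sum_prod_ite_eq c₁ fun c =>
      ∑ y, P' a x * P y b * D (fun s : Option τ => s.elim x c) (fun s : Option τ => s.elim y d₁))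
  rw [f1, f2] at e2
  exact e2.symm

lemma deltaContr_equivariant {P : Matrix ι κ ℂ} {P' : Matrix κ ι ℂ} (h : P * P' = 1)
    (h' : P' * P = 1) (M : (τ → ι) → (τ → ι) → ℂ) (M' : (τ → κ) → (τ → κ) → ℂ)
    (hM : ∀ c d, M' c d = ∑ c₁, ∑ d₁, (∏ s, P (c₁ s) (c s)) * (∏ s, P' (d s) (d₁ s)) * M c₁ d₁) :
    deltaContr M' = P' * deltaContr M * P := by
  ext a b
  have e1 : (P' * deltaContr M * P) a b = ∑ c₁, ∑ d₁, (∑ a₁, ∑ b₁, P' a a₁ * P b₁ b *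
      (genDelta (fun s : Option τ => s.elim a₁ c₁) (fun s : Option τ => s.elim b₁ d₁) : ℂ)) *
        M c₁ d₁ := by
    simp only [Matrix.mul_apply, deltaContr, Matrix.of_apply, Finset.sum_mul, Finset.mul_sum]
    have r : ∀ f : ι → ι → (τ → ι) → (τ → ι) → ℂ, ∑ b₁, ∑ a₁, ∑ c, ∑ d, f b₁ a₁ c d =
        ∑ c, ∑ d, ∑ a₁, ∑ b₁, f b₁ a₁ c d := by
      intro f
      simp only [← Fintype.sum_prod_type']
      exact Fintype.sum_equiv ⟨fun q => (q.2.2.1, q.2.2.2, q.2.1, q.1),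
        fun q => (q.2.2.2, q.2.2.1, q.1, q.2.1), fun _ => rfl, fun _ => rfl⟩ _ _ fun _ => rfl
    rw [r]
    exact Finset.sum_congr rfl fun _ _ => Finset.sum_congr rfl fun _ _ =>
      Finset.sum_congr rfl fun _ _ => Finset.sum_congr rfl fun _ _ => by ring
  rw [e1]
  simp only [← sum_genDelta_option h h', deltaContr, Matrix.of_apply, hM, Finset.sum_mul,
    Finset.mul_sum]
  have r : ∀ f : (τ → κ) → (τ → κ) → (τ → ι) → (τ → ι) → ℂ,
      ∑ c, ∑ d, ∑ c₁, ∑ d₁, f c d c₁ d₁ = ∑ c₁, ∑ d₁, ∑ c, ∑ d, f c d c₁ d₁ := by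
    intro f
    simp only [← Fintype.sum_prod_type']
    exact Fintype.sum_equiv ⟨fun q => (q.2.2.1, q.2.2.2, q.1, q.2.1),
      fun q => (q.2.2.1, q.2.2.2, q.1, q.2.1), fun _ => rfl, fun _ => rfl⟩ _ _ fun _ => rfl
  rw [r]
  exact Finset.sum_congr rfl fun _ _ => Finset.sum_congr rfl fun _ _ =>
    Finset.sum_congr rfl fun _ _ => Finset.sum_congr rfl fun _ _ => by ring

/-- `Rᵃᵇ_{cd}`, computed from the inverse metric and the curvature tensor. -/
def mixedAt (Q : Matrix ι ι ℂ) (R : (Fin 4 → ι) → ℂ) (d c : Fin 2 → ι) : ℂ :=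
  ∑ e, ∑ f, Q (d 0) e * Q (d 1) f * R ![e, f, c 0, c 1]

lemma sum_fin_two_arrow (f : (Fin 2 → ι) → ℂ) : ∑ A, f A = ∑ x, ∑ y, f ![x, y] := by
  rw [← Fintype.sum_prod_type']
  refine Fintype.sum_equiv (finTwoArrowEquiv ι) _ _ fun A => ?_
  congr 1
  funext k
  fin_cases k <;> rfl

lemma sum_fin_four_arrow (f : (Fin 4 → ι) → ℂ) :
    ∑ A, f A = ∑ x, ∑ y, ∑ z, ∑ w, f ![x, y, z, w] := by
  simp only [sum_fin_succ_arrow (r := 3), sum_fin_succ_arrow (r := 2), sum_fin_two_arrow]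
  rfl

/-- In a raised slot the `P` of the covariant index cancels against `P'.transpose`, and a single
`P'` remains. -/
lemma mixedAt_frameChange {P : Matrix ι κ ℂ} {P' : Matrix κ ι ℂ} (h : P * P' = 1)
    (Q : Matrix ι ι ℂ) (R : (Fin 4 → ι) → ℂ) (d c : Fin 2 → κ) :
    mixedAt (P' * Q * P'.transpose) (frameChange P R) d c =
      ∑ q : (Fin 2 → ι) × (Fin 2 → ι),
        (∏ s, P (q.1 s) (c s)) * (∏ s, P' (d s) (q.2 s)) * mixedAt Q R q.2 q.1 := by
  have e1 : (P' * Q * P'.transpose) * P.transpose = P' * Q := by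
    rw [Matrix.mul_assoc _ P'.transpose, ← Matrix.transpose_mul, h, Matrix.transpose_one,
      Matrix.mul_one]
  have e2 : ∀ x i, ∑ e, (P' * Q * P'.transpose) i e * P x e = ∑ a, P' i a * Q a x := by
    intro x i
    have := congrFun (congrFun e1 i) x
    rw [Matrix.mul_apply] at this
    simpa [Matrix.transpose_apply, Matrix.mul_apply (M := P') (N := Q)] using this
  generalize P' * Q * P'.transpose = X at e2 ⊢
  have lhs : mixedAt X (frameChange P R) d c = ∑ x, ∑ y, ∑ z, ∑ w,
      (∑ e, X (d 0) e * P x e) * (∑ f, X (d 1) f * P y f) * (P z (c 0) * P w (c 1)) *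
        R ![x, y, z, w] := by
    simp only [mixedAt, frameChange, sum_fin_four_arrow, Fin.prod_univ_four, Finset.mul_sum,
      Finset.sum_mul]
    have r : ∀ f : κ → κ → ι → ι → ι → ι → ℂ, ∑ a, ∑ b, ∑ x, ∑ y, ∑ z, ∑ w, f a b x y z w =
        ∑ x, ∑ y, ∑ z, ∑ w, ∑ b, ∑ a, f a b x y z w := by
      intro f
      simp only [← Fintype.sum_prod_type']
      exact Fintype.sum_equiv
        ⟨fun q => (q.2.2.1, q.2.2.2.1, q.2.2.2.2.1, q.2.2.2.2.2, q.2.1, q.1),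
        fun q => (q.2.2.2.2.2, q.2.2.2.2.1, q.1, q.2.1, q.2.2.1, q.2.2.2.1),
        fun _ => rfl, fun _ => rfl⟩ _ _ fun _ => rfl
    rw [r]
    refine Finset.sum_congr rfl fun x _ => Finset.sum_congr rfl fun y _ =>
      Finset.sum_congr rfl fun z _ => Finset.sum_congr rfl fun w _ =>
      Finset.sum_congr rfl fun _ _ => Finset.sum_congr rfl fun _ _ => ?_
    simp
    ring
  rw [lhs]
  simp only [e2]
  rw [Fintype.sum_prod_type]
  simp only [mixedAt, sum_fin_two_arrow, Fin.prod_univ_two, Finset.mul_sum, Finset.sum_mul]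
  have r : ∀ f : ι → ι → ι → ι → ι → ι → ℂ, ∑ x, ∑ y, ∑ z, ∑ w, ∑ b, ∑ a, f a b x y z w =
      ∑ z, ∑ w, ∑ a, ∑ b, ∑ x, ∑ y, f a b x y z w := by
    intro f
    simp only [← Fintype.sum_prod_type']
    exact Fintype.sum_equiv
      ⟨fun q => (q.2.2.1, q.2.2.2.1, q.2.2.2.2.2, q.2.2.2.2.1, q.1, q.2.1),
      fun q => (q.2.2.2.2.1, q.2.2.2.2.2, q.1, q.2.1, q.2.2.2.1, q.2.2.1),
      fun _ => rfl, fun _ => rfl⟩ _ _ fun _ => rfl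
  rw [r]
  refine Finset.sum_congr rfl fun x _ => Finset.sum_congr rfl fun y _ =>
    Finset.sum_congr rfl fun z _ => Finset.sum_congr rfl fun w _ =>
    Finset.sum_congr rfl fun _ _ => Finset.sum_congr rfl fun _ _ => ?_
  simp
  ring

/-- The Lovelock tensor as an operation on the metric, its inverse and the curvature tensor. -/
def lovelockAt (k : ℕ) (ι : Type) [Fintype ι] [DecidableEq ι] (G Q : Matrix ι ι ℂ)
    (R : (Fin 4 → ι) → ℂ) : Matrix ι ι ℂ :=
  (-(1 / 2 ^ (k + 1)) : ℂ) • (G * deltaContr fun c d : Fin k × Fin 2 → ι =>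
    ∏ l, mixedAt Q R (fun s => d (l, s)) fun s => c (l, s))

/-- A product of sums is a sum over families; a family of pairs of index pairs is, by currying, a
pair of maps on `Fin k × Fin 2`. -/
lemma prod_mixedAt_frameChange (k : ℕ) {P : Matrix ι κ ℂ} {P' : Matrix κ ι ℂ} (h : P * P' = 1)
    (Q : Matrix ι ι ℂ) (R : (Fin 4 → ι) → ℂ) (c d : Fin k × Fin 2 → κ) :
    ∏ l, mixedAt (P' * Q * P'.transpose) (frameChange P R) (fun s => d (l, s))
        (fun s => c (l, s)) =
      ∑ c₁ : Fin k × Fin 2 → ι, ∑ d₁ : Fin k × Fin 2 → ι,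
        (∏ s, P (c₁ s) (c s)) * (∏ s, P' (d s) (d₁ s)) *
          ∏ l, mixedAt Q R (fun s => d₁ (l, s)) fun s => c₁ (l, s) := by
  simp only [mixedAt_frameChange h]
  rw [Finset.prod_univ_sum, Fintype.piFinset_univ, ← Fintype.sum_prod_type']
  refine Fintype.sum_equiv ((Equiv.arrowProdEquivProdArrow (Fin k) (fun _ => Fin 2 → ι)
    (fun _ => Fin 2 → ι)).trans
      ((Equiv.curry (Fin k) (Fin 2) ι).symm.prodCongr (Equiv.curry (Fin k) (Fin 2) ι).symm))
    _ _ fun φ => ?_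
  simp only [Finset.prod_mul_distrib, Fintype.prod_prod_type]
  rfl

lemma isNatural_lovelockAt (k : ℕ) : IsNatural fun ι _ _ => lovelockAt k ι where
  differentiable G Q a b := by
    simp only [lovelockAt, deltaContr, mixedAt, Matrix.smul_apply, Matrix.mul_apply,
      Matrix.of_apply, smul_eq_mul]
    fun_prop
  equivariant P P' h h' G Q R := by
    simp only [lovelockAt]
    rw [deltaContr_equivariant h h' _ _ fun c d => prod_mixedAt_frameChange k h Q R c d]
    simp only [Matrix.mul_smul, Matrix.smul_mul]
    congr 1
    rw [Matrix.mul_assoc P', ← Matrix.mul_assoc _ P', Matrix.mul_assoc _ P, h, Matrix.mul_one]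
    simp only [Matrix.mul_assoc]

end Lovelock

/-! ### Partial derivatives -/

section PartialDerivatives

variable {ι : Type} [Fintype ι] [DecidableEq ι] {f g : (ι → ℝ) → ℝ} {p : ι → ℝ}

lemma pd_congr {U : Set (ι → ℝ)} (hU : IsOpen U) (h : ∀ q ∈ U, f q = g q) (hp : p ∈ U) (i : ι) :
    pd i f p = pd i g p := by
  have : f =ᶠ[nhds p] g := Filter.eventuallyEq_of_mem (hU.mem_nhds hp) h
  rw [pd, pd, this.fderiv_eq]

lemma pd_add (hf : DifferentiableAt ℝ f p) (hg : DifferentiableAt ℝ g p) (i : ι) :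
    pd i (fun q => f q + g q) p = pd i f p + pd i g p := by
  simp only [pd, fderiv_fun_add hf hg]; rfl

lemma pd_sub (hf : DifferentiableAt ℝ f p) (hg : DifferentiableAt ℝ g p) (i : ι) :
    pd i (fun q => f q - g q) p = pd i f p - pd i g p := by
  simp only [pd, fderiv_fun_sub hf hg]; rfl

lemma pd_mul (hf : DifferentiableAt ℝ f p) (hg : DifferentiableAt ℝ g p) (i : ι) :
    pd i (fun q => f q * g q) p = f p * pd i g p + pd i f p * g p := by
  simp only [pd, fderiv_fun_mul hf hg]
  simp
  ring

lemma pd_const (c : ℝ) (i : ι) : pd i (fun _ : ι → ℝ => c) p = 0 := by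
  simp [pd]

lemma pd_const_mul (hf : DifferentiableAt ℝ f p) (c : ℝ) (i : ι) :
    pd i (fun q => c * f q) p = c * pd i f p := by
  rw [pd_mul (by fun_prop) hf, pd_const, zero_mul, add_zero]

lemma pd_mul_const (hf : DifferentiableAt ℝ f p) (c : ℝ) (i : ι) :
    pd i (fun q => f q * c) p = pd i f p * c := by
  rw [pd_mul hf (by fun_prop), pd_const, mul_zero, zero_add]

lemma pd_comp_coord {φ : ℝ → ℝ} {φ' : ℝ} {j : ι} (h : HasDerivAt φ φ' (p j)) (i : ι) :
    pd i (fun q => φ (q j)) p = if i = j then φ' else 0 := by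
  have h1 : HasFDerivAt (fun q : ι → ℝ => q j) (ContinuousLinearMap.proj (R := ℝ) j) p :=
    (ContinuousLinearMap.proj (R := ℝ) (φ := fun _ : ι => ℝ) j).hasFDerivAt
  have h2 := h.comp_hasFDerivAt p h1
  have h3 : (fun q : ι → ℝ => φ (q j)) = φ ∘ fun q => q j := rfl
  rw [pd, h3, h2.fderiv]
  by_cases hij : i = j
  · subst hij; simp
  · simp [hij, Ne.symm hij]

lemma contDiffAt_pd (hf : ContDiffAt ℝ ∞ f p) (i : ι) : ContDiffAt ℝ ∞ (fun q => pd i f q) p := by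
  have h : ContDiffAt ℝ ∞ (fderiv ℝ f) p := hf.fderiv_right (m := ∞) le_rfl
  exact h.clm_apply contDiffAt_const

lemma pd_comm (hf : ContDiffAt ℝ ∞ f p) (i j : ι) : pd i (pd j f) p = pd j (pd i f) p := by
  have h2 : DifferentiableAt ℝ (fderiv ℝ f) p :=
    (hf.fderiv_right (m := ∞) le_rfl).differentiableAt (by simp)
  have h : ∀ i j, pd i (pd j f) p = fderiv ℝ (fderiv ℝ f) p (Pi.single i 1) (Pi.single j 1) := by
    intro i j
    have h3 := h2.hasFDerivAt.clm_apply (hasFDerivAt_const (Pi.single j 1 : ι → ℝ) p)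
    change fderiv ℝ (fun q => fderiv ℝ f q (Pi.single j 1)) p (Pi.single i 1) = _
    rw [h3.fderiv]
    simp
  rw [h, h]
  exact hf.isSymmSndFDerivAt (by
    rw [minSmoothness_of_isRCLikeNormedField]
    exact WithTop.coe_le_coe.mpr (le_top : (2 : ℕ∞) ≤ ⊤)) _ _

end PartialDerivatives

/-! ### The metric in coordinates -/

section Metric

variable {N : ℕ} (lam : ℝ) (H : HSpace N → ℝ)

lemma contDiff_toHSpace : ContDiff ℝ ∞ (toHSpace : (Coord N → ℝ) → HSpace N) := by
  unfold toHSpace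
  fun_prop

lemma isOpen_preimage_toHSpace {W : Set (HSpace N)} (hW : IsOpen W) : IsOpen (toHSpace ⁻¹' W) :=
  hW.preimage contDiff_toHSpace.continuous

/-- The component of the metric along `du²`. -/
def guu (q : Coord N → ℝ) : ℝ := lam * q cv ^ 2 + H (toHSpace q)

/-- The components of the inverse of the metric. -/
def kgtInv (q : Coord N → ℝ) : Matrix (Coord N) (Coord N) ℝ :=
  Matrix.fromBlocks !![0, 1; 1, -guu lam H q] 0 0
    (Matrix.diagonal fun i : Fin (N - 1) × Fin 2 =>
      |lam| * if i.2 = 0 then 1 else 1 / sFun lam (q (cx i.1)) ^ 2)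

variable {lam H}

lemma kgtMetric_mul_kgtInv (hlam : lam ≠ 0) {q : Coord N → ℝ}
    (hs : ∀ α, sFun lam (q (cx α)) ≠ 0) : kgtMetric lam H q * kgtInv lam H q = 1 := by
  have hl : |lam| ≠ 0 := abs_ne_zero.mpr hlam
  rw [kgtMetric, kgtInv, Matrix.fromBlocks_multiply, ← Matrix.fromBlocks_one]
  simp only [Matrix.mul_zero, Matrix.zero_mul, add_zero, zero_add, Matrix.diagonal_mul_diagonal]
  congr 1
  · ext i j
    fin_cases i <;> fin_cases j <;> simp [Matrix.mul_apply, guu]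
  · rw [← Matrix.diagonal_one]
    congr 1
    funext i
    have := hs i.1
    split_ifs <;> field_simp

lemma inv_kgtMetric (hlam : lam ≠ 0) {q : Coord N → ℝ}
    (hs : ∀ α, sFun lam (q (cx α)) ≠ 0) : (kgtMetric lam H q)⁻¹ = kgtInv lam H q :=
  Matrix.inv_eq_right_inv (kgtMetric_mul_kgtInv hlam hs)

lemma transpose_kgtMetric (q : Coord N → ℝ) :
    (kgtMetric lam H q).transpose = kgtMetric lam H q := by
  rw [kgtMetric, Matrix.fromBlocks_transpose, Matrix.diagonal_transpose]
  congr 1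
  ext i j
  fin_cases i <;> fin_cases j <;> rfl

lemma kgtMetric_comm (q : Coord N → ℝ) (a b : Coord N) :
    kgtMetric lam H q a b = kgtMetric lam H q b a :=
  congrFun (congrFun (transpose_kgtMetric q) b) a

variable (lam)

/-- The sign of `lam`. -/
def sgn : ℝ := if 0 < lam then 1 else -1

variable {lam}

lemma hasDerivAt_sFun (x : ℝ) : HasDerivAt (sFun lam) (cFun lam x) x := by
  unfold sFun cFun
  split_ifs
  · exact Real.hasDerivAt_sin x
  · exact Real.hasDerivAt_sinh x

/-- The sign lets one formula, here and in `cFun_sq`, cover the trigonometric and the hyperbolic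
case. -/
lemma hasDerivAt_cFun (x : ℝ) : HasDerivAt (cFun lam) (-(sgn lam * sFun lam x)) x := by
  unfold sFun cFun sgn
  split_ifs
  · simpa using Real.hasDerivAt_cos x
  · simpa using Real.hasDerivAt_cosh x

lemma cFun_sq (x : ℝ) : cFun lam x ^ 2 = 1 - sgn lam * sFun lam x ^ 2 := by
  unfold sFun cFun sgn
  split_ifs
  · rw [Real.cos_sq']; ring
  · rw [Real.cosh_sq]; ring

lemma sgn_mul_abs : sgn lam * |lam| = lam := by
  unfold sgn
  split_ifs with h
  · rw [abs_of_pos h, one_mul]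
  · rw [abs_of_nonpos (not_lt.mp h)]; ring

variable (lam) in
/-- The transverse part of the Christoffel symbols. -/
def transChristoffel (q : Coord N → ℝ) : Coord N → Coord N → Coord N → ℝ
  | .inr d, .inr a, .inr b =>
    if d.1 = a.1 ∧ d.1 = b.1 then
      if d.2 = 0 then
        if a.2 = 1 ∧ b.2 = 1 then -(sFun lam (q (cx d.1)) * cFun lam (q (cx d.1))) else 0
      else if a.2 = b.2 then 0 else cFun lam (q (cx d.1)) / sFun lam (q (cx d.1))
    else 0
  | _, _, _ => 0

variable (lam) in
/-- The partial derivative by the coordinate `a` of the transverse metric. -/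
def transDeriv (q : Coord N → ℝ) : Coord N → Coord N → Coord N → ℝ
  | .inr a, .inr e, .inr b =>
    if e = b ∧ e.1 = a.1 ∧ a.2 = 0 ∧ e.2 = 1 then
      2 / |lam| * (sFun lam (q (cx e.1)) * cFun lam (q (cx e.1)))
    else 0
  | _, _, _ => 0

variable (lam H) in
/-- The gradient of `guu`. -/
def dguu (q : Coord N → ℝ) (a : Coord N) : ℝ :=
  (if a = cv then 2 * lam * q cv else 0) + pd a (fun q => H (toHSpace q)) q

variable (lam H) in
/-- The gradient of `guu` with the index raised. -/
def dguuUp (q : Coord N → ℝ) (d : Coord N) : ℝ := ∑ e, kgtInv lam H q d e * dguu lam H q e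

variable (lam H) in
/-- The closed form of the Christoffel symbols. -/
def kgtChristoffel (q : Coord N → ℝ) (d a b : Coord N) : ℝ :=
  1 / 2 * ((if d = cv then 1 else 0) * (dguu lam H q a * (if b = cu then 1 else 0) +
      dguu lam H q b * (if a = cu then 1 else 0)) -
    dguuUp lam H q d * ((if a = cu then 1 else 0) * (if b = cu then 1 else 0))) +
  transChristoffel lam q d a b

variable {W : Set (HSpace N)}

lemma contDiffAt_comp_toHSpace (hW : IsOpen W) (hH : ContDiffOn ℝ ∞ H W) {p : Coord N → ℝ}
    (hp : p ∈ toHSpace ⁻¹' W) : ContDiffAt ℝ ∞ (fun q => H (toHSpace q)) p :=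
  (hH.contDiffAt (hW.mem_nhds hp)).comp p contDiff_toHSpace.contDiffAt

lemma pd_guu {p : Coord N → ℝ} (hH : ContDiffAt ℝ ∞ (fun q => H (toHSpace q)) p) (a : Coord N) :
    pd a (guu lam H) p = dguu lam H p a := by
  have h1 : DifferentiableAt ℝ (fun q => H (toHSpace q)) p := hH.differentiableAt (by simp)
  have h2 : HasDerivAt (fun x => lam * x ^ 2) (2 * lam * p cv) (p cv) := by
    have := (hasDerivAt_pow 2 (p cv)).const_mul lam
    have e : 2 * lam * p cv = lam * (((2 : ℕ) : ℝ) * p cv ^ (2 - 1)) := by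
      norm_num
      ring
    rw [e]
    exact this
  have h3 := pd_comp_coord h2 a
  unfold guu dguu
  rw [pd_add (by fun_prop) h1, h3]

/-- The gradient splits into that of `g_uu` times `du²` and a transverse part. Indicator factors
instead of cases allow the later products to be expanded by `ring`. -/
lemma pd_kgtMetric {p : Coord N → ℝ} (hH : ContDiffAt ℝ ∞ (fun q => H (toHSpace q)) p)
    (a e b : Coord N) : pd a (fun q => kgtMetric lam H q e b) p =
      dguu lam H p a * ((if e = cu then 1 else 0) * (if b = cu then 1 else 0)) +
        transDeriv lam p a e b := by
  rcases e with e | e <;> rcases b with b | b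
  · have h : (fun q => kgtMetric lam H q (.inl e) (.inl b)) = fun q =>
        if e = 0 ∧ b = 0 then guu lam H q else if e = b then 0 else 1 := by
      funext q
      fin_cases e <;> fin_cases b <;> simp [kgtMetric, guu]
    rw [h]
    have h0 : transDeriv lam p a (.inl e) (.inl b) = 0 := by
      cases a <;> rfl
    rw [h0]
    fin_cases e <;> fin_cases b <;> simp [pd_const]
    exact pd_guu hH a
  · have h : (fun q => kgtMetric lam H q (.inl e) (.inr b)) = fun q => 0 := by
      funext q
      simp [kgtMetric]
    rw [h, pd_const]
    cases a <;> simp [transDeriv]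
  · have h : (fun q => kgtMetric lam H q (.inr e) (.inl b)) = fun q => 0 := by
      funext q
      simp [kgtMetric]
    rw [h, pd_const]
    cases a <;> simp [transDeriv]
  · by_cases heb : e = b
    · subst heb
      obtain ⟨α, k⟩ := e
      fin_cases k
      · have h : (fun q => kgtMetric lam H q (cx α) (cx α)) = fun q => 1 / |lam| := by
          funext q
          simp [kgtMetric]
        simp only [Fin.zero_eta, h, pd_const]
        cases a <;> simp [transDeriv]
      · have h : (fun q => kgtMetric lam H q (cy α) (cy α)) =
            fun q => 1 / |lam| * sFun lam (q (cx α)) ^ 2 := by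
          funext q
          simp [kgtMetric]
        have h2 := ((hasDerivAt_sFun (lam := lam) (p (cx α))).pow 2).const_mul (1 / |lam|)
        have h3 := pd_comp_coord h2 a
        simp only [Pi.pow_apply] at h3
        simp only [Fin.mk_one, h, h3]
        rcases a with a | ⟨β, k⟩
        · simp [transDeriv]
        · by_cases hβ : α = β
          · subst hβ
            fin_cases k <;> simp [transDeriv]
            ring
          · simp [transDeriv, hβ, Ne.symm hβ]
    · have h : (fun q => kgtMetric lam H q (.inr e) (.inr b)) = fun q => 0 := by
        funext q
        simp [kgtMetric, heb]
      rw [h, pd_const]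
      cases a <;> simp [transDeriv, heb]

lemma sum_kgtInv (q : Coord N → ℝ) (d : Coord N) (X : Coord N → ℝ) :
    ∑ e, kgtInv lam H q d e * X e = (if d = cv then X cu - guu lam H q * X cv else 0) +
      (if d = cu then X cv else 0) + (kgtInv lam H q d d * if d.isRight then X d else 0) := by
  rcases d with d | d
  · fin_cases d <;> simp [kgtInv, Fintype.sum_sum_type]
    ring
  · simp [kgtInv, Fintype.sum_sum_type, Matrix.diagonal_apply]

lemma christoffel_kgtMetric (hlam : lam ≠ 0) {p : Coord N → ℝ}
    (hs : ∀ α, sFun lam (p (cx α)) ≠ 0)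
    (hH : ContDiffAt ℝ ∞ (fun q => H (toHSpace q)) p) (d a b : Coord N) :
    christoffel (kgtMetric lam H) d a b p = kgtChristoffel lam H p d a b := by
  have hl : |lam| ≠ 0 := abs_ne_zero.mpr hlam
  -- Raising the index of `du` gives `∂_v`.
  have e1 : ∑ e, kgtInv lam H p d e * (if e = cu then 1 else 0) = if d = cv then 1 else 0 := by
    rw [sum_kgtInv]
    rcases d with d | d <;> simp
  have e2 : 1 / 2 * ∑ e, kgtInv lam H p d e * (transDeriv lam p a e b + transDeriv lam p b e a -
      transDeriv lam p e a b) = transChristoffel lam p d a b := by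
    rw [sum_kgtInv]
    rcases d with d | ⟨α, i⟩
    · simp [transChristoffel, transDeriv]
    · rcases a with a | ⟨β, j⟩
      · cases b <;> simp [transChristoffel, transDeriv]
      · rcases b with b | ⟨γ, k⟩
        · simp [transChristoffel, transDeriv]
        · have := hs α
          by_cases h1 : α = β
          · subst h1
            by_cases h2 : α = γ
            · subst h2
              fin_cases i <;> fin_cases j <;> fin_cases k <;>
                simp [transChristoffel, transDeriv, kgtInv] <;> field_simp
            · simp [transChristoffel, transDeriv, h2]
          · by_cases h2 : α = γ
            · subst h2
              simp [transChristoffel, transDeriv, h1, Ne.symm h1]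
            · simp [transChristoffel, transDeriv, h1, Ne.symm h1, h2]
  simp only [christoffel, inv_kgtMetric hlam hs, pd_kgtMetric hH, kgtChristoffel, dguuUp]
  rw [← e1, ← e2]
  simp only [Finset.sum_mul, Finset.mul_sum, ← Finset.sum_add_distrib, ← Finset.sum_sub_distrib]
  refine Finset.sum_congr rfl fun e _ => ?_
  ring

end Metric

/-! ### Derivatives and products of the Christoffel symbols -/

section Curvature

variable {N : ℕ} {lam : ℝ} {H : HSpace N → ℝ} {W : Set (HSpace N)}

lemma pd_cv_comp_toHSpace (hW : IsOpen W) (hH : ContDiffOn ℝ ∞ H W) {p : Coord N → ℝ}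
    (hp : p ∈ toHSpace ⁻¹' W) : pd cv (fun q => H (toHSpace q)) p = 0 := by
  have h1 : DifferentiableAt ℝ H (toHSpace p) :=
    (hH.contDiffAt (hW.mem_nhds hp)).differentiableAt (by simp)
  have h2 : DifferentiableAt ℝ (toHSpace : (Coord N → ℝ) → HSpace N) p :=
    contDiff_toHSpace.differentiable (by simp) p
  have h3 : HasDerivAt (fun t : ℝ => p + t • (Pi.single cv 1 : Coord N → ℝ))
      (Pi.single cv 1) 0 := by
    simpa using ((hasDerivAt_id (0 : ℝ)).smul_const (Pi.single cv 1 : Coord N → ℝ)).const_add p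
  have h4 : DifferentiableAt ℝ (fun q => H (toHSpace q)) p := h1.comp p h2
  have h7 : HasFDerivAt (fun q => H (toHSpace q)) (fderiv ℝ (fun q => H (toHSpace q)) p)
      (p + (0 : ℝ) • (Pi.single cv 1 : Coord N → ℝ)) := by
    simpa using h4.hasFDerivAt
  have h5 : HasDerivAt (fun t : ℝ => H (toHSpace (p + t • (Pi.single cv 1 : Coord N → ℝ))))
      (pd cv (fun q => H (toHSpace q)) p) 0 := by
    have := h7.comp_hasDerivAt (0 : ℝ) h3
    exact this
  have h6 : (fun t : ℝ => H (toHSpace (p + t • (Pi.single cv 1 : Coord N → ℝ)))) =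
      fun _ => H (toHSpace p) := by
    funext t
    congr 1
    simp [toHSpace]
  rw [h6] at h5
  exact h5.unique (hasDerivAt_const _ _)

lemma dguu_cv (hW : IsOpen W) (hH : ContDiffOn ℝ ∞ H W) {p : Coord N → ℝ}
    (hp : p ∈ toHSpace ⁻¹' W) : dguu lam H p cv = 2 * lam * p cv := by
  simp [dguu, pd_cv_comp_toHSpace hW hH hp]

variable (H) in
/-- The second partial derivatives of `H`. -/
def hessian (p : Coord N → ℝ) (c a : Coord N) : ℝ := pd c (pd a fun q => H (toHSpace q)) p

lemma hessian_comm (hW : IsOpen W) (hH : ContDiffOn ℝ ∞ H W) {p : Coord N → ℝ}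
    (hp : p ∈ toHSpace ⁻¹' W) (a c : Coord N) : hessian H p a c = hessian H p c a :=
  pd_comm (contDiffAt_comp_toHSpace hW hH hp) a c

lemma hessian_cv_right (hW : IsOpen W) (hH : ContDiffOn ℝ ∞ H W) {p : Coord N → ℝ}
    (hp : p ∈ toHSpace ⁻¹' W) (c : Coord N) : hessian H p c cv = 0 := by
  rw [hessian, pd_congr (isOpen_preimage_toHSpace hW)
    (fun q hq => pd_cv_comp_toHSpace hW hH hq) hp c, pd_const]

lemma hessian_cv_left (hW : IsOpen W) (hH : ContDiffOn ℝ ∞ H W) {p : Coord N → ℝ}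
    (hp : p ∈ toHSpace ⁻¹' W) (c : Coord N) : hessian H p cv c = 0 := by
  rw [hessian_comm hW hH hp, hessian_cv_right hW hH hp]

lemma differentiableAt_coord_mul {p : Coord N → ℝ} (a : Coord N) :
    DifferentiableAt ℝ (fun q : Coord N → ℝ => if a = cv then 2 * lam * q cv else 0) p := by
  split_ifs <;> fun_prop

lemma differentiableAt_dguu (hW : IsOpen W) (hH : ContDiffOn ℝ ∞ H W) {p : Coord N → ℝ}
    (hp : p ∈ toHSpace ⁻¹' W) (a : Coord N) :
    DifferentiableAt ℝ (fun q => dguu lam H q a) p :=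
  (differentiableAt_coord_mul a).add
    ((contDiffAt_pd (contDiffAt_comp_toHSpace hW hH hp) a).differentiableAt (by simp))

lemma pd_dguu (hW : IsOpen W) (hH : ContDiffOn ℝ ∞ H W) {p : Coord N → ℝ}
    (hp : p ∈ toHSpace ⁻¹' W) (c a : Coord N) :
    pd c (fun q => dguu lam H q a) p =
      (if c = cv ∧ a = cv then 2 * lam else 0) + hessian H p c a := by
  have h1 := (contDiffAt_pd (contDiffAt_comp_toHSpace hW hH hp) a).differentiableAt (by simp)
  simp only [dguu]
  rw [pd_add (differentiableAt_coord_mul a) h1]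
  congr 1
  by_cases ha : a = cv
  · simp only [ha, if_true, and_true]
    have h2 : HasDerivAt (fun x : ℝ => 2 * lam * x) (2 * lam) (p cv) := by
      simpa using (hasDerivAt_id (p cv)).const_mul (2 * lam)
    exact pd_comp_coord h2 c
  · simp [ha, pd_const]

lemma dguuUp_cu (q : Coord N → ℝ) : dguuUp lam H q cu = dguu lam H q cv := by
  rw [dguuUp, sum_kgtInv]
  simp

lemma dguuUp_cv (q : Coord N → ℝ) :
    dguuUp lam H q cv = dguu lam H q cu - guu lam H q * dguu lam H q cv := by
  rw [dguuUp, sum_kgtInv]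
  simp

lemma dguuUp_inr (q : Coord N → ℝ) (i : Fin (N - 1) × Fin 2) : dguuUp lam H q (.inr i) =
    |lam| * (if i.2 = 0 then 1 else 1 / sFun lam (q (cx i.1)) ^ 2) * dguu lam H q (.inr i) := by
  rw [dguuUp, sum_kgtInv]
  simp [kgtInv]

lemma differentiableAt_guu (hW : IsOpen W) (hH : ContDiffOn ℝ ∞ H W) {p : Coord N → ℝ}
    (hp : p ∈ toHSpace ⁻¹' W) : DifferentiableAt ℝ (guu lam H) p := by
  have h1 : DifferentiableAt ℝ (fun q => H (toHSpace q)) p :=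
    (contDiffAt_comp_toHSpace hW hH hp).differentiableAt (by simp)
  have h2 : DifferentiableAt ℝ (fun q : Coord N → ℝ => lam * q cv ^ 2) p := by fun_prop
  exact h2.add h1

lemma hasDerivAt_inv_sFun_sq {x : ℝ} (hx : sFun lam x ≠ 0) :
    HasDerivAt (fun x => 1 / sFun lam x ^ 2) (-2 * cFun lam x / sFun lam x ^ 3) x := by
  have h := ((hasDerivAt_sFun (lam := lam) x).pow 2).inv (pow_ne_zero 2 hx)
  simp only [one_div]
  refine h.congr_deriv ?_
  simp only [Pi.pow_apply]
  field_simp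
  norm_num
  ring

lemma differentiableAt_comp_coord {φ : ℝ → ℝ} {p : Coord N → ℝ} {j : Coord N} {φ' : ℝ}
    (h : HasDerivAt φ φ' (p j)) : DifferentiableAt ℝ (fun q : Coord N → ℝ => φ (q j)) p :=
  DifferentiableAt.comp p (g := φ) h.differentiableAt
    (ContinuousLinearMap.proj (R := ℝ) (φ := fun _ : Coord N => ℝ) j).differentiableAt

lemma differentiableAt_dguuUp (hW : IsOpen W) (hH : ContDiffOn ℝ ∞ H W)
    (hs : ∀ w ∈ W, ∀ α, sFun lam (w.2.1 α) ≠ 0) {p : Coord N → ℝ}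
    (hp : p ∈ toHSpace ⁻¹' W) (d : Coord N) :
    DifferentiableAt ℝ (fun q => dguuUp lam H q d) p := by
  have hF := differentiableAt_dguu (lam := lam) hW hH hp
  rcases d with d | ⟨α, k⟩
  · fin_cases d
    · simp only [Fin.zero_eta, dguuUp_cu]
      exact hF cv
    · simp only [Fin.mk_one, dguuUp_cv]
      exact (hF cu).sub ((differentiableAt_guu hW hH hp).mul (hF cv))
  · have h1 : DifferentiableAt ℝ (fun q : Coord N → ℝ => 1 / sFun lam (q (cx α)) ^ 2) p :=
      differentiableAt_comp_coord (hasDerivAt_inv_sFun_sq (hs _ hp α))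
    have h2 := hF (.inr (α, k))
    simp only [dguuUp_inr]
    split_ifs
    · fun_prop
    · exact (h1.const_mul _).mul h2

lemma hasDerivAt_sFun_mul_cFun (x : ℝ) : HasDerivAt (fun x => -(sFun lam x * cFun lam x))
    (-1 + 2 * sgn lam * sFun lam x ^ 2) x := by
  refine ((hasDerivAt_sFun (lam := lam) x).mul (hasDerivAt_cFun x)).neg.congr_deriv ?_
  linear_combination -cFun_sq (lam := lam) x

lemma hasDerivAt_cFun_div_sFun {x : ℝ} (hx : sFun lam x ≠ 0) :
    HasDerivAt (fun x => cFun lam x / sFun lam x) (-1 / sFun lam x ^ 2) x := by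
  refine ((hasDerivAt_cFun (lam := lam) x).div (hasDerivAt_sFun x) hx).congr_deriv ?_
  congr 1
  linear_combination -cFun_sq (lam := lam) x

variable (lam) in
/-- The partial derivatives of the transverse Christoffel symbols. -/
def transChristoffelDeriv (q : Coord N → ℝ) (c : Coord N) : Coord N → Coord N → Coord N → ℝ
  | .inr d, .inr a, .inr b =>
    if c = cx d.1 ∧ d.1 = a.1 ∧ d.1 = b.1 then
      if d.2 = 0 then
        if a.2 = 1 ∧ b.2 = 1 then -1 + 2 * sgn lam * sFun lam (q (cx d.1)) ^ 2 else 0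
      else if a.2 = b.2 then 0 else -1 / sFun lam (q (cx d.1)) ^ 2
    else 0
  | _, _, _ => 0

lemma pd_transChristoffel (hs : ∀ w ∈ W, ∀ α, sFun lam (w.2.1 α) ≠ 0) {p : Coord N → ℝ}
    (hp : p ∈ toHSpace ⁻¹' W) (c d a b : Coord N) :
    DifferentiableAt ℝ (fun q => transChristoffel lam q d a b) p ∧
    pd c (fun q => transChristoffel lam q d a b) p = transChristoffelDeriv lam p c d a b := by
  rcases d with d | ⟨α, k⟩
  · simp only [transChristoffel, transChristoffelDeriv, pd_const]
    exact ⟨by fun_prop, trivial⟩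
  rcases a with a | a
  · simp only [transChristoffel, transChristoffelDeriv, pd_const]
    exact ⟨by fun_prop, trivial⟩
  rcases b with b | b
  · simp only [transChristoffel, transChristoffelDeriv, pd_const]
    exact ⟨by fun_prop, trivial⟩
  obtain ⟨β, j⟩ := a
  obtain ⟨γ, l⟩ := b
  by_cases h : α = β ∧ α = γ
  · obtain ⟨rfl, rfl⟩ := h
    have h1 := hasDerivAt_sFun_mul_cFun (lam := lam) (p (cx α))
    have h2 := hasDerivAt_cFun_div_sFun (lam := lam) (x := p (cx α)) (hs _ hp α)
    have h3 := pd_comp_coord h1 c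
    have h4 := pd_comp_coord (p := p) (j := cx α) h2 c
    have h5 := differentiableAt_comp_coord h1
    have h6 := differentiableAt_comp_coord (p := p) (j := cx α) h2
    fin_cases k <;> fin_cases j <;> fin_cases l <;>
      simp [transChristoffel, transChristoffelDeriv, pd_const, h3, h4, h5, h6]
  · have h2 : ¬(c = cx α ∧ α = β ∧ α = γ) := fun h' => h h'.2
    have e1 : (fun q => transChristoffel lam q (.inr (α, k)) (.inr (β, j)) (.inr (γ, l))) =
        fun _ => 0 := by
      funext q
      exact if_neg h
    have e2 : transChristoffelDeriv lam p c (.inr (α, k)) (.inr (β, j)) (.inr (γ, l)) = 0 :=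
      if_neg h2
    rw [e1, e2, pd_const]
    exact ⟨by fun_prop, rfl⟩

/-! ### Christoffel symbols: derivatives and products -/

lemma pd_kgtChristoffel (hW : IsOpen W) (hH : ContDiffOn ℝ ∞ H W)
    (hs : ∀ w ∈ W, ∀ α, sFun lam (w.2.1 α) ≠ 0) {p : Coord N → ℝ}
    (hp : p ∈ toHSpace ⁻¹' W) (c d a b : Coord N) :
    pd c (fun q => kgtChristoffel lam H q d a b) p =
      1 / 2 * ((if d = cv then 1 else 0) *
        (pd c (fun q => dguu lam H q a) p * (if b = cu then 1 else 0) +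
          pd c (fun q => dguu lam H q b) p * (if a = cu then 1 else 0)) -
        pd c (fun q => dguuUp lam H q d) p * ((if a = cu then 1 else 0) * (if b = cu then 1 else 0)))
      + transChristoffelDeriv lam p c d a b := by
  have hF := differentiableAt_dguu (lam := lam) hW hH hp
  have hU := differentiableAt_dguuUp hW hH hs hp d
  obtain ⟨hT, hT'⟩ := pd_transChristoffel hs hp c d a b
  have ha := hF a
  have hb := hF b
  simp only [kgtChristoffel]
  rw [pd_add (by fun_prop) hT, hT', pd_const_mul (by fun_prop), pd_sub (by fun_prop) (by fun_prop),
    pd_const_mul (by fun_prop), pd_add (by fun_prop) (by fun_prop), pd_mul_const ha,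
    pd_mul_const hb, pd_mul_const hU]

/-- As functions of the summed index the factors have the shapes `A [e = u] + B dguu e + T` and `C
[e = v] - D dguuUp e + T'`, with `T`, `T'` transverse. Of the nine sums, three vanish, two give
`dguu` at `v`, and four stay. -/
lemma sum_kgtChristoffel_mul (q : Coord N → ℝ) (a b c d : Coord N) :
    ∑ e, kgtChristoffel lam H q a c e * kgtChristoffel lam H q e d b =
      1 / 4 * (-((if a = cv then 1 else 0) * dguu lam H q c * dguu lam H q cv *
            ((if d = cu then 1 else 0) * (if b = cu then 1 else 0))) +
          (if a = cv then 1 else 0) * (if c = cu then 1 else 0) *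
            (dguu lam H q cv * (dguu lam H q d * (if b = cu then 1 else 0) +
              dguu lam H q b * (if d = cu then 1 else 0)) -
            (∑ e, dguu lam H q e * dguuUp lam H q e) *
              ((if d = cu then 1 else 0) * (if b = cu then 1 else 0))) +
          dguuUp lam H q a * dguu lam H q cv * (if c = cu then 1 else 0) *
            ((if d = cu then 1 else 0) * (if b = cu then 1 else 0))) +
        1 / 2 * (if a = cv then 1 else 0) * (if c = cu then 1 else 0) *
          (∑ e, dguu lam H q e * transChristoffel lam q e d b) -
        1 / 2 * (∑ e, transChristoffel lam q a c e * dguuUp lam H q e) *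
          ((if d = cu then 1 else 0) * (if b = cu then 1 else 0)) +
        ∑ e, transChristoffel lam q a c e * transChristoffel lam q e d b := by
  have t1 : transChristoffel lam q cu d b = 0 := rfl
  have t2 : transChristoffel lam q a c cv = 0 := by
    rcases a with a | a <;> rcases c with c | c <;> rfl
  have s1 : ∑ e, (if e = cu then (1 : ℝ) else 0) * dguuUp lam H q e = dguu lam H q cv := by
    simp [dguuUp_cu]
  have s2 : ∑ e : Coord N, (if e = cu then (1 : ℝ) else 0) * (if e = cv then 1 else 0) = 0 := by
    simp
  have s3 : ∑ e, (if e = cu then (1 : ℝ) else 0) * transChristoffel lam q e d b = 0 := by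
    simp [t1]
  have s4 : ∑ e, dguu lam H q e * (if e = cv then (1 : ℝ) else 0) = dguu lam H q cv := by
    simp
  have s5 : ∑ e, transChristoffel lam q a c e * (if e = cv then (1 : ℝ) else 0) = 0 := by
    simp [t2]
  generalize hA : 1 / 2 * ((if a = cv then 1 else 0) * dguu lam H q c -
    dguuUp lam H q a * (if c = cu then 1 else 0)) = A
  generalize hB : 1 / 2 * ((if a = cv then (1 : ℝ) else 0) * (if c = cu then 1 else 0)) = B
  generalize hC : 1 / 2 * (dguu lam H q d * (if b = cu then 1 else 0) +
    dguu lam H q b * (if d = cu then 1 else 0)) = C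
  generalize hD : 1 / 2 * ((if d = cu then (1 : ℝ) else 0) * (if b = cu then 1 else 0)) = D
  have key : ∀ e, kgtChristoffel lam H q a c e * kgtChristoffel lam H q e d b =
      A * C * ((if e = cu then 1 else 0) * (if e = cv then 1 else 0)) -
      A * D * ((if e = cu then 1 else 0) * dguuUp lam H q e) +
      A * ((if e = cu then 1 else 0) * transChristoffel lam q e d b) +
      B * C * (dguu lam H q e * (if e = cv then 1 else 0)) -
      B * D * (dguu lam H q e * dguuUp lam H q e) +
      B * (dguu lam H q e * transChristoffel lam q e d b) +
      C * (transChristoffel lam q a c e * (if e = cv then 1 else 0)) -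
      D * (transChristoffel lam q a c e * dguuUp lam H q e) +
      transChristoffel lam q a c e * transChristoffel lam q e d b := by
    intro e
    simp only [kgtChristoffel, ← hA, ← hB, ← hC, ← hD]
    ring
  simp only [key, Finset.sum_add_distrib, Finset.sum_sub_distrib, ← Finset.mul_sum, s1, s2, s3,
    s4, s5]
  rw [← hA, ← hB, ← hC, ← hD]
  ring

variable (lam H) in
/-- The covariant second derivative of `guu` for the transverse connection. -/
def covHess (p : Coord N → ℝ) (c b : Coord N) : ℝ :=
  pd c (fun q => dguu lam H q b) p - ∑ e, dguu lam H p e * transChristoffel lam p e c b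

variable (lam H) in
/-- The covariant derivative of the raised gradient of `guu` for the transverse connection. -/
def covHessUp (p : Coord N → ℝ) (c a : Coord N) : ℝ :=
  pd c (fun q => dguuUp lam H q a) p + ∑ e, transChristoffel lam p a c e * dguuUp lam H p e

variable (lam H) in
/-- Half of the curvature tensor: antisymmetrization in `c`, `d` yields `Rᵃ_{bcd}`. -/
def halfCurv (p : Coord N → ℝ) (a b c d : Coord N) : ℝ :=
  1 / 2 * (if a = cv then 1 else 0) * (if d = cu then 1 else 0) * covHess lam H p c b -
    1 / 2 * (if b = cu then 1 else 0) * (if d = cu then 1 else 0) * covHessUp lam H p c a +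
    1 / 2 * (if a = cv then 1 else 0) * dguu lam H p cv * (if b = cu then 1 else 0) *
      (if c = cu then 1 else 0) * dguu lam H p d +
    (transChristoffelDeriv lam p c a d b +
      ∑ e, transChristoffel lam p a c e * transChristoffel lam p e d b)

end Curvature

/-! ### The Riemann tensor in closed form -/

section Curvature

variable {N : ℕ} {lam : ℝ} {H : HSpace N → ℝ} {W : Set (HSpace N)}

/-- Antisymmetrization in `c`, `d` removes the mixed second derivatives of `g_uu` and the terms
containing both `[c = u]` and `[d = u]`; the remaining products of two gradients, with factor `1 /
4`, combine into one with factor `1 / 2`. -/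
lemma riemannUp_eq_halfCurv (hlam : lam ≠ 0) (hW : IsOpen W) (hH : ContDiffOn ℝ ∞ H W)
    (hs : ∀ w ∈ W, ∀ α, sFun lam (w.2.1 α) ≠ 0) {p : Coord N → ℝ}
    (hp : p ∈ toHSpace ⁻¹' W) (a b c d : Coord N) :
    riemannUp (kgtMetric lam H) a b c d p = halfCurv lam H p a b c d - halfCurv lam H p a b d c := by
  have hU := isOpen_preimage_toHSpace hW
  have hC : ∀ q ∈ toHSpace ⁻¹' W, ∀ d a b, christoffel (kgtMetric lam H) d a b q =
      kgtChristoffel lam H q d a b := by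
    intro q hq d a b
    have h1 : ∀ α, sFun lam (q (cx α)) ≠ 0 := hs (toHSpace q) hq
    exact christoffel_kgtMetric hlam h1 (contDiffAt_comp_toHSpace hW hH hq) d a b
  have hD : ∀ c d a b, pd c (christoffel (kgtMetric lam H) d a b) p =
      pd c (fun q => kgtChristoffel lam H q d a b) p := fun c d a b =>
    pd_congr hU (fun q hq => hC q hq d a b) hp c
  have hdd : pd c (fun q => dguu lam H q d) p = pd d (fun q => dguu lam H q c) p := by
    rw [pd_dguu hW hH hp, pd_dguu hW hH hp, hessian_comm hW hH hp c d]
    simp only [and_comm]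
  rw [riemannUp, hD, hD, pd_kgtChristoffel hW hH hs hp, pd_kgtChristoffel hW hH hs hp]
  simp only [hC p hp]
  rw [Finset.sum_sub_distrib, sum_kgtChristoffel_mul, sum_kgtChristoffel_mul]
  simp only [halfCurv, covHess, covHessUp]
  rw [hdd]
  generalize (if a = cv then (1 : ℝ) else 0) = k
  generalize (if b = cu then (1 : ℝ) else 0) = l₁
  generalize (if c = cu then (1 : ℝ) else 0) = l₂
  generalize (if d = cu then (1 : ℝ) else 0) = l₃
  ring

lemma pd_dguuUp_cu (p : Coord N → ℝ) (c : Coord N) :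
    pd c (fun q => dguuUp lam H q cu) p = pd c (fun q => dguu lam H q cv) p := by
  simp only [dguuUp_cu]

lemma pd_dguuUp_cv (hW : IsOpen W) (hH : ContDiffOn ℝ ∞ H W) {p : Coord N → ℝ}
    (hp : p ∈ toHSpace ⁻¹' W) (c : Coord N) :
    pd c (fun q => dguuUp lam H q cv) p = pd c (fun q => dguu lam H q cu) p -
      (guu lam H p * pd c (fun q => dguu lam H q cv) p + dguu lam H p c * dguu lam H p cv) := by
  have hF := differentiableAt_dguu (lam := lam) hW hH hp
  have hg := differentiableAt_guu (lam := lam) hW hH hp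
  simp only [dguuUp_cv]
  rw [pd_sub (hF cu) (hg.fun_mul (hF cv)), pd_mul hg (hF cv),
    pd_guu (contDiffAt_comp_toHSpace hW hH hp)]

lemma pd_dguuUp_inr (hW : IsOpen W) (hH : ContDiffOn ℝ ∞ H W)
    (hs : ∀ w ∈ W, ∀ α, sFun lam (w.2.1 α) ≠ 0) {p : Coord N → ℝ}
    (hp : p ∈ toHSpace ⁻¹' W) (c : Coord N) (α : Fin (N - 1)) (k : Fin 2) :
    pd c (fun q => dguuUp lam H q (.inr (α, k))) p = |lam| *
      ((if k = 0 then 1 else 1 / sFun lam (p (cx α)) ^ 2) *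
          pd c (fun q => dguu lam H q (.inr (α, k))) p +
        (if c = cx α ∧ k = 1 then -2 * cFun lam (p (cx α)) / sFun lam (p (cx α)) ^ 3 else 0) *
          dguu lam H p (.inr (α, k))) := by
  have h1 := hasDerivAt_inv_sFun_sq (lam := lam) (x := p (cx α)) (hs (toHSpace p) hp α)
  have h2 := differentiableAt_comp_coord (p := p) (j := cx α) h1
  have h3 := differentiableAt_dguu (lam := lam) hW hH hp (.inr (α, k))
  have h4 := pd_comp_coord (p := p) (j := cx α) h1 c
  simp only [dguuUp_inr]
  fin_cases k
  · simp only [Fin.zero_eta, if_true, mul_one] at h3 ⊢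
    rw [pd_const_mul h3]
    simp
  · simp only [Fin.mk_one, one_ne_zero, if_false, and_true] at h3 ⊢
    rw [pd_mul (h2.const_mul _) h3, pd_const_mul h2, h4]
    ring

lemma covHess_cv (hW : IsOpen W) (hH : ContDiffOn ℝ ∞ H W) {p : Coord N → ℝ}
    (hp : p ∈ toHSpace ⁻¹' W) (b : Coord N) :
    covHess lam H p cv b = if b = cv then 2 * lam else 0 := by
  rw [covHess, pd_dguu hW hH hp, hessian_cv_left hW hH hp]
  have : ∀ e, transChristoffel lam p e cv b = 0 := by
    intro e
    cases e <;> rfl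
  simp [this]

lemma covHess_inl (p : Coord N → ℝ) (c : Coord N) (b : Fin 2) :
    covHess lam H p c (.inl b) = pd c (fun q => dguu lam H q (.inl b)) p := by
  have : ∀ e, transChristoffel lam p e c (.inl b) = 0 := by
    intro e
    cases e <;> cases c <;> rfl
  simp [covHess, this]

lemma pd_dguu_inr_cv (hW : IsOpen W) (hH : ContDiffOn ℝ ∞ H W) {p : Coord N → ℝ}
    (hp : p ∈ toHSpace ⁻¹' W) (i : Fin (N - 1) × Fin 2) :
    pd (.inr i) (fun q => dguu lam H q cv) p = 0 := by
  rw [pd_dguu hW hH hp, hessian_cv_right hW hH hp]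
  simp

lemma covHessUp_inl (p : Coord N → ℝ) (c a : Coord N) (h : c.isLeft ∨ a.isLeft) :
    covHessUp lam H p c a = pd c (fun q => dguuUp lam H q a) p := by
  have : ∀ e, transChristoffel lam p a c e = 0 := by
    intro e
    rcases a with a | a <;> rcases c with c | c <;> first | rfl | simp at h
  simp [covHessUp, this]

lemma sum_transChristoffel_mul (p : Coord N → ℝ) (α : Fin (N - 1)) (i : Fin 2) (a : Coord N)
    (X : Coord N → ℝ) : ∑ e, transChristoffel lam p (.inr (α, i)) a e * X e =
      transChristoffel lam p (.inr (α, i)) a (cx α) * X (cx α) +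
        transChristoffel lam p (.inr (α, i)) a (cy α) * X (cy α) := by
  have h1 : ∀ e : Fin 2, transChristoffel lam p (.inr (α, i)) a (.inl e) = 0 := by
    intro e
    cases a <;> rfl
  rw [Fintype.sum_sum_type, Fintype.sum_prod_type, Fintype.sum_eq_single α]
  · simp [h1]
  · intro β hβ
    have h2 : ∀ k, transChristoffel lam p (.inr (α, i)) a (.inr (β, k)) = 0 := by
      intro k
      rcases a with a | a
      · rfl
      · exact if_neg fun h => hβ h.2.symm
    simp [h2]

lemma sum_mul_transChristoffel (p : Coord N → ℝ) (α : Fin (N - 1)) (i : Fin 2) (b : Coord N)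
    (X : Coord N → ℝ) : ∑ e, X e * transChristoffel lam p e (.inr (α, i)) b =
      X (cx α) * transChristoffel lam p (cx α) (.inr (α, i)) b +
        X (cy α) * transChristoffel lam p (cy α) (.inr (α, i)) b := by
  have h1 : ∀ e : Fin 2, transChristoffel lam p (.inl e) (.inr (α, i)) b = 0 := fun _ => rfl
  rw [Fintype.sum_sum_type, Fintype.sum_prod_type, Fintype.sum_eq_single α]
  · simp [h1]
  · intro β hβ
    have h2 : ∀ k, transChristoffel lam p (.inr (β, k)) (.inr (α, i)) b = 0 := by
      intro k
      rcases b with b | b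
      · rfl
      · exact if_neg fun h => hβ h.1
    simp [h2]

/-- Raising an index commutes with the covariant derivative, because the transverse connection is
compatible with the transverse metric. -/
lemma covHessUp_inr (hW : IsOpen W) (hH : ContDiffOn ℝ ∞ H W)
    (hs : ∀ w ∈ W, ∀ α, sFun lam (w.2.1 α) ≠ 0) {p : Coord N → ℝ}
    (hp : p ∈ toHSpace ⁻¹' W) (i j : Fin (N - 1) × Fin 2) :
    covHessUp lam H p (.inr j) (.inr i) =
      kgtInv lam H p (.inr i) (.inr i) * covHess lam H p (.inr j) (.inr i) := by
  obtain ⟨α, k⟩ := i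
  obtain ⟨β, l⟩ := j
  have h0 : sFun lam (p (cx α)) ≠ 0 := hs (toHSpace p) hp α
  rw [covHessUp, covHess, pd_dguuUp_inr hW hH hs hp]
  by_cases h : α = β
  · subst h
    rw [sum_transChristoffel_mul, sum_mul_transChristoffel]
    fin_cases k <;> fin_cases l <;>
      simp [transChristoffel, kgtInv, dguuUp_inr] <;>
      field_simp <;> ring
  · have h1 : ∀ e, transChristoffel lam p e (.inr (β, l)) (.inr (α, k)) = 0 := by
      rintro (e | e)
      · rfl
      · exact if_neg fun h' => h (h'.2.symm.trans h'.1)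
    have h2 : ∀ e, transChristoffel lam p (.inr (α, k)) (.inr (β, l)) e = 0 := by
      rintro (e | e)
      · rfl
      · exact if_neg fun h' => h h'.1
    have h3 : ¬(Sum.inr (β, l) = cx α ∧ k = 1) := by
      rintro ⟨h3, _⟩
      simp only [Sum.inr.injEq, Prod.mk.injEq] at h3
      exact h h3.1.symm
    rw [if_neg h3]
    simp [h1, h2, kgtInv]
    split_ifs <;> ring

/-- The block of a coordinate. -/
def blk : Coord N → Option (Fin (N - 1)) := Sum.elim (fun _ => none) fun i => some i.1

variable (lam) in
/-- Half of the transverse curvature. -/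
def halfTransCurv (p : Coord N → ℝ) (a b c d : Coord N) : ℝ :=
  transChristoffelDeriv lam p c a d b +
    ∑ e, transChristoffel lam p a c e * transChristoffel lam p e d b

lemma halfTransCurv_eq_zero (p : Coord N → ℝ) (a b c d : Coord N) (h : c.isLeft ∨ d.isLeft) :
    halfTransCurv lam p a b c d = 0 := by
  have h1 : transChristoffelDeriv lam p c a d b = 0 := by
    rcases a with a | a <;> rcases d with d | d <;> rcases b with b | b <;> rcases c with c | c <;>
      first | rfl | exact absurd h (by simp)
  have h2 : ∀ e, transChristoffel lam p a c e * transChristoffel lam p e d b = 0 := by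
    intro e
    rcases c with c | c
    · rcases a with a | a <;> simp [transChristoffel]
    · rcases d with d | d
      · rcases e with e | e <;> simp [transChristoffel]
      · simp at h
  simp [halfTransCurv, h1, h2]

/-- The surface with metric `dx² + s² dy²` has curvature `sgn lam`; the factor `1 / |lam|` turns
this into `lam`. Components that mix blocks vanish on both sides. -/
lemma halfTransCurv_inr (hlam : lam ≠ 0) (hs : ∀ w ∈ W, ∀ α, sFun lam (w.2.1 α) ≠ 0)
    {p : Coord N → ℝ} (hp : p ∈ toHSpace ⁻¹' W) (a b : Coord N) (c d : Fin (N - 1) × Fin 2) :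
    halfTransCurv lam p a b (.inr c) (.inr d) - halfTransCurv lam p a b (.inr d) (.inr c) =
      lam * (if blk a = blk b then (if a = .inr c then kgtMetric lam H p b (.inr d) else 0) else 0) -
      lam * (if blk a = blk b then (if a = .inr d then kgtMetric lam H p b (.inr c) else 0) else 0)
      := by
  rcases a with a | ⟨α, i⟩
  · simp [halfTransCurv, transChristoffel, transChristoffelDeriv]
  rcases b with b | ⟨β, j⟩
  · have : ∀ e d, transChristoffel lam p e d (.inl b) = 0 := by
      intro e d
      rcases e with e | e <;> rcases d with d | d <;> rfl
    simp [halfTransCurv, this, transChristoffelDeriv, blk]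
  obtain ⟨γ, k⟩ := c
  obtain ⟨δ, l⟩ := d
  have h0 : sFun lam (p (cx α)) ≠ 0 := hs (toHSpace p) hp α
  by_cases hall : α = β ∧ α = γ ∧ α = δ
  · obtain ⟨rfl, rfl, rfl⟩ := hall
    have h1 := cFun_sq (lam := lam) (p (cx α))
    have hl : |lam| ≠ 0 := abs_ne_zero.mpr hlam
    have h2 : lam * |lam|⁻¹ = sgn lam := by
      rw [← div_eq_mul_inv, div_eq_iff hl, sgn_mul_abs]
    have q1 : sFun lam (p (cx α)) * cFun lam (p (cx α)) *
        (cFun lam (p (cx α)) / sFun lam (p (cx α))) = 1 - sgn lam * sFun lam (p (cx α)) ^ 2 := by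
      rw [← h1]
      field_simp
    have q2 : -1 / sFun lam (p (cx α)) ^ 2 + cFun lam (p (cx α)) / sFun lam (p (cx α)) *
        (cFun lam (p (cx α)) / sFun lam (p (cx α))) = -sgn lam := by
      field_simp
      rw [h1]
      ring
    rw [halfTransCurv, halfTransCurv, sum_transChristoffel_mul, sum_transChristoffel_mul]
    fin_cases i <;> fin_cases j <;> fin_cases k <;> fin_cases l <;>
      simp [transChristoffel, transChristoffelDeriv, blk, kgtMetric]
    · linear_combination q1 - sFun lam (p (cx α)) ^ 2 * h2
    · linear_combination -q1 + sFun lam (p (cx α)) ^ 2 * h2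
    · linear_combination q2 + h2
    · linear_combination -q2 - h2
  · have e1 : ∀ γ δ k l, ¬(α = β ∧ α = γ ∧ α = δ) →
        halfTransCurv lam p (.inr (α, i)) (.inr (β, j)) (.inr (γ, k)) (.inr (δ, l)) = 0 := by
      intro γ δ k l hall
      have t1 : transChristoffelDeriv lam p (.inr (γ, k)) (.inr (α, i)) (.inr (δ, l))
          (.inr (β, j)) = 0 := by
        refine if_neg ?_
        rintro ⟨h1, h2, h3⟩
        simp only [Sum.inr.injEq, Prod.mk.injEq] at h1
        exact hall ⟨h3, h1.1.symm, h2⟩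
      have t2 : ∀ e, transChristoffel lam p (.inr (α, i)) (.inr (γ, k)) e *
          transChristoffel lam p e (.inr (δ, l)) (.inr (β, j)) = 0 := by
        rintro (e | e)
        · exact zero_mul _
        · by_cases h1 : α = γ ∧ α = e.1
          · refine mul_eq_zero_of_right _ (if_neg ?_)
            rintro ⟨h2, h3⟩
            exact hall ⟨h1.2.trans h3, h1.1, h1.2.trans h2⟩
          · exact mul_eq_zero_of_left (if_neg h1) _
      simp [halfTransCurv, t1, t2]
    have e2 : ∀ γ δ k l, ¬(α = β ∧ α = γ ∧ α = δ) →
        (if blk (.inr (α, i)) = blk (.inr (β, j)) then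
          (if (.inr (α, i) : Coord N) = .inr (γ, k) then
            kgtMetric lam H p (.inr (β, j)) (.inr (δ, l)) else 0) else 0) = 0 := by
      intro γ δ k l hall
      split_ifs with h1 h2
      · simp only [blk, Sum.elim_inr, Option.some.injEq, Sum.inr.injEq, Prod.mk.injEq] at h1 h2
        have h3 : ((β, j) : Fin (N - 1) × Fin 2) ≠ (δ, l) := by
          intro h3
          simp only [Prod.mk.injEq] at h3
          exact hall ⟨h1, h2.1, h1.trans h3.1⟩
        simp [kgtMetric, h3]
      · rfl
      · rfl
    have hall' : ¬(α = β ∧ α = δ ∧ α = γ) := fun h => hall ⟨h.1, h.2.2, h.2.1⟩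
    rw [e1 _ _ _ _ hall, e1 _ _ _ _ hall', e2 _ _ _ _ hall, e2 _ _ _ _ hall']
    ring

variable (lam H) in
/-- The tensor `h` for which `R_{uiuj} = h_{ij}`. -/
def waveTensor (p : Coord N → ℝ) : Coord N → Coord N → ℝ
  | .inr i, .inr j => -(1 / 2) * covHess lam H p (.inr j) (.inr i)
  | _, _ => 0

variable (lam H) in
/-- Half of the curvature tensor in closed form. -/
def curvForm (p : Coord N → ℝ) (a b c d : Coord N) : ℝ :=
  lam * (if blk a = blk b then (if a = c then kgtMetric lam H p b d else 0) else 0) +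
    (if a = cv then 1 else 0) * (if c = cu then 1 else 0) * waveTensor lam H p b d +
    (if b = cu then 1 else 0) * (if d = cu then 1 else 0) *
      (kgtInv lam H p a a * waveTensor lam H p a c)

/-- Here the term `lam v²` acts: the second `v`-derivative `2 lam` of `g_uu` gives the `(u, v)`
block constant curvature `lam`. -/
lemma riemannUp_cu_cv (hlam : lam ≠ 0) (hW : IsOpen W) (hH : ContDiffOn ℝ ∞ H W)
    (hs : ∀ w ∈ W, ∀ α, sFun lam (w.2.1 α) ≠ 0) {p : Coord N → ℝ}
    (hp : p ∈ toHSpace ⁻¹' W) (a b : Coord N) :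
    riemannUp (kgtMetric lam H) a b cu cv p =
      curvForm lam H p a b cu cv - curvForm lam H p a b cv cu := by
  have hv := dguu_cv (lam := lam) hW hH hp
  have hdd : ∀ b, pd cv (fun q => dguu lam H q b) p = if b = cv then 2 * lam else 0 := by
    intro b
    rw [pd_dguu hW hH hp, hessian_cv_left hW hH hp]
    simp
  have hz : ∀ a b c d : Coord N, c.isLeft ∨ d.isLeft → transChristoffelDeriv lam p c a d b +
      ∑ e, transChristoffel lam p a c e * transChristoffel lam p e d b = 0 := fun a b c d h =>
    halfTransCurv_eq_zero p a b c d h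
  rw [riemannUp_eq_halfCurv hlam hW hH hs hp, halfCurv, halfCurv, hz _ _ _ _ (by simp),
    hz _ _ _ _ (by simp), covHess_cv hW hH hp, covHessUp_inl p cv a (by simp), hv]
  rcases a with a | ⟨α, i⟩
  · fin_cases a
    · simp only [Fin.zero_eta, pd_dguuUp_cu, hdd]
      rcases b with b | b
      · fin_cases b <;> simp [curvForm, blk, kgtMetric, waveTensor]
      · simp [curvForm, blk, waveTensor]
    · simp only [Fin.mk_one, pd_dguuUp_cv hW hH hp, hdd, hv]
      rcases b with b | b
      · fin_cases b <;> simp [curvForm, blk, kgtMetric, waveTensor, guu]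
        ring
      · simp [curvForm, blk, waveTensor]
  · rw [pd_dguuUp_inr hW hH hs hp, hdd]
    rcases b with b | b
    · fin_cases b <;> simp [curvForm, waveTensor]
    · simp [curvForm, waveTensor]

/-- The components through which the transverse Hessian of `H` enters the curvature. -/
lemma riemannUp_cu_inr (hlam : lam ≠ 0) (hW : IsOpen W) (hH : ContDiffOn ℝ ∞ H W)
    (hs : ∀ w ∈ W, ∀ α, sFun lam (w.2.1 α) ≠ 0) {p : Coord N → ℝ}
    (hp : p ∈ toHSpace ⁻¹' W) (a b : Coord N) (j : Fin (N - 1) × Fin 2) :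
    riemannUp (kgtMetric lam H) a b cu (.inr j) p =
      curvForm lam H p a b cu (.inr j) - curvForm lam H p a b (.inr j) cu := by
  have hv := dguu_cv (lam := lam) hW hH hp
  have hdv := pd_dguu_inr_cv (lam := lam) hW hH hp j
  have hz : ∀ a b c d : Coord N, c.isLeft ∨ d.isLeft → transChristoffelDeriv lam p c a d b +
      ∑ e, transChristoffel lam p a c e * transChristoffel lam p e d b = 0 := fun a b c d h =>
    halfTransCurv_eq_zero p a b c d h
  rw [riemannUp_eq_halfCurv hlam hW hH hs hp, halfCurv, halfCurv, hz _ _ _ _ (by simp),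
    hz _ _ _ _ (by simp)]
  rcases b with b | b
  · simp only [covHess_inl]
    rcases a with a | i
    · rw [covHessUp_inl p (.inr j) _ (by simp)]
      fin_cases a
      · simp only [Fin.zero_eta, pd_dguuUp_cu, hdv]
        fin_cases b <;> simp [curvForm, blk, kgtMetric, waveTensor]
      · simp only [Fin.mk_one, pd_dguuUp_cv hW hH hp, hdv, hv]
        fin_cases b <;> simp [curvForm, blk, waveTensor, hdv]
        ring
    · rw [covHessUp_inr hW hH hs hp]
      fin_cases b <;> simp [curvForm, blk, waveTensor]
      ring
  · rcases a with a | i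
    · fin_cases a <;> simp [curvForm, blk, waveTensor]
    · simp [curvForm, kgtMetric, waveTensor]

lemma riemannUp_cv_inr (hlam : lam ≠ 0) (hW : IsOpen W) (hH : ContDiffOn ℝ ∞ H W)
    (hs : ∀ w ∈ W, ∀ α, sFun lam (w.2.1 α) ≠ 0) {p : Coord N → ℝ}
    (hp : p ∈ toHSpace ⁻¹' W) (a b : Coord N) (j : Fin (N - 1) × Fin 2) :
    riemannUp (kgtMetric lam H) a b cv (.inr j) p =
      curvForm lam H p a b cv (.inr j) - curvForm lam H p a b (.inr j) cv := by
  have hz : ∀ a b c d : Coord N, c.isLeft ∨ d.isLeft → transChristoffelDeriv lam p c a d b +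
      ∑ e, transChristoffel lam p a c e * transChristoffel lam p e d b = 0 := fun a b c d h =>
    halfTransCurv_eq_zero p a b c d h
  rw [riemannUp_eq_halfCurv hlam hW hH hs hp, halfCurv, halfCurv, hz _ _ _ _ (by simp),
    hz _ _ _ _ (by simp)]
  rcases b with b | b
  · rcases a with a | i
    · fin_cases b <;> simp [curvForm, kgtMetric]
    · fin_cases b <;> simp [curvForm, blk]
  · rcases a with a | a <;> simp [curvForm, kgtMetric, blk]

lemma riemannUp_inr_inr (hlam : lam ≠ 0) (hW : IsOpen W) (hH : ContDiffOn ℝ ∞ H W)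
    (hs : ∀ w ∈ W, ∀ α, sFun lam (w.2.1 α) ≠ 0) {p : Coord N → ℝ}
    (hp : p ∈ toHSpace ⁻¹' W) (a b : Coord N) (c d : Fin (N - 1) × Fin 2) :
    riemannUp (kgtMetric lam H) a b (.inr c) (.inr d) p =
      curvForm lam H p a b (.inr c) (.inr d) - curvForm lam H p a b (.inr d) (.inr c) := by
  have h := halfTransCurv_inr (H := H) hlam hs hp a b c d
  rw [riemannUp_eq_halfCurv hlam hW hH hs hp, halfCurv, halfCurv]
  simp only [halfTransCurv] at h
  simp only [curvForm, reduceCtorEq, if_false, mul_zero, zero_mul, sub_zero, zero_add, add_zero, h]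

lemma riemannUp_swap (g : (Coord N → ℝ) → Matrix (Coord N) (Coord N) ℝ) (a b c d : Coord N)
    (p : Coord N → ℝ) : riemannUp g a b c d p = -riemannUp g a b d c p := by
  simp only [riemannUp, Finset.sum_sub_distrib]
  ring

lemma riemannUp_kgtMetric (hlam : lam ≠ 0) (hW : IsOpen W) (hH : ContDiffOn ℝ ∞ H W)
    (hs : ∀ w ∈ W, ∀ α, sFun lam (w.2.1 α) ≠ 0) {p : Coord N → ℝ}
    (hp : p ∈ toHSpace ⁻¹' W) (a b c d : Coord N) :
    riemannUp (kgtMetric lam H) a b c d p =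
      curvForm lam H p a b c d - curvForm lam H p a b d c := by
  have hself : ∀ c, riemannUp (kgtMetric lam H) a b c c p =
      curvForm lam H p a b c c - curvForm lam H p a b c c := fun c => by
    rw [riemannUp_eq_halfCurv hlam hW hH hs hp, sub_self, sub_self]
  rcases c with c | c <;> rcases d with d | d
  · fin_cases c <;> fin_cases d
    · exact hself _
    · exact riemannUp_cu_cv hlam hW hH hs hp a b
    · rw [riemannUp_swap]
      exact neg_eq_iff_eq_neg.mpr ((riemannUp_cu_cv hlam hW hH hs hp a b).trans (neg_sub _ _).symm)
    · exact hself _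
  · fin_cases c
    · exact riemannUp_cu_inr hlam hW hH hs hp a b d
    · exact riemannUp_cv_inr hlam hW hH hs hp a b d
  · rw [riemannUp_swap, neg_eq_iff_eq_neg, neg_sub]
    fin_cases d
    · exact riemannUp_cu_inr hlam hW hH hs hp a b c
    · exact riemannUp_cv_inr hlam hW hH hs hp a b c
  · exact riemannUp_inr_inr hlam hW hH hs hp a b c d

end Curvature

/-! ### Lowered Riemann tensor, Ricci tensor and the Einstein condition -/

section RicciTensor

variable {N : ℕ} {lam : ℝ} {H : HSpace N → ℝ} {W : Set (HSpace N)}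

lemma kgtMetric_cv (p : Coord N → ℝ) (a : Coord N) :
    kgtMetric lam H p a cv = if a = cu then 1 else 0 := by
  rcases a with a | a
  · fin_cases a <;> simp [kgtMetric]
  · simp [kgtMetric]

lemma kgtMetric_eq_zero_of_blk {p : Coord N → ℝ} {a b : Coord N} (h : blk a ≠ blk b) :
    kgtMetric lam H p a b = 0 := by
  rcases a with a | a <;> rcases b with b | b
  · exact absurd rfl h
  · simp [kgtMetric]
  · simp [kgtMetric]
  · have : a ≠ b := fun h' => h (by rw [h'])
    simp [kgtMetric, this]

lemma kgtMetric_mul_kgtInv_inr (hlam : lam ≠ 0) (hs : ∀ w ∈ W, ∀ α, sFun lam (w.2.1 α) ≠ 0)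
    {p : Coord N → ℝ} (hp : p ∈ toHSpace ⁻¹' W) (i : Fin (N - 1) × Fin 2) :
    kgtMetric lam H p (.inr i) (.inr i) * kgtInv lam H p (.inr i) (.inr i) = 1 := by
  have h0 : sFun lam (p (cx i.1)) ≠ 0 := hs (toHSpace p) hp i.1
  have hl : |lam| ≠ 0 := abs_ne_zero.mpr hlam
  simp only [kgtMetric, kgtInv, Matrix.fromBlocks_apply₂₂, Matrix.diagonal_apply_eq]
  split_ifs <;> field_simp

lemma waveTensor_inl_left (p : Coord N → ℝ) (a : Fin 2) (b : Coord N) :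
    waveTensor lam H p (.inl a) b = 0 := rfl

lemma waveTensor_inl_right (p : Coord N → ℝ) (a : Coord N) (b : Fin 2) :
    waveTensor lam H p a (.inl b) = 0 := by
  cases a <;> rfl

lemma sum_kgtMetric_mul_curvForm (hlam : lam ≠ 0)
    (hs : ∀ w ∈ W, ∀ α, sFun lam (w.2.1 α) ≠ 0) {p : Coord N → ℝ} (hp : p ∈ toHSpace ⁻¹' W)
    (a b c d : Coord N) : ∑ e, kgtMetric lam H p a e * curvForm lam H p e b c d =
      lam * (if blk a = blk b then kgtMetric lam H p a c * kgtMetric lam H p b d else 0) +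
      (if a = cu then 1 else 0) * (if c = cu then 1 else 0) * waveTensor lam H p b d +
      (if b = cu then 1 else 0) * (if d = cu then 1 else 0) * waveTensor lam H p a c := by
  have s1 : ∑ e, kgtMetric lam H p a e *
      (if blk e = blk b then (if e = c then kgtMetric lam H p b d else 0) else 0) =
      if blk a = blk b then kgtMetric lam H p a c * kgtMetric lam H p b d else 0 := by
    rw [Fintype.sum_eq_single c (fun e he => by simp [he])]
    by_cases h : blk a = blk c
    · simp [h]
    · simp [kgtMetric_eq_zero_of_blk h]
  have s2 : ∑ e, kgtMetric lam H p a e * (if e = cv then 1 else 0) = if a = cu then 1 else 0 := by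
    simp [kgtMetric_cv]
  have s3 : ∑ e, kgtMetric lam H p a e * (kgtInv lam H p e e * waveTensor lam H p e c) =
      waveTensor lam H p a c := by
    rcases a with a | a
    · rw [waveTensor_inl_left]
      refine Finset.sum_eq_zero fun e _ => ?_
      rcases e with e | e
      · rw [waveTensor_inl_left, mul_zero, mul_zero]
      · simp [kgtMetric]
    · rw [Fintype.sum_eq_single (.inr a)]
      · rw [← mul_assoc, kgtMetric_mul_kgtInv_inr hlam hs hp, one_mul]
      · rintro (e | e) he
        · rw [waveTensor_inl_left, mul_zero, mul_zero]
        · have : a ≠ e := fun h => he (by rw [h])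
          simp [kgtMetric, this]
  rw [← s1, ← s2]
  conv_rhs => rw [← s3]
  simp only [curvForm, Finset.mul_sum, Finset.sum_mul, ← Finset.sum_add_distrib]
  exact Finset.sum_congr rfl fun e _ => by ring

lemma riemann_kgtMetric (hlam : lam ≠ 0) (hW : IsOpen W) (hH : ContDiffOn ℝ ∞ H W)
    (hs : ∀ w ∈ W, ∀ α, sFun lam (w.2.1 α) ≠ 0) {p : Coord N → ℝ}
    (hp : p ∈ toHSpace ⁻¹' W) (i : Fin 4 → Coord N) :
    riemann (kgtMetric lam H) p i =
      lam * (if blk (i 0) = blk (i 1) then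
        kgtMetric lam H p (i 0) (i 2) * kgtMetric lam H p (i 1) (i 3) -
          kgtMetric lam H p (i 0) (i 3) * kgtMetric lam H p (i 1) (i 2) else 0) +
      ((if i 0 = cu then 1 else 0) * (if i 2 = cu then 1 else 0) * waveTensor lam H p (i 1) (i 3) +
      (if i 1 = cu then 1 else 0) * (if i 3 = cu then 1 else 0) * waveTensor lam H p (i 0) (i 2) -
      (if i 0 = cu then 1 else 0) * (if i 3 = cu then 1 else 0) * waveTensor lam H p (i 1) (i 2) -
      (if i 1 = cu then 1 else 0) * (if i 2 = cu then 1 else 0) * waveTensor lam H p (i 0) (i 3))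
      := by
  simp only [riemann, riemannUp_kgtMetric hlam hW hH hs hp, mul_sub, Finset.sum_sub_distrib,
    sum_kgtMetric_mul_curvForm hlam hs hp]
  split_ifs <;> ring

/-- `boxH` is the Laplacian of the transverse metric; its first-order term comes from `Γ^x_{yy} = -s
c` against the inverse metric `|lam| / s²`. -/
lemma sum_kgtInv_mul_waveTensor (hs : ∀ w ∈ W, ∀ α, sFun lam (w.2.1 α) ≠ 0) {p : Coord N → ℝ}
    (hW : IsOpen W) (hH : ContDiffOn ℝ ∞ H W) (hp : p ∈ toHSpace ⁻¹' W) :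
    ∑ a, kgtInv lam H p a a * waveTensor lam H p a a = -(1 / 2) * boxH lam H p := by
  rw [Fintype.sum_sum_type, Fintype.sum_prod_type, boxH, Finset.mul_sum]
  simp only [waveTensor_inl_left, mul_zero, Finset.sum_const_zero, zero_add]
  refine Finset.sum_congr rfl fun α _ => ?_
  have h0 : sFun lam (p (cx α)) ≠ 0 := hs (toHSpace p) hp α
  simp only [Fin.sum_univ_two, waveTensor, covHess, sum_mul_transChristoffel, pd_dguu hW hH hp]
  simp [kgtInv, transChristoffel, hessian, dguu]
  field_simp
  ring

lemma sum_blk_eq (b : Coord N) : ∑ a : Coord N, (if blk a = blk b then (1 : ℝ) else 0) = 2 := by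
  rw [Fintype.sum_sum_type, Fintype.sum_prod_type]
  rcases b with b | b
  · simp [blk]
  · simp [blk]

/-- Every block has two dimensions, so constant curvature `lam` contributes `(2 - 1) lam g`; the
wave part contributes only its trace. -/
lemma ricci_kgtMetric (hlam : lam ≠ 0) (hW : IsOpen W) (hH : ContDiffOn ℝ ∞ H W)
    (hs : ∀ w ∈ W, ∀ α, sFun lam (w.2.1 α) ≠ 0) {p : Coord N → ℝ}
    (hp : p ∈ toHSpace ⁻¹' W) (i : Fin 2 → Coord N) :
    ricci (kgtMetric lam H) p i = lam * kgtMetric lam H p (i 0) (i 1) -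
      1 / 2 * boxH lam H p * ((if i 0 = cu then 1 else 0) * (if i 1 = cu then 1 else 0)) := by
  have s1 : ∑ a, curvForm lam H p a (i 0) a (i 1) = 2 * lam * kgtMetric lam H p (i 0) (i 1) +
      (if i 0 = cu then 1 else 0) * (if i 1 = cu then 1 else 0) * (-(1 / 2) * boxH lam H p) := by
    rw [← sum_kgtInv_mul_waveTensor hs hW hH hp, ← sum_blk_eq (i 0)]
    have : ∀ a : Coord N, (if a = cv then (1 : ℝ) else 0) * (if a = cu then 1 else 0) = 0 := by
      intro a
      split_ifs with h1 h2 <;> simp_all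
    simp only [curvForm, if_true, this, zero_mul, add_zero, Finset.sum_add_distrib, Finset.mul_sum,
      Finset.sum_mul]
    congr 1
    refine Finset.sum_congr rfl fun a _ => ?_
    split_ifs <;> ring
  have s2 : ∑ a, curvForm lam H p a (i 0) (i 1) a = lam * kgtMetric lam H p (i 0) (i 1) := by
    have e1 : ∀ a, curvForm lam H p a (i 0) (i 1) a =
        if a = i 1 then lam * kgtMetric lam H p (i 0) (i 1) else 0 := by
      intro a
      have e2 : (if a = cv then (1 : ℝ) else 0) * (if i 1 = cu then 1 else 0) *
          waveTensor lam H p (i 0) a = 0 := by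
        by_cases h : a = cv
        · rw [h, waveTensor_inl_right, mul_zero]
        · simp [h]
      have e3 : (if i 0 = cu then (1 : ℝ) else 0) * (if a = cu then 1 else 0) *
          (kgtInv lam H p a a * waveTensor lam H p a (i 1)) = 0 := by
        by_cases h : a = cu
        · rw [h, waveTensor_inl_left, mul_zero, mul_zero]
        · simp [h]
      rw [curvForm, e2, e3, add_zero, add_zero]
      by_cases h : a = i 1
      · subst h
        by_cases h2 : blk (i 1) = blk (i 0)
        · simp [h2]
        · simp [h2, kgtMetric_eq_zero_of_blk (Ne.symm h2)]
      · simp [h]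
    simp [e1]
  simp only [ricci, riemannUp_kgtMetric hlam hW hH hs hp, Finset.sum_sub_distrib]
  rw [s1, s2]
  ring

lemma isEinsteinOn_kgtMetric_iff (hlam : lam ≠ 0) (hW : IsOpen W) (hH : ContDiffOn ℝ ∞ H W)
    (hs : ∀ w ∈ W, ∀ α, sFun lam (w.2.1 α) ≠ 0) :
    IsEinsteinOn (kgtMetric lam H) (toHSpace ⁻¹' W) ↔
      ∀ p ∈ toHSpace ⁻¹' W, boxH lam H p = 0 := by
  constructor
  · rintro ⟨c, hc⟩ p hp
    -- The `uv` component forces the Einstein constant to be `lam`; the `uu` component then isolates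
    -- `boxH`.
    have h1 := hc p hp cu cv
    have h2 := hc p hp cu cu
    rw [ricci_kgtMetric hlam hW hH hs hp] at h1 h2
    simp [kgtMetric_cv] at h1 h2
    rw [← h1] at h2
    linarith
  · intro h
    refine ⟨lam, fun p hp a b => ?_⟩
    rw [ricci_kgtMetric hlam hW hH hs hp, h p hp]
    simp

end RicciTensor

/-! ### Covariant derivatives of multiples of the metric -/

section CovariantDerivative

variable {ι : Type} [Fintype ι] [DecidableEq ι] {g : (ι → ℝ) → Matrix ι ι ℝ} {U : Set (ι → ℝ)}
  {p : ι → ℝ}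

lemma sum_mul_christoffel (h : g p * (g p)⁻¹ = 1) (e a b : ι) :
    ∑ d, g p e d * christoffel g d a b p = 1 / 2 * (pd a (fun q => g q e b) p +
      pd b (fun q => g q e a) p - pd e (fun q => g q a b) p) := by
  have h1 : (g p).mulVec ((g p)⁻¹.mulVec fun e => pd a (fun q => g q e b) p +
      pd b (fun q => g q e a) p - pd e (fun q => g q a b) p) =
      fun e => pd a (fun q => g q e b) p +
      pd b (fun q => g q e a) p - pd e (fun q => g q a b) p := by
    rw [Matrix.mulVec_mulVec, h, Matrix.one_mulVec]
  have h2 := congrFun h1 e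
  simp only [Matrix.mulVec, dotProduct] at h2
  rw [← h2, Finset.mul_sum]
  refine Finset.sum_congr rfl fun d _ => ?_
  rw [christoffel]
  ring

/-- Compatibility of the Levi-Civita connection with the metric: the two lowered Christoffel terms
add up to the partial derivative of `g`. -/
lemma covD_eq_zero_of_eq_smul_metric (hU : IsOpen U) (hsymm : ∀ q a b, g q a b = g q b a)
    (hinv : ∀ q ∈ U, g q * (g q)⁻¹ = 1)
    (hg : ∀ q ∈ U, ∀ a b, DifferentiableAt ℝ (fun q => g q a b) q) {T : TensorField ι 2} {c : ℝ}
    (hT : ∀ q ∈ U, ∀ i, T q i = c * g q (i 0) (i 1)) (hp : p ∈ U) (i : Fin 3 → ι) :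
    covD g T p i = 0 := by
  have h1 := sum_mul_christoffel (hinv p hp) (i 2) (i 0) (i 1)
  have h2 := sum_mul_christoffel (hinv p hp) (i 1) (i 0) (i 2)
  have e1 : ∀ k a b, pd k (fun q => g q a b) p = pd k (fun q => g q b a) p := fun k a b => by
    congr 1
    exact funext fun q => hsymm q a b
  have e2 : ∑ j : Fin 2, ∑ d, christoffel g d (i 0) (i j.succ) p *
      T p (Function.update (Fin.tail i) j d) =
      c * (∑ d, g p (i 2) d * christoffel g d (i 0) (i 1) p +
        ∑ d, g p (i 1) d * christoffel g d (i 0) (i 2) p) := by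
    rw [Fin.sum_univ_two, mul_add, Finset.mul_sum, Finset.mul_sum]
    congr 1 <;> refine Finset.sum_congr rfl fun d _ => ?_
    · rw [hT p hp, hsymm p (i 2) d]
      simp [Fin.tail]
      ring
    · rw [hT p hp]
      simp [Fin.tail]
      ring
  rw [covD, e2, h1, h2, pd_congr hU (fun q hq => hT q hq (Fin.tail i)) hp,
    pd_const_mul (hg p hp _ _)]
  have h3 := e1 (i 0) (i 1) (i 2)
  have h4 := e1 (i 1) (i 2) (i 0)
  have h5 := e1 (i 2) (i 1) (i 0)
  simp only [Fin.tail, Fin.succ_zero_eq_one, Fin.succ_one_eq_two]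
  linear_combination c / 2 * (h3 - h4 - h5)

lemma covD_eq_zero_of_eq_zero (hU : IsOpen U) {r : ℕ} {T : TensorField ι r}
    (hT : ∀ q ∈ U, ∀ i, T q i = 0) (hp : p ∈ U) (i : Fin (r + 1) → ι) : covD g T p i = 0 := by
  rw [covD, pd_congr hU (fun q hq => hT q hq (Fin.tail i)) hp, pd_const]
  simp [hT p hp]

lemma covD_eq_zero_of_eq_const (hU : IsOpen U) {T : TensorField ι 0} {c : ℝ}
    (hT : ∀ q ∈ U, ∀ i, T q i = c) (hp : p ∈ U) (i : Fin 1 → ι) : covD g T p i = 0 := by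
  rw [covD, pd_congr hU (fun q hq => hT q hq (Fin.tail i)) hp, pd_const]
  simp

lemma covDIter_eq_zero_of_eq_smul_metric (hU : IsOpen U) (hsymm : ∀ q a b, g q a b = g q b a)
    (hinv : ∀ q ∈ U, g q * (g q)⁻¹ = 1)
    (hg : ∀ q ∈ U, ∀ a b, DifferentiableAt ℝ (fun q => g q a b) q) {T : TensorField ι 2} {c : ℝ}
    (hT : ∀ q ∈ U, ∀ i, T q i = c * g q (i 0) (i 1)) {j : ℕ} (hj : j ≠ 0) (hp : p ∈ U)
    (i : Fin (2 + j) → ι) : covDIter g T j p i = 0 := by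
  induction j generalizing p with
  | zero => exact absurd rfl hj
  | succ j ih =>
    rcases eq_or_ne j 0 with rfl | h
    · exact covD_eq_zero_of_eq_smul_metric hU hsymm hinv hg hT hp i
    · exact covD_eq_zero_of_eq_zero hU (fun q hq i => ih h hq i) hp i

end CovariantDerivative

/-! ### The metric is Lorentzian -/

section Lorentzian

variable {N : ℕ} {lam : ℝ} {H : HSpace N → ℝ} {W : Set (HSpace N)}

lemma contDiff_sFun : ContDiff ℝ ∞ (sFun lam) := by
  unfold sFun
  split_ifs
  · exact Real.contDiff_sin
  · exact Real.contDiff_sinh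

lemma contDiffAt_kgtMetric (hW : IsOpen W) (hH : ContDiffOn ℝ ∞ H W) {p : Coord N → ℝ}
    (hp : p ∈ toHSpace ⁻¹' W) (a b : Coord N) :
    ContDiffAt ℝ ∞ (fun q => kgtMetric lam H q a b) p := by
  have h := contDiffAt_comp_toHSpace hW hH hp
  have hs : ∀ i : Coord N, ContDiffAt ℝ ∞ (fun q : Coord N → ℝ => sFun lam (q i)) p := fun i =>
    contDiff_sFun.contDiffAt.comp p (by fun_prop)
  rcases a with a | a <;> rcases b with b | b
  · fin_cases a <;> fin_cases b <;> simp only [kgtMetric, Matrix.fromBlocks_apply₁₁] <;> simp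
    · exact (by fun_prop : ContDiffAt ℝ ∞ (fun q : Coord N → ℝ => lam * q cv ^ 2) p).add h
    all_goals exact contDiffAt_const
  · simpa only [kgtMetric, Matrix.fromBlocks_apply₁₂] using contDiffAt_const
  · simpa only [kgtMetric, Matrix.fromBlocks_apply₂₁] using contDiffAt_const
  · simp only [kgtMetric, Matrix.fromBlocks_apply₂₂, Matrix.diagonal_apply]
    split_ifs
    · fun_prop
    · exact contDiffAt_const.mul ((hs _).pow 2)
    · exact contDiffAt_const

variable (lam H) in
/-- An orthonormal frame, up to the sign of its first vector. -/
def orthoFrame (p : Coord N → ℝ) : Matrix (Coord N) (Coord N) ℝ :=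
  Matrix.fromBlocks !![1, 1; (-1 - guu lam H p) / 2, (1 - guu lam H p) / 2] 0 0
    (Matrix.diagonal fun i : Fin (N - 1) × Fin 2 =>
      √|lam| * if i.2 = 0 then 1 else 1 / sFun lam (p (cx i.1)))

/-- The vector `∂_u + t ∂_v` has square `g_uu + 2 t`, so `t = (∓1 - g_uu) / 2` gives `∓1`, and the
two choices are orthogonal. -/
lemma transpose_orthoFrame_mul_mul (hlam : lam ≠ 0) {p : Coord N → ℝ}
    (hs : ∀ α, sFun lam (p (cx α)) ≠ 0) :
    (orthoFrame lam H p).transpose * kgtMetric lam H p * orthoFrame lam H p =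
      Matrix.diagonal (fun i => if i = cu then -1 else 1) := by
  have hl : |lam| ≠ 0 := abs_ne_zero.mpr hlam
  have hq : √|lam| ^ 2 = |lam| := Real.sq_sqrt (abs_nonneg _)
  rw [kgtMetric, orthoFrame, Matrix.fromBlocks_transpose, Matrix.fromBlocks_multiply,
    Matrix.fromBlocks_multiply]
  simp only [Matrix.mul_zero, Matrix.zero_mul, add_zero, zero_add, Matrix.diagonal_mul_diagonal,
    Matrix.diagonal_transpose, Matrix.transpose_zero]
  have hd : (Matrix.diagonal (fun i : Coord N => if i = cu then (-1 : ℝ) else 1)) =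
      Matrix.fromBlocks !![-1, 0; 0, 1] 0 0 1 := by
    rw [← Matrix.diagonal_one, show !![(-1 : ℝ), 0; 0, 1] = Matrix.diagonal ![-1, 1] by
      ext i j; fin_cases i <;> fin_cases j <;> simp, Matrix.fromBlocks_diagonal]
    congr 1
    funext i
    rcases i with i | i
    · fin_cases i <;> simp
    · simp
  rw [hd]
  congr 1
  · ext i j
    fin_cases i <;> fin_cases j <;> simp [Matrix.mul_apply, Fin.sum_univ_two, guu] <;> ring
  · rw [← Matrix.diagonal_one]
    congr 1
    funext i
    have := hs i.1
    split_ifs <;> field_simp <;> exact hq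

lemma isLorentzianOn_kgtMetric (hlam : lam ≠ 0) (hW : IsOpen W) (hH : ContDiffOn ℝ ∞ H W)
    (hs : ∀ w ∈ W, ∀ α, sFun lam (w.2.1 α) ≠ 0) :
    IsLorentzianOn (kgtMetric lam H) (toHSpace ⁻¹' W) := by
  refine ⟨fun a b p hp => (contDiffAt_kgtMetric hW hH hp a b).contDiffWithinAt, fun p hp => ?_⟩
  have h := transpose_orthoFrame_mul_mul (H := H) hlam (p := p) fun α => hs (toHSpace p) hp α
  refine ⟨cu, orthoFrame lam H p, ?_, h⟩
  have h2 := congrArg Matrix.det h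
  rw [Matrix.det_mul, Matrix.det_diagonal] at h2
  refine isUnit_iff_ne_zero.mpr fun h0 => ?_
  rw [h0, mul_zero] at h2
  have h3 := h2.symm
  rw [Finset.prod_eq_zero_iff] at h3
  obtain ⟨i, -, hi⟩ := h3
  split_ifs at hi <;> norm_num at hi

end Lorentzian

/-! ### Consequences of the Einstein condition -/

section Einstein

variable {N : ℕ} {lam : ℝ} {H : HSpace N → ℝ} {W : Set (HSpace N)}

lemma kgtMetric_mul_inv (hlam : lam ≠ 0) (hs : ∀ w ∈ W, ∀ α, sFun lam (w.2.1 α) ≠ 0)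
    {p : Coord N → ℝ} (hp : p ∈ toHSpace ⁻¹' W) :
    kgtMetric lam H p * (kgtMetric lam H p)⁻¹ = 1 := by
  have h : ∀ α, sFun lam (p (cx α)) ≠ 0 := fun α => hs (toHSpace p) hp α
  rw [inv_kgtMetric hlam h, kgtMetric_mul_kgtInv hlam h]

lemma ricci_kgtMetric_of_boxH (hlam : lam ≠ 0) (hW : IsOpen W) (hH : ContDiffOn ℝ ∞ H W)
    (hs : ∀ w ∈ W, ∀ α, sFun lam (w.2.1 α) ≠ 0)
    (hbox : ∀ p ∈ toHSpace ⁻¹' W, boxH lam H p = 0) {p : Coord N → ℝ}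
    (hp : p ∈ toHSpace ⁻¹' W) (i : Fin 2 → Coord N) :
    ricci (kgtMetric lam H) p i = lam * kgtMetric lam H p (i 0) (i 1) := by
  rw [ricci_kgtMetric hlam hW hH hs hp, hbox p hp]
  simp

lemma covD_eq_zero_of_eq_smul_kgtMetric (hlam : lam ≠ 0) (hW : IsOpen W)
    (hH : ContDiffOn ℝ ∞ H W) (hs : ∀ w ∈ W, ∀ α, sFun lam (w.2.1 α) ≠ 0)
    {T : TensorField (Coord N) 2} {c : ℝ}
    (hT : ∀ p ∈ toHSpace ⁻¹' W, ∀ i, T p i = c * kgtMetric lam H p (i 0) (i 1))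
    {p : Coord N → ℝ} (hp : p ∈ toHSpace ⁻¹' W) (i : Fin 3 → Coord N) :
    covD (kgtMetric lam H) T p i = 0 :=
  covD_eq_zero_of_eq_smul_metric (isOpen_preimage_toHSpace hW) kgtMetric_comm
    (fun _ hq => kgtMetric_mul_inv hlam hs hq)
    (fun _ hq a b => (contDiffAt_kgtMetric hW hH hq a b).differentiableAt (by simp)) hT hp i

lemma covDIter_ricci_kgtMetric (hlam : lam ≠ 0) (hW : IsOpen W)
    (hH : ContDiffOn ℝ ∞ H W) (hs : ∀ w ∈ W, ∀ α, sFun lam (w.2.1 α) ≠ 0)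
    (hbox : ∀ p ∈ toHSpace ⁻¹' W, boxH lam H p = 0) {j : ℕ} (hj : j ≠ 0)
    {p : Coord N → ℝ} (hp : p ∈ toHSpace ⁻¹' W) (i : Fin (2 + j) → Coord N) :
    covDIter (kgtMetric lam H) (ricci (kgtMetric lam H)) j p i = 0 :=
  covDIter_eq_zero_of_eq_smul_metric (isOpen_preimage_toHSpace hW) kgtMetric_comm
    (fun _ hq => kgtMetric_mul_inv hlam hs hq)
    (fun _ hq a b => (contDiffAt_kgtMetric hW hH hq a b).differentiableAt (by simp))
    (fun _ hq i => ricci_kgtMetric_of_boxH hlam hW hH hs hbox hq i) hj hp i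

end Einstein

/-! ### The null frame of the metric -/

section Frame

variable {N : ℕ} {lam : ℝ} {H : HSpace N → ℝ} {W : Set (HSpace N)}

variable (lam H) in
/-- The components of the vectors `∂_u - (g_{uu} / 2) ∂_v`, `∂_v` and
`(|lam| / 2) (∂_x + (i / s) ∂_y)`, `∂_x - (i / s) ∂_y`. -/
def nullFrame (p : Coord N → ℝ) : Matrix (Coord N) (Option (Fin (N - 1)) × Fin 2) ℂ
  | .inl i, (none, k) => (!![1, 0; -(guu lam H p : ℂ) / 2, 1] : Matrix _ _ ℂ) i k
  | .inr (α, j), (some β, k) => if α = β then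
      (!![((|lam| : ℝ) : ℂ) / 2, 1;
        ((|lam| : ℝ) : ℂ) / 2 * (Complex.I / (sFun lam (p (cx α)) : ℂ)),
        -(Complex.I / (sFun lam (p (cx α)) : ℂ))] : Matrix _ _ ℂ) j k else 0
  | _, _ => 0

lemma sum_nullFrame_none (p : Coord N → ℝ) (i : Fin 2) (X : Coord N → ℂ) :
    ∑ a, nullFrame lam H p a (none, i) * X a =
      (if i = 0 then X cu - (guu lam H p : ℂ) / 2 * X cv else X cv) := by
  fin_cases i <;> simp [Fintype.sum_sum_type, nullFrame]
  ring

lemma sum_nullFrame_some (p : Coord N → ℝ) (α : Fin (N - 1)) (i : Fin 2) (X : Coord N → ℂ) :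
    ∑ a, nullFrame lam H p a (some α, i) * X a =
      (if i = 0 then ((|lam| : ℝ) : ℂ) / 2 *
          (X (cx α) + Complex.I / (sFun lam (p (cx α)) : ℂ) * X (cy α))
        else X (cx α) - Complex.I / (sFun lam (p (cx α)) : ℂ) * X (cy α)) := by
  fin_cases i <;> simp [Fintype.sum_sum_type, Fintype.sum_prod_type, nullFrame, ite_mul] <;> ring

lemma conj_apply {ι κ : Type} [Fintype ι] [Fintype κ] (P : Matrix ι κ ℂ) (M : Matrix ι ι ℂ)
    (k l : κ) : (P.transpose * M * P) k l = ∑ a, P a k * ∑ b, P b l * M a b := by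
  simp only [Matrix.mul_apply, Matrix.transpose_apply, Finset.sum_mul, Finset.mul_sum]
  rw [Finset.sum_comm]
  exact Finset.sum_congr rfl fun _ _ => Finset.sum_congr rfl fun _ _ => by ring

variable (lam H) in
/-- The block `β` of the metric. -/
def blockMetric (p : Coord N → ℝ) (β : Option (Fin (N - 1))) : Matrix (Coord N) (Coord N) ℂ :=
  Matrix.of fun a b => if blk a = β then (kgtMetric lam H p a b : ℂ) else 0

/-- The square of the covector `du`. -/
def duSq : Matrix (Coord N) (Coord N) ℂ := Matrix.of fun a b => if a = cu ∧ b = cu then 1 else 0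

variable (lam H) in
/-- The complex components of the metric. -/
def metricC (p : Coord N → ℝ) : Matrix (Coord N) (Coord N) ℂ :=
  (kgtMetric lam H p).map Complex.ofReal

variable (lam H) in
/-- The complex components of `waveTensor`. -/
def waveC (p : Coord N → ℝ) : Matrix (Coord N) (Coord N) ℂ :=
  Matrix.of fun a b => (waveTensor lam H p a b : ℂ)

/-- The vectors `∂_x ± (i / s) ∂_y` are null with scalar product `2 / |lam|`, which the factor
`|lam| / 2` normalizes to `1`. -/
lemma conj_blockMetric (hlam : lam ≠ 0) (hs : ∀ w ∈ W, ∀ α, sFun lam (w.2.1 α) ≠ 0)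
    {p : Coord N → ℝ} (hp : p ∈ toHSpace ⁻¹' W) (β : Option (Fin (N - 1))) :
    (nullFrame lam H p).transpose * blockMetric lam H p β * nullFrame lam H p = nullBlock β := by
  have hl : ((|lam| : ℝ) : ℂ) ≠ 0 := Complex.ofReal_ne_zero.mpr (abs_ne_zero.mpr hlam)
  ext ⟨a, i⟩ ⟨b, j⟩
  rw [conj_apply]
  rcases a with _ | α
  · rw [sum_nullFrame_none]
    rcases b with _ | γ
    · simp only [sum_nullFrame_none]
      rcases β with _ | β
      · fin_cases i <;> fin_cases j <;> simp [blockMetric, nullBlock, opp, blk, kgtMetric, guu] <;>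
          ring
      · fin_cases i <;> fin_cases j <;> simp [blockMetric, nullBlock, opp, blk, kgtMetric, guu]
    · simp only [sum_nullFrame_some]
      have h : ∀ i j, blockMetric lam H p β (.inl i) (.inr j) = 0 := fun i j => by
        simp [blockMetric, kgtMetric_eq_zero_of_blk (lam := lam) (H := H) (p := p) (a := .inl i)
          (b := .inr j) (by simp [blk])]
      simp [cu, cv, cx, cy, h, nullBlock, opp]
  · rw [sum_nullFrame_some]
    rcases b with _ | γ
    · simp only [sum_nullFrame_none]
      have h : ∀ i j, blockMetric lam H p β (.inr i) (.inl j) = 0 := fun i j => by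
        simp [blockMetric, kgtMetric_eq_zero_of_blk (lam := lam) (H := H) (p := p) (a := .inr i)
          (b := .inl j) (by simp [blk])]
      simp [cu, cv, cx, cy, h, nullBlock, opp]
    · simp only [sum_nullFrame_some]
      have h0 : (sFun lam (p (cx α)) : ℂ) ≠ 0 :=
        Complex.ofReal_ne_zero.mpr (hs (toHSpace p) hp α)
      by_cases hβ : some α = β
      · subst hβ
        by_cases hγ : α = γ
        · subst hγ
          fin_cases i <;> fin_cases j <;>
            simp [blockMetric, nullBlock, opp, blk, kgtMetric] <;> field_simp <;>
              simp [Complex.I_sq] <;> ring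
        · fin_cases i <;> fin_cases j <;>
            simp [blockMetric, nullBlock, opp, blk, kgtMetric, hγ, Ne.symm hγ]
      · fin_cases i <;> fin_cases j <;>
          simp [blockMetric, nullBlock, opp, blk, kgtMetric, hβ]

lemma sum_blockMetric (p : Coord N → ℝ) : ∑ β, blockMetric lam H p β = metricC lam H p := by
  ext a b
  simp [Matrix.sum_apply, blockMetric, metricC]

lemma sum_nullBlock {A : Type} [Fintype A] [DecidableEq A] :
    ∑ β : Option A, nullBlock β = (nullMetric : Matrix (Option A × Fin 2) _ ℂ) := by
  ext a b
  rw [Matrix.sum_apply]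
  simp only [nullBlock, nullMetric, Matrix.of_apply, ite_and]
  split_ifs
  · rw [Finset.sum_ite_eq]; simp
  · simp

lemma conj_metricC (hlam : lam ≠ 0) (hs : ∀ w ∈ W, ∀ α, sFun lam (w.2.1 α) ≠ 0)
    {p : Coord N → ℝ} (hp : p ∈ toHSpace ⁻¹' W) :
    (nullFrame lam H p).transpose * metricC lam H p * nullFrame lam H p =
      (nullMetric : Matrix (Option (Fin (N - 1)) × Fin 2) _ ℂ) := by
  rw [← sum_blockMetric, Matrix.mul_sum, Matrix.sum_mul, ← sum_nullBlock]
  exact Finset.sum_congr rfl fun β _ => conj_blockMetric hlam hs hp β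

lemma conj_duSq (p : Coord N → ℝ) :
    (nullFrame lam H p).transpose * (duSq : Matrix (Coord N) _ ℂ) *
      nullFrame lam H p = (nullSq : Matrix (Option (Fin (N - 1)) × Fin 2) _ ℂ) := by
  ext ⟨a, i⟩ ⟨b, j⟩
  rw [conj_apply]
  rcases a with _ | α <;> rcases b with _ | γ <;>
    simp only [sum_nullFrame_none, sum_nullFrame_some] <;> fin_cases i <;> fin_cases j <;>
      simp [duSq, nullSq]

lemma isTransverse_conj_waveC (p : Coord N → ℝ) :
    IsTransverse ((nullFrame lam H p).transpose * waveC lam H p * nullFrame lam H p) := by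
  rintro ⟨a, i⟩ ⟨b, j⟩ h
  rw [conj_apply]
  rcases h with rfl | rfl
  · rw [sum_nullFrame_none]
    simp [waveC, waveTensor_inl_left]
  · simp only [sum_nullFrame_none]
    simp [waveC, waveTensor_inl_right]

/-- The equivalence between the coordinates and the vectors of the null frame. -/
def coordEquiv : Coord N ≃ Option (Fin (N - 1)) × Fin 2 where
  toFun := Sum.elim (fun i => (none, i)) fun i => (some i.1, i.2)
  invFun x := x.1.elim (Sum.inl x.2) fun α => Sum.inr (α, x.2)
  left_inv x := by rcases x with x | x <;> rfl
  right_inv x := by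
    obtain ⟨_ | α, i⟩ := x <;> rfl

variable (lam H) in
/-- The inverse of the null frame. -/
def nullCoframe (p : Coord N → ℝ) : Matrix (Option (Fin (N - 1)) × Fin 2) (Coord N) ℂ :=
  (nullMetric : Matrix (Option (Fin (N - 1)) × Fin 2) _ ℂ) * (nullFrame lam H p).transpose *
    metricC lam H p

lemma nullCoframe_mul_nullFrame (hlam : lam ≠ 0) (hs : ∀ w ∈ W, ∀ α, sFun lam (w.2.1 α) ≠ 0)
    {p : Coord N → ℝ} (hp : p ∈ toHSpace ⁻¹' W) : nullCoframe lam H p * nullFrame lam H p = 1 := by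
  rw [nullCoframe, Matrix.mul_assoc nullMetric, Matrix.mul_assoc nullMetric,
    conj_metricC hlam hs hp, nullMetric_mul_self]

lemma nullFrame_mul_nullCoframe (hlam : lam ≠ 0) (hs : ∀ w ∈ W, ∀ α, sFun lam (w.2.1 α) ≠ 0)
    {p : Coord N → ℝ} (hp : p ∈ toHSpace ⁻¹' W) : nullFrame lam H p * nullCoframe lam H p = 1 :=
  -- The index types differ but are equivalent, so a left inverse is also a right inverse.
  (Matrix.mul_eq_one_comm_of_equiv coordEquiv.symm).mp (nullCoframe_mul_nullFrame hlam hs hp)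

variable (lam H) in
/-- The complex components of the inverse metric. -/
def inverseC (p : Coord N → ℝ) : Matrix (Coord N) (Coord N) ℂ :=
  (kgtMetric lam H p)⁻¹.map Complex.ofReal

lemma metricC_mul_inverseC (hlam : lam ≠ 0) (hs : ∀ w ∈ W, ∀ α, sFun lam (w.2.1 α) ≠ 0)
    {p : Coord N → ℝ} (hp : p ∈ toHSpace ⁻¹' W) : metricC lam H p * inverseC lam H p = 1 := by
  have h := congrArg (fun M => M.map Complex.ofReal) (kgtMetric_mul_inv (H := H) hlam hs hp)
  have h2 : (kgtMetric lam H p * (kgtMetric lam H p)⁻¹).map Complex.ofReal =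
      metricC lam H p * inverseC lam H p := Matrix.map_mul (f := Complex.ofRealHom)
  rw [← h2]
  refine h.trans (Matrix.map_one _ Complex.ofReal_zero Complex.ofReal_one)

lemma transpose_metricC (p : Coord N → ℝ) : (metricC lam H p).transpose = metricC lam H p := by
  rw [metricC, ← Matrix.transpose_map, transpose_kgtMetric]

lemma conj_inverseC (hlam : lam ≠ 0) (hs : ∀ w ∈ W, ∀ α, sFun lam (w.2.1 α) ≠ 0)
    {p : Coord N → ℝ} (hp : p ∈ toHSpace ⁻¹' W) :
    nullCoframe lam H p * inverseC lam H p * (nullCoframe lam H p).transpose =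
      (nullMetric : Matrix (Option (Fin (N - 1)) × Fin 2) _ ℂ) :=
  conj_inv_of_conj_eq (conj_metricC hlam hs hp) nullMetric_mul_self nullMetric_transpose
    (transpose_metricC p) (metricC_mul_inverseC hlam hs hp)

lemma inverseC_eq (hlam : lam ≠ 0) (hs : ∀ w ∈ W, ∀ α, sFun lam (w.2.1 α) ≠ 0)
    {p : Coord N → ℝ} (hp : p ∈ toHSpace ⁻¹' W) :
    nullFrame lam H p * (nullMetric : Matrix (Option (Fin (N - 1)) × Fin 2) _ ℂ) *
      (nullFrame lam H p).transpose = inverseC lam H p := by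
  have h := nullFrame_mul_nullCoframe (H := H) hlam hs hp
  have h2 := congrArg Matrix.transpose h
  rw [Matrix.transpose_mul, Matrix.transpose_one] at h2
  rw [← conj_inverseC (H := H) hlam hs hp, Matrix.mul_assoc, Matrix.mul_assoc _ _
    (nullFrame lam H p).transpose, h2,
    Matrix.mul_one, ← Matrix.mul_assoc, h, Matrix.one_mul]

/-- The sum over opposite pairs is the trace with respect to the null metric. Cyclicity of the trace
turns it into the trace with respect to the inverse metric in coordinates, which is `-boxH / 2`. -/
lemma sum_conj_waveC_opp (hlam : lam ≠ 0) (hW : IsOpen W) (hH : ContDiffOn ℝ ∞ H W)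
    (hs : ∀ w ∈ W, ∀ α, sFun lam (w.2.1 α) ≠ 0) {p : Coord N → ℝ} (hp : p ∈ toHSpace ⁻¹' W)
    (hbox : boxH lam H p = 0) :
    ∑ a, ((nullFrame lam H p).transpose * waveC lam H p * nullFrame lam H p) a (opp a) = 0 := by
  have e1 : ∀ M : Matrix (Option (Fin (N - 1)) × Fin 2) (Option (Fin (N - 1)) × Fin 2) ℂ,
      ∑ a, M a (opp a) = (M * nullMetric).trace := by
    intro M
    refine Finset.sum_congr rfl fun a _ => ?_
    simp only [Matrix.diag_apply, Matrix.mul_apply, nullMetric, Matrix.of_apply]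
    rw [Fintype.sum_eq_single (opp a)]
    · simp [opp_opp]
    · intro b hb
      rw [if_neg, mul_zero]
      rintro rfl
      exact hb (opp_opp b).symm
  rw [e1, Matrix.mul_assoc, Matrix.mul_assoc, Matrix.trace_mul_comm, Matrix.mul_assoc,
    inverseC_eq hlam hs hp, inverseC, inv_kgtMetric hlam fun α => hs (toHSpace p) hp α]
  have e2 := sum_kgtInv_mul_waveTensor hs hW hH hp
  rw [hbox, mul_zero] at e2
  have e3 : (waveC lam H p * (kgtInv lam H p).map Complex.ofReal).trace =
      ((∑ a, kgtInv lam H p a a * waveTensor lam H p a a : ℝ) : ℂ) := by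
    rw [Complex.ofReal_sum]
    refine Finset.sum_congr rfl fun a _ => ?_
    simp only [Matrix.diag_apply, Matrix.mul_apply, waveC, Matrix.of_apply, Matrix.map_apply]
    rw [Fintype.sum_eq_single a]
    · push_cast; ring
    · intro b hb
      rcases a with a | a
      · simp [waveTensor_inl_left]
      · rcases b with b | b
        · simp [waveTensor_inl_right]
        · have : b ≠ a := fun h => hb (by rw [h])
          simp [kgtInv, this]
  rw [e3, e2, Complex.ofReal_zero]

variable (lam H) in
/-- The complex components of the curvature tensor. -/
def riemannC (p : Coord N → ℝ) : (Fin 4 → Coord N) → ℂ :=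
  fun i => (riemann (kgtMetric lam H) p i : ℂ)

lemma riemannC_eq (hlam : lam ≠ 0) (hW : IsOpen W) (hH : ContDiffOn ℝ ∞ H W)
    (hs : ∀ w ∈ W, ∀ α, sFun lam (w.2.1 α) ≠ 0) {p : Coord N → ℝ} (hp : p ∈ toHSpace ⁻¹' W) :
    riemannC lam H p = curvModel (lam : ℂ) (blockMetric lam H p) duSq (waveC lam H p) := by
  funext i
  -- The product of a block metric with itself counts each term twice, whence `lam / 2` in
  -- `curvModel`.
  have e1 : ∑ β, kulkarniNomizu (blockMetric lam H p β) (blockMetric lam H p β) i =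
      2 * (if blk (i 0) = blk (i 1) then
        (kgtMetric lam H p (i 0) (i 2) * kgtMetric lam H p (i 1) (i 3) -
          kgtMetric lam H p (i 0) (i 3) * kgtMetric lam H p (i 1) (i 2) : ℂ) else 0) := by
    rw [Fintype.sum_eq_single (blk (i 0))]
    · by_cases h : blk (i 0) = blk (i 1)
      · simp [kulkarniNomizu, blockMetric, h]
        ring
      · simp [kulkarniNomizu, blockMetric, h, Ne.symm h]
    · intro β hβ
      simp [kulkarniNomizu, blockMetric, hβ.symm]
  rw [riemannC, riemann_kgtMetric hlam hW hH hs hp, curvModel, e1]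
  push_cast
  simp only [kulkarniNomizu, duSq, waveC, Matrix.of_apply, ite_and, apply_ite Complex.ofReal,
    Complex.ofReal_sub, Complex.ofReal_mul, Complex.ofReal_zero, Complex.ofReal_one]
  split_ifs <;> ring

lemma frameChange_riemannC (hlam : lam ≠ 0) (hW : IsOpen W) (hH : ContDiffOn ℝ ∞ H W)
    (hs : ∀ w ∈ W, ∀ α, sFun lam (w.2.1 α) ≠ 0) {p : Coord N → ℝ} (hp : p ∈ toHSpace ⁻¹' W) :
    frameChange (nullFrame lam H p) (riemannC lam H p) = nullCurv (lam : ℂ)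
      ((nullFrame lam H p).transpose * waveC lam H p * nullFrame lam H p) := by
  rw [riemannC_eq hlam hW hH hs hp, frameChange_curvModel, conj_duSq]
  simp only [conj_blockMetric hlam hs hp]
  rfl

/-- A natural operation maps the metric to a constant multiple of itself. -/
theorem exists_natural_eq_smul_metricC (hlam : lam ≠ 0) (hW : IsOpen W)
    (hH : ContDiffOn ℝ ∞ H W) (hs : ∀ w ∈ W, ∀ α, sFun lam (w.2.1 α) ≠ 0)
    (hbox : ∀ p ∈ toHSpace ⁻¹' W, boxH lam H p = 0) {F : TwoTensorOp} (hF : IsNatural F) :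
    ∃ c : ℂ, ∀ p ∈ toHSpace ⁻¹' W,
      F _ (metricC lam H p) (inverseC lam H p) (riemannC lam H p) = c • metricC lam H p := by
  -- The factor is chosen before the point: only `h` varies with the point, and the factor is
  -- independent of it.
  obtain ⟨c, hc⟩ := exists_nullValue_eq_smul (A := Fin (N - 1)) hF (lam : ℂ)
  refine ⟨c, fun p hp => ?_⟩
  have h1 := nullFrame_mul_nullCoframe (H := H) hlam hs hp
  have h2 := nullCoframe_mul_nullFrame (H := H) hlam hs hp
  have h3 := congrArg Matrix.transpose h1
  rw [Matrix.transpose_mul, Matrix.transpose_one] at h3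
  have h4 := hF.equivariant _ _ h1 h2 (metricC lam H p) (inverseC lam H p) (riemannC lam H p)
  rw [conj_metricC hlam hs hp, conj_inverseC hlam hs hp, frameChange_riemannC hlam hW hH hs hp]
    at h4
  have h5 : F _ nullMetric nullMetric _ = _ := hc _ (isTransverse_conj_waveC p)
    (sum_conj_waveC_opp hlam hW hH hs hp (hbox p hp))
  rw [h5, ← conj_metricC hlam hs hp] at h4
  have h6 : ∀ M : Matrix (Coord N) (Coord N) ℂ, (nullCoframe lam H p).transpose *
      ((nullFrame lam H p).transpose * M * nullFrame lam H p) * nullCoframe lam H p = M := by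
    intro M
    rw [Matrix.mul_assoc _ M, ← Matrix.mul_assoc _ (nullFrame lam H p).transpose, h3,
      Matrix.one_mul, Matrix.mul_assoc M, h1, Matrix.mul_one]
  rw [← h6 (F _ _ _ _), ← h4, Matrix.mul_smul, Matrix.smul_mul, h6]

/-- A real tensor field that is given by a natural operation is a constant multiple of
the metric. -/
theorem exists_eq_mul_kgtMetric (hlam : lam ≠ 0) (hW : IsOpen W)
    (hH : ContDiffOn ℝ ∞ H W) (hs : ∀ w ∈ W, ∀ α, sFun lam (w.2.1 α) ≠ 0)
    (hbox : ∀ p ∈ toHSpace ⁻¹' W, boxH lam H p = 0) {F : TwoTensorOp} (hF : IsNatural F)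
    {T : TensorField (Coord N) 2} (hT : ∀ p ∈ toHSpace ⁻¹' W, ∀ a b, (T p ![a, b] : ℂ) =
      F _ (metricC lam H p) (inverseC lam H p) (riemannC lam H p) a b) :
    ∃ c : ℝ, ∀ p ∈ toHSpace ⁻¹' W, ∀ a b, T p ![a, b] = c * kgtMetric lam H p a b := by
  obtain ⟨c, hc⟩ := exists_natural_eq_smul_metricC hlam hW hH hs hbox hF
  -- The tensor and the metric are real, so the real part of the factor suffices.
  refine ⟨c.re, fun p hp a b => ?_⟩
  have h := hT p hp a b
  rw [hc p hp, Matrix.smul_apply, metricC, Matrix.map_apply, smul_eq_mul] at h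
  have h2 := congrArg Complex.re h
  simpa using h2

end Frame

/-! ### Contractions -/

section Contractions

variable {ι : Type} [Fintype ι] [DecidableEq ι] {g : (ι → ℝ) → Matrix ι ι ℝ} {p : ι → ℝ}

lemma sum_inv_mul_metric (hsymm : ∀ a b, g p a b = g p b a) (h : g p * (g p)⁻¹ = 1) (a b : ι) :
    ∑ c, (g p)⁻¹ c a * g p c b = if b = a then 1 else 0 := by
  rw [← Matrix.one_apply, ← h, Matrix.mul_apply]
  exact Finset.sum_congr rfl fun c _ => by rw [hsymm c b, mul_comm]

/-- `ricci` is traced from `riemannUp`, whereas `evalAt` only sees the covariant curvature tensor;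
this links the two. -/
lemma ricci_eq_sum (hsymm : ∀ a b, g p a b = g p b a) (h : g p * (g p)⁻¹ = 1) (i : Fin 2 → ι) :
    ricci g p i = ∑ a, ∑ b, (g p)⁻¹ a b * riemann g p ![a, i 0, b, i 1] := by
  have h1 : ∀ b, ∑ a, (g p)⁻¹ a b * riemann g p ![a, i 0, b, i 1] =
      riemannUp g b (i 0) b (i 1) p := by
    intro b
    simp only [riemann, Finset.mul_sum]
    rw [Finset.sum_comm]
    have h2 : ∀ e, ∑ a, (g p)⁻¹ a b * (g p (![a, i 0, b, i 1] 0) e *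
        riemannUp g e (![a, i 0, b, i 1] 1) (![a, i 0, b, i 1] 2) (![a, i 0, b, i 1] 3) p) =
        (if e = b then 1 else 0) * riemannUp g e (i 0) b (i 1) p := by
      intro e
      rw [← sum_inv_mul_metric hsymm h, Finset.sum_mul]
      exact Finset.sum_congr rfl fun a _ => (mul_assoc _ _ _).symm
    simp only [h2, ite_mul, one_mul, zero_mul, Finset.sum_ite_eq', Finset.mem_univ, if_true]
  rw [Finset.sum_comm]
  simp only [h1, ricci]

lemma contract_of_eq_mul_metric (hsymm : ∀ a b, g p a b = g p b a) (h : g p * (g p)⁻¹ = 1)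
    {T : TensorField ι 2} {c : ℝ} (hT : ∀ a b, T p ![a, b] = c * g p a b) (i : Fin 0 → ι) :
    contract g T p i = c * Fintype.card ι := by
  have h1 : ∀ a b, T p (Fin.cons (α := fun _ => ι) a (Fin.cons (α := fun _ => ι) b i)) =
      c * g p a b := by
    intro a b
    rw [← hT]
    congr 1
    funext k
    fin_cases k <;> rfl
  simp only [contract, h1]
  rw [Finset.sum_comm]
  have h2 : ∀ b, ∑ a, (g p)⁻¹ a b * (c * g p a b) = c := by
    intro b
    have := sum_inv_mul_metric hsymm h b b
    rw [if_pos rfl] at this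
    calc _ = c * ∑ a, (g p)⁻¹ a b * g p a b := by
            rw [Finset.mul_sum]
            exact Finset.sum_congr rfl fun a _ => by ring
      _ = c := by rw [this, mul_one]
  simp only [h2, Finset.sum_const, Finset.card_univ, nsmul_eq_mul]
  ring

lemma contract_of_eq_zero {r : ℕ} {T : TensorField ι (r + 2)} (hT : ∀ i, T p i = 0)
    (i : Fin r → ι) : contract g T p i = 0 := by
  simp [contract, hT]

/-- The expression `R_{acbd} g^{cd}`. -/
def riemTraceExpr : CurvExpr 2 :=
  -- A contraction prepends its pair, so the slots read `c, d, a, b`; the permutation selects `a, c,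
  -- b, d`.
  .contr (.perm ⟨![2, 0, 3, 1], ![1, 3, 0, 2], by decide, by decide⟩ (.riem 0))

lemma eval_riemTraceExpr (a b : ι) : riemTraceExpr.eval g p ![a, b] =
    ∑ c, ∑ d, (g p)⁻¹ c d * riemann g p ![a, c, b, d] := by
  simp only [riemTraceExpr, CurvExpr.eval, contract]
  refine Finset.sum_congr rfl fun c _ => Finset.sum_congr rfl fun d _ => congrArg _ ?_
  refine congrArg (riemann g p) (funext fun k => ?_)
  fin_cases k <;> rfl

/-- The expression `R_{acde} R_b{}^{cde}`. -/
def riemRiemExpr : CurvExpr 2 :=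
  -- After three contractions the slots read `e, e', d, d', c, c', a, b`; the permutation selects
  -- `a, c, d, e` and `b, c', d', e'`.
  .contr (.contr (.contr (.perm (r := 8)
    ⟨![6, 4, 2, 0, 7, 5, 3, 1], ![3, 7, 2, 6, 1, 5, 0, 4], by decide, by decide⟩
    (.prod (r := 4) (s := 4) (.riem 0) (.riem 0)))))

lemma sum_six (f : ι → ι → ι → ι → ι → ι → ℝ) :
    ∑ c, ∑ d, ∑ e, ∑ c', ∑ d', ∑ e', f c d e c' d' e' =
      ∑ c, ∑ c', ∑ d, ∑ d', ∑ e, ∑ e', f c d e c' d' e' := by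
  refine Finset.sum_congr rfl fun c _ => ?_
  calc _ = ∑ d, ∑ c', ∑ e, ∑ d', ∑ e', f c d e c' d' e' :=
        Finset.sum_congr rfl fun d _ => Finset.sum_comm
    _ = ∑ c', ∑ d, ∑ e, ∑ d', ∑ e', f c d e c' d' e' := Finset.sum_comm
    _ = _ := Finset.sum_congr rfl fun c' _ => Finset.sum_congr rfl fun d _ => Finset.sum_comm

lemma eval_riemRiemExpr (a b : ι) : riemRiemExpr.eval g p ![a, b] = riemRiem g p ![a, b] := by
  rw [riemRiem, sum_six]
  simp only [riemRiemExpr, CurvExpr.eval, contract, Finset.mul_sum]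
  refine Finset.sum_congr rfl fun c _ => Finset.sum_congr rfl fun c' _ => ?_
  refine Finset.sum_congr rfl fun d _ => Finset.sum_congr rfl fun d' _ => ?_
  refine Finset.sum_congr rfl fun e _ => Finset.sum_congr rfl fun e' _ => ?_
  have h1 : ∀ X Y A B C D E : ℝ, X = D → Y = E →
      A * (B * (C * (X * Y))) = A * B * C * D * E := by
    rintro X Y A B C D E rfl rfl
    ring
  refine h1 _ _ _ _ _ _ _ ?_ ?_ <;> refine congrArg (riemann g p) (funext fun k => ?_) <;>
    fin_cases k <;> rfl

end Contractions

/-! ### Tensors constructed from the curvature of the metric -/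

section Main

variable {N : ℕ} {lam : ℝ} {H : HSpace N → ℝ} {W : Set (HSpace N)}

/-- `evalAt` sets all derivatives of the curvature to zero. This is correct here: those of the Ricci
tensor vanish by the Einstein condition, those of the Riemann tensor are excluded by `hE`. -/
lemma ofReal_eval (hlam : lam ≠ 0) (hW : IsOpen W) (hH : ContDiffOn ℝ ∞ H W)
    (hs : ∀ w ∈ W, ∀ α, sFun lam (w.2.1 α) ≠ 0)
    (hbox : ∀ p ∈ toHSpace ⁻¹' W, boxH lam H p = 0) {p : Coord N → ℝ}
    (hp : p ∈ toHSpace ⁻¹' W) {r : ℕ} (E : CurvExpr r) (hE : E.NoRiemannDerivatives)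
    (i : Fin r → Coord N) : (E.eval (kgtMetric lam H) p i : ℂ) =
      evalAt (metricC lam H p) (inverseC lam H p) (riemannC lam H p) E i := by
  induction E with
  | const c => rfl
  | metric => rfl
  | riem j =>
    obtain rfl : j = 0 := hE
    rfl
  | ric j =>
    rcases eq_or_ne j 0 with rfl | hj
    · have h := ricci_eq_sum (kgtMetric_comm p) (kgtMetric_mul_inv (H := H) hlam hs hp) i
      change ((ricci (kgtMetric lam H) p i : ℝ) : ℂ) = _
      rw [h]
      push_cast
      rfl
    · change ((covDIter (kgtMetric lam H) (ricci (kgtMetric lam H)) j p i : ℝ) : ℂ) = _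
      rw [covDIter_ricci_kgtMetric hlam hW hH hs hbox hj hp, Complex.ofReal_zero]
      exact (if_neg hj).symm
  | add T S hT hS =>
    simp only [CurvExpr.eval, evalAt, Complex.ofReal_add, hT hE.1, hS hE.2]
  | smul c T hT => simp only [CurvExpr.eval, evalAt, Complex.ofReal_mul, hT hE]
  | prod T S hT hS =>
    simp only [CurvExpr.eval, tprod, evalAt, Complex.ofReal_mul, hT hE.1, hS hE.2]
  | perm σ T hT => simp only [CurvExpr.eval, evalAt, hT hE]
  | contr T hT =>
    simp only [CurvExpr.eval, contract, evalAt, contrAt, Complex.ofReal_sum, Complex.ofReal_mul,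
      hT hE]
    rfl

lemma noRiemannDerivatives_of_order {r : ℕ} (T : CurvExpr r) (h : T.order ≤ 0) :
    T.NoRiemannDerivatives := by
  induction T with
  | const c => trivial
  | metric => trivial
  | riem j => exact Nat.le_zero.mp h
  | ric j => trivial
  | add T S hT hS => exact ⟨hT ((le_max_left _ _).trans h), hS ((le_max_right _ _).trans h)⟩
  | smul c T hT => exact hT h
  | prod T S hT hS => exact ⟨hT ((le_max_left _ _).trans h), hS ((le_max_right _ _).trans h)⟩
  | perm σ T hT => exact hT h
  | contr T hT => exact hT h

theorem exists_eval_eq_mul_kgtMetric (hlam : lam ≠ 0) (hW : IsOpen W)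
    (hH : ContDiffOn ℝ ∞ H W) (hs : ∀ w ∈ W, ∀ α, sFun lam (w.2.1 α) ≠ 0)
    (hbox : ∀ p ∈ toHSpace ⁻¹' W, boxH lam H p = 0) (E : CurvExpr 2)
    (hE : E.NoRiemannDerivatives) : ∃ c : ℝ, ∀ p ∈ toHSpace ⁻¹' W, ∀ a b,
      E.eval (kgtMetric lam H) p ![a, b] = c * kgtMetric lam H p a b :=
  exists_eq_mul_kgtMetric hlam hW hH hs hbox (isNatural_evalAt E) fun _ hp a b =>
    ofReal_eval hlam hW hH hs hbox hp E hE ![a, b]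

lemma solvesVacuum_of_eq_mul {ι : Type} [Fintype ι] [DecidableEq ι]
    {g : (ι → ℝ) → Matrix ι ι ℝ} {U : Set (ι → ℝ)} {T : TensorField ι 2}
    (h : ∃ c : ℝ, ∀ p ∈ U, ∀ a b, T p ![a, b] = c * g p a b) : SolvesVacuum T g U := by
  obtain ⟨c, hc⟩ := h
  exact ⟨-c, fun p hp a b => by rw [hc p hp]; ring⟩

lemma exists_lovelock_eq_mul_kgtMetric (hlam : lam ≠ 0) (hW : IsOpen W)
    (hH : ContDiffOn ℝ ∞ H W) (hs : ∀ w ∈ W, ∀ α, sFun lam (w.2.1 α) ≠ 0)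
    (hbox : ∀ p ∈ toHSpace ⁻¹' W, boxH lam H p = 0) (k : ℕ) : ∃ c : ℝ, ∀ p ∈ toHSpace ⁻¹' W,
      ∀ a b, lovelock k (kgtMetric lam H) p ![a, b] = c * kgtMetric lam H p a b := by
  refine exists_eq_mul_kgtMetric hlam hW hH hs hbox (isNatural_lovelockAt k) fun p hp a b => ?_
  simp only [lovelock, lovelockAt, deltaContr, Matrix.smul_apply, Matrix.mul_apply,
    Matrix.of_apply, smul_eq_mul, Finset.mul_sum, metricC, Matrix.map_apply, riemannMixed,
    mixedAt, inverseC, riemannC]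
  push_cast
  refine Finset.sum_congr rfl fun x _ => Finset.sum_congr rfl fun c _ =>
    Finset.sum_congr rfl fun d _ => ?_
  simp
  ring

lemma exists_lovelockTensor_eq_mul_kgtMetric (hlam : lam ≠ 0) (hW : IsOpen W)
    (hH : ContDiffOn ℝ ∞ H W) (hs : ∀ w ∈ W, ∀ α, sFun lam (w.2.1 α) ≠ 0)
    (hbox : ∀ p ∈ toHSpace ⁻¹' W, boxH lam H p = 0) (m : ℕ) (coef : ℕ → ℝ) :
    ∃ c : ℝ, ∀ p ∈ toHSpace ⁻¹' W, ∀ a b,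
      lovelockTensor m coef (kgtMetric lam H) p ![a, b] = c * kgtMetric lam H p a b := by
  choose c hc using exists_lovelock_eq_mul_kgtMetric hlam hW hH hs hbox
  refine ⟨∑ k ∈ Finset.range (m + 1), coef k * c k, fun p hp a b => ?_⟩
  rw [lovelockTensor, Finset.sum_mul]
  exact Finset.sum_congr rfl fun k _ => by rw [hc k p hp, mul_assoc]

/-! ### Quadratic gravity -/

lemma exists_quadraticGravityTensor_eq_zero (hlam : lam ≠ 0) (hW : IsOpen W)
    (hH : ContDiffOn ℝ ∞ H W) (hs : ∀ w ∈ W, ∀ α, sFun lam (w.2.1 α) ≠ 0)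
    (hbox : ∀ p ∈ toHSpace ⁻¹' W, boxH lam H p = 0) (κ α β γ : ℝ) (hκ : κ ≠ 0) :
    ∃ Λ₀ : ℝ, ∀ p ∈ toHSpace ⁻¹' W, ∀ a b,
      quadraticGravityTensor κ Λ₀ α β γ (kgtMetric lam H) p ![a, b] = 0 := by
  -- `c₁` and `c₂` are the factors of `R_{acbd} g^{cd}` and `R_{acde} R_b{}^{cde}`; their values are
  -- not needed.
  obtain ⟨c₁, h₁⟩ := exists_eval_eq_mul_kgtMetric hlam hW hH hs hbox riemTraceExpr rfl
  obtain ⟨c₂, h₂⟩ := exists_eval_eq_mul_kgtMetric hlam hW hH hs hbox riemRiemExpr ⟨rfl, rfl⟩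
  simp only [eval_riemTraceExpr] at h₁
  simp only [eval_riemRiemExpr] at h₂
  have hU : IsOpen (toHSpace ⁻¹' W : Set (Coord N → ℝ)) := isOpen_preimage_toHSpace hW
  have hinv : ∀ p ∈ toHSpace ⁻¹' W, kgtMetric lam H p * (kgtMetric lam H p)⁻¹ = 1 :=
    fun p hp => kgtMetric_mul_inv hlam hs hp
  have hric := fun (p : Coord N → ℝ) (hp : p ∈ toHSpace ⁻¹' W) (i : Fin 2 → Coord N) =>
    ricci_kgtMetric_of_boxH hlam hW hH hs hbox hp i
  set n : ℝ := (Fintype.card (Coord N) : ℝ) with hn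
  have hscal : ∀ p ∈ toHSpace ⁻¹' W, ∀ i, scalarCurv (kgtMetric lam H) p i = lam * n :=
    fun p hp i => contract_of_eq_mul_metric (kgtMetric_comm p) (hinv p hp)
      (fun a b => hric p hp ![a, b]) i
  have hein : ∀ p ∈ toHSpace ⁻¹' W, ∀ i, einstein (kgtMetric lam H) p i =
      (lam - 1 / 2 * (lam * n)) * kgtMetric lam H p (i 0) (i 1) := by
    intro p hp i
    rw [einstein, hric p hp, hscal p hp, metricTensor]
    ring
  -- The scalar curvature is constant and the Einstein tensor parallel, so every derivative term
  -- drops out.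
  have hds : ∀ p ∈ toHSpace ⁻¹' W, ∀ i,
      covD (kgtMetric lam H) (covD (kgtMetric lam H) (scalarCurv (kgtMetric lam H))) p i = 0 :=
    fun p hp i => covD_eq_zero_of_eq_zero hU
      (fun q hq j => covD_eq_zero_of_eq_const hU hscal hq j) hp i
  have hde : ∀ p ∈ toHSpace ⁻¹' W, ∀ i,
      covD (kgtMetric lam H) (covD (kgtMetric lam H) (einstein (kgtMetric lam H))) p i = 0 :=
    fun p hp i => covD_eq_zero_of_eq_zero hU
      (fun q hq j => covD_eq_zero_of_eq_smul_kgtMetric hlam hW hH hs hein hq j) hp i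
  have hup : ∀ p ∈ toHSpace ⁻¹' W, ∀ c d, ricciUp (kgtMetric lam H) c d p =
      lam * (kgtMetric lam H p)⁻¹ c d := by
    intro p hp c d
    have h : ∀ f, ∑ e, (kgtMetric lam H p)⁻¹ c e * kgtMetric lam H p e f =
        if c = f then 1 else 0 := by
      intro f
      rw [← Matrix.one_apply, ← Matrix.mul_apply, mul_eq_one_comm.mp (hinv p hp)]
    have hT : ((kgtMetric lam H p)⁻¹) d c = (kgtMetric lam H p)⁻¹ c d := by
      rw [← Matrix.transpose_apply (kgtMetric lam H p)⁻¹, Matrix.transpose_nonsing_inv,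
        transpose_kgtMetric]
    rw [ricciUp, Finset.sum_comm]
    calc _ = ∑ f, lam * (kgtMetric lam H p)⁻¹ d f *
          ∑ e, (kgtMetric lam H p)⁻¹ c e * kgtMetric lam H p e f := by
            refine Finset.sum_congr rfl fun f _ => ?_
            rw [Finset.mul_sum]
            refine Finset.sum_congr rfl fun e _ => ?_
            rw [hric p hp]
            simp
            ring
      _ = _ := by simp [h, hT]
  have hrr : ∀ p ∈ toHSpace ⁻¹' W, ∀ a b, riemRic (kgtMetric lam H) p ![a, b] =
      lam * c₁ * kgtMetric lam H p a b := by
    intro p hp a b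
    rw [mul_assoc, ← h₁ p hp, riemRic, Finset.mul_sum]
    refine Finset.sum_congr rfl fun c _ => ?_
    rw [Finset.mul_sum]
    refine Finset.sum_congr rfl fun d _ => ?_
    rw [hup p hp]
    simp
    ring
  have hricric : ∀ p ∈ toHSpace ⁻¹' W, ∀ a b, ricRic (kgtMetric lam H) p ![a, b] =
      lam ^ 2 * kgtMetric lam H p a b := by
    intro p hp a b
    rw [ricRic, Finset.sum_comm]
    calc _ = ∑ d, lam ^ 2 * kgtMetric lam H p b d *
          ∑ c, (kgtMetric lam H p)⁻¹ c d * kgtMetric lam H p c a := by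
            refine Finset.sum_congr rfl fun d _ => ?_
            rw [Finset.mul_sum]
            refine Finset.sum_congr rfl fun c _ => ?_
            rw [hric p hp, hric p hp, kgtMetric_comm p c a]
            simp
            ring
      _ = _ := by
        simp [sum_inv_mul_metric (kgtMetric_comm p) (hinv p hp), kgtMetric_comm p b a]
  have hric2 := fun p hp => contract_of_eq_mul_metric (kgtMetric_comm p) (hinv p hp)
    (hricric p hp) ![]
  have hriem2 := fun p hp => contract_of_eq_mul_metric (kgtMetric_comm p) (hinv p hp)
    (h₂ p hp) ![]
  -- All terms being multiples of the metric, the sum of their factors is affine in `Λ₀` with slope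
  -- `1 / κ`; this is its root.
  refine ⟨-(lam - 1 / 2 * (lam * n)) - κ * (2 * α * (lam * n) * (lam - 1 / 4 * (lam * n)) +
    2 * γ * (lam * n * lam - 2 * (lam * c₁) + c₂ - 2 * lam ^ 2 -
      1 / 4 * (c₂ * n - 4 * (lam ^ 2 * n) + (lam * n) ^ 2)) +
    2 * β * (lam * c₁ - 1 / 4 * (lam ^ 2 * n))), fun p hp a b => ?_⟩
  simp only [quadraticGravityTensor, hein p hp, hscal p hp, hric p hp, hds p hp,
    contract_of_eq_zero (hds p hp), contract_of_eq_zero (hde p hp), hrr p hp, hricric p hp,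
    h₂ p hp, hric2 p hp, hriem2 p hp, metricTensor, ← hn]
  simp only [Matrix.cons_val_zero, Matrix.cons_val_one]
  field_simp
  ring

end Main

end KGT

end

theorem mainTheorem8 (N : ℕ) (hN : 1 ≤ N) (lam : ℝ) (hlam : lam ≠ 0)
    (W : Set (KGT.HSpace N)) (hW : IsOpen W)
    (hs : ∀ w ∈ W, ∀ α, KGT.sFun lam (w.2.1 α) ≠ 0)
    (H : KGT.HSpace N → ℝ) (hH : ContDiffOn ℝ ∞ H W) :
    KGT.IsLorentzianOn (KGT.kgtMetric lam H) (KGT.toHSpace ⁻¹' W) ∧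
    (KGT.IsEinsteinOn (KGT.kgtMetric lam H) (KGT.toHSpace ⁻¹' W) ↔
      ∀ p ∈ KGT.toHSpace ⁻¹' W, KGT.boxH lam H p = 0) ∧
    ((∀ p ∈ KGT.toHSpace ⁻¹' W, KGT.boxH lam H p = 0) →
      KGT.IsKUniversal 0 (KGT.kgtMetric lam H) (KGT.toHSpace ⁻¹' W) ∧
      (∀ (L : KGT.CurvExpr 0) (E : KGT.CurvExpr 2),
        KGT.IsFieldTensor (KGT.Coord N) L E → E.NoRiemannDerivatives →
          KGT.SolvesVacuum (E.eval (KGT.kgtMetric lam H)) (KGT.kgtMetric lam H)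
            (KGT.toHSpace ⁻¹' W)) ∧
      (∀ (m : ℕ) (coef : ℕ → ℝ),
        KGT.SolvesVacuum (KGT.lovelockTensor m coef (KGT.kgtMetric lam H)) (KGT.kgtMetric lam H)
          (KGT.toHSpace ⁻¹' W)) ∧
      (∀ κ α β γ : ℝ, κ ≠ 0 → ∃ Λ₀ : ℝ, ∀ p ∈ KGT.toHSpace ⁻¹' W, ∀ a b,
        KGT.quadraticGravityTensor κ Λ₀ α β γ (KGT.kgtMetric lam H) p ![a, b] = 0)) := by
  refine ⟨KGT.isLorentzianOn_kgtMetric hlam hW hH hs,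
    KGT.isEinsteinOn_kgtMetric_iff hlam hW hH hs, fun hbox => ⟨?_, ?_, ?_, ?_⟩⟩
  · intro T hT _ _
    exact KGT.exists_eval_eq_mul_kgtMetric hlam hW hH hs hbox T
      (KGT.noRiemannDerivatives_of_order T hT)
  · intro L E _ hE
    exact KGT.solvesVacuum_of_eq_mul (KGT.exists_eval_eq_mul_kgtMetric hlam hW hH hs hbox E hE)
  · intro m coef
    exact KGT.solvesVacuum_of_eq_mul
      (KGT.exists_lovelockTensor_eq_mul_kgtMetric hlam hW hH hs hbox m coef)
  · exact KGT.exists_quadraticGravityTensor_eq_zero hlam hW hH hs hbox
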